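/- \textbf{Setting.} A \emph{network} $\Gamma=(V,E\cup\partial\Gamma)$ is a finite graph in which each vertex $x\in V$ has three numbered legs; each leg is either glued to exactly one other leg (a link in $E$; multiple links are allowed) or open (a link in $\partial\Gamma$, closed by a virtual single-valent boundary node, one for each open leg). Let $\partial\Gamma=A\cup B$ be a disjoint partition. A set $\sigma\subset E\cup\partial\Gamma$ of links \emph{separates} $A$ and $B$ if after its omission no boundary node of $A$ is connected to one of $B$. $\Gamma$ is \emph{coarse-grainable to a tree} if $V\cup\partial\Gamma$ has a partition into regions, with all boundary nodes in a common region and no region equal to the whole set, such that the graph whose nodes are the regions and whose links are the links of $\Gamma$ between different regions has no cycles (in particular no double links). \textbf{Diagrams.} Fix $N\ge2$; each vertex carries $N$ incoming and $N$ outgoing copies of its field, each with three arguments (one for each leg). A link of $E$ identifies the arguments of equal incoming copies, and of equal outgoing copies, at its two legs; at an open leg the $k$-th incoming argument is identified with the $\tau(k)$-th outgoing one. In the situation $Z_0^{(N)}$ the permutation is $\tau=\mathbb I$ at all open legs, in the situation $Z_A^{(N)}$ it is the cyclic permutation $\tau=\mathbb F$ on $A$ and $\mathbb I$ on $B$. A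 \emph{free local diagram} is given by $\pi_x\in S_N$ for $x\in V$: the three arguments $g_a$ of the incoming copy $k$ of $x$ and $\bar g_a$ of the outgoing copy $\pi_x(k)$ are joined by strands $\delta(h_{x,k}g_a\bar g_a^{-1})$. A \emph{diagram with a single local interaction process} is given by such permutations, a vertex $v$ and copies $i\neq j$: at $v$ the incoming copies $i,j$, with arguments $g^{(1)},g^{(2)}$, and the outgoing copies $\pi_v(i),\pi_v(j)$, with arguments $\bar g^{(1)},\bar g^{(2)}$, are joined instead by $$\delta(h_1g^{(1)}_1,h_3\bar g^{(1)}_1)\,\delta(h_1g^{(1)}_2,h_4\bar g^{(2)}_2)\,\delta(h_1g^{(1)}_3,h_2g^{(2)}_3)\,\delta(h_2g^{(2)}_1,h_4\bar g^{(2)}_1)\,\delta(h_2g^{(2)}_2,h_3\bar g^{(1)}_2)\,\delta(h_3\bar g^{(1)}_3,h_4\bar g^{(2)}_3)$$ with four independent gauge parameters. The faces $f$ of a diagram $\mathcal G$ are its closed strands. Its amplitude is $\mathcal A[\mathcal G]=\int\prod_l dh_l\prod_f\delta\big(\prod_{l\in\partial f}h_l^{\pm1}\big)$, over all gauge parameters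 with normalised Haar measure, and its divergence degree $\Omega$ is defined by $\mathcal A[\mathcal G]=\delta(e)^{\Omega[\mathcal G]}$. Here either (a) $G$ is a finite group of order $D\ge 2$ and $\delta=D\,1_{\{e\}}$, so that $\delta(e)=D$; or (b) $G$ is a compact group with a left-invariant metric whose Haar measure $\mu$ is locally uniformly doubling (for example $SU(2)$), and $\delta$ is replaced by a sequence of measurable functions $\delta_n\ge0$ with $\int\delta_n\,d\mu=1$, $\delta_n(g)=\delta_n(kgk^{-1})=\delta_n(g^{-1})\le\delta_n(e)$, $\delta_n(e)\to\infty$, such that for some $c>0$ and some radii $r_n>0$ one has $\delta_n\ge c\,\delta_n(e)$ on the closed ball $\bar B(e,r_n)$ and $\delta_n(e)\,\mu(\bar B(e,r_n))\ge c$ for all $n$; then amplitudes and degrees depend on $n$. For real $\lambda$ let $Z_{0}^{\lambda}$, $Z_A^{\lambda}$ be the sum of the amplitudes of all free local diagrams minus $\lambda$ times the sum of the amplitudes of all diagrams with a single local interaction process (over all permutations, vertices $v$ and ordered pairs $i\ne j$), in the respective boundary situation, and let $S_N(A)=\frac{1}{1-N}\ln\frac{Z_A^{\lambda}}{Z_0^{\lambda}}$,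 the approximated mean R\'enyi entropy up to linear order in $\lambda$. \textbf{Theorem.} Let $\Gamma$ be connected with $\partial\Gamma\neq\emptyset$, not coarse-grainable to a tree, and suppose that among the sets of links that separate $A$ and $B$ there is a unique one, $\sigma_{\min}$, of minimal cardinality. In the situation $Z_0^{(N)}$ let $\pi^*_x=\mathbb I$ for all $x$ and $\Omega^*=N(|E\cup\partial\Gamma|-|V|)$; in the situation $Z_A^{(N)}$ let $\pi^*_x=\mathbb F$ if $x$ is connected to $A$ after omission of $\sigma_{\min}$ and $\pi^*_x=\mathbb I$ otherwise, and $\Omega^*=N(|E\cup\partial\Gamma|-|V|)-(N-1)|\sigma_{\min}|$. In both situations: (a) For every finite group $G$ of order $D\ge2$, the free local diagram of $\pi^*$ has degree $\Omega^*$, and every other free local diagram and every diagram with a single local interaction process has strictly smaller degree. For every $\lambda\in\mathbb R$ there are $C$ and $D_0$, depending only on $\Gamma,A,N,\lambda$, such that for all finite groups of order $D=\delta(e)\ge D_0$ one has $Z_0^\lambda,Z_A^\lambda>0$ and $\big|S_N(A)-|\sigma_{\min}|\ln\delta(e)\big|\le C/\delta(e)$. (b) For every compact group and every regularisation as above, the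 degree of the free local diagram of $\pi^*$ tends to $\Omega^*$ as $n\to\infty$, and for every other free local diagram and every diagram with a single local interaction process there is $\omega<\Omega^*$ such that its degree is at most $\omega$ for all large $n$. For every $\lambda\in\mathbb R$ one has $Z_0^\lambda,Z_A^\lambda>0$ for all large $n$ and $S_N(A)=|\sigma_{\min}|\ln\delta_n(e)+O(1)$ as $n\to\infty$. -/

import Mathlib

open MeasureTheory Filter Topology Asymptotics

noncomputable section

open scoped Classical

namespace GFT

universe u v w

/-! ### Network graphs -/

/-- A three-valent open network graph with vertex set `V`. The legs of the vertex `x` are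
`(x, 0), (x, 1), (x, 2)`; the involution `glue` pairs two legs to a link of `E`, and its fixed
points are the open legs, that is, the elements of `∂Γ`. -/
structure Network (V : Type u) where
  glue : V × Fin 3 → V × Fin 3
  glue_glue : ∀ l, glue (glue l) = l

namespace Network

variable {V : Type u} (Γ : Network V)

/-- The open links `∂Γ`; each of them is closed by a virtual single-valent boundary node. -/
def OpenLeg : Type u := {l : V × Fin 3 // Γ.glue l = l}

/-- All links, that is, `E ∪ ∂Γ`. -/
def Link : Type u := {e : Sym2 (V × Fin 3) // ∃ l, e = s(l, Γ.glue l)}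

/-- The link that contains the leg `l`. -/
def link (l : V × Fin 3) : Γ.Link := ⟨s(l, Γ.glue l), l, rfl⟩

/-- The vertices together with the virtual boundary nodes. -/
abbrev Node : Type u := V ⊕ Γ.OpenLeg

/-- The node at the other end of the link of the leg `l` (whose first end is `l.1`). -/
def farEnd (l : V × Fin 3) : Γ.Node :=
  if h : Γ.glue l = l then Sum.inr ⟨l, h⟩ else Sum.inl (Γ.glue l).1

/-- The link `e` joins the nodes `x` and `y`. -/
def Joins (e : Γ.Link) (x y : Γ.Node) : Prop :=
  ∃ l, e = Γ.link l ∧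
    ((x = Sum.inl l.1 ∧ y = Γ.farEnd l) ∨ (y = Sum.inl l.1 ∧ x = Γ.farEnd l))

/-- The graph on all nodes that is left after omission of the links in `σ`. -/
def graphOff (σ : Set Γ.Link) : SimpleGraph Γ.Node :=
  SimpleGraph.fromRel fun x y => ∃ e, e ∉ σ ∧ Γ.Joins e x y

/-- `Γ` is connected. -/
def Connected : Prop := (Γ.graphOff ∅).Connected

/-- The link set `σ` separates the boundary region `A` from its complement `B = ∂Γ \ A`. -/
def Separates (A : Set Γ.OpenLeg) (σ : Set Γ.Link) : Prop :=
  ∀ a ∈ A, ∀ b ∉ A, ¬ (Γ.graphOff σ).Reachable (Sum.inr a) (Sum.inr b)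

/-- `σ` is a separating link set of minimal cardinality. -/
def IsMinCut (A : Set Γ.OpenLeg) (σ : Set Γ.Link) : Prop :=
  Γ.Separates A σ ∧ ∀ τ, Γ.Separates A τ → σ.ncard ≤ τ.ncard

/-- The links between two different regions `m`, `m'` of a partition of the nodes. -/
def linksBetween (P : Setoid Γ.Node) (m m' : Quotient P) : Set Γ.Link :=
  {e | ∃ x y, Γ.Joins e x y ∧ Quotient.mk P x = m ∧ Quotient.mk P y = m'}

/-- The coarse-grained graph of a partition (without the multiplicities of its links, which
are the numbers `(Γ.linksBetween P m m').ncard`). -/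
def coarseGraph (P : Setoid Γ.Node) : SimpleGraph (Quotient P) :=
  SimpleGraph.fromRel fun m m' => (Γ.linksBetween P m m').Nonempty

/-- `Γ` is coarse-grainable to a tree: the nodes have a partition, with the boundary nodes in a
common region and no region consisting of all nodes, whose coarse-grained graph has no cycles,
neither multiple links nor longer ones. -/
def CoarseGrainable : Prop :=
  ∃ P : Setoid Γ.Node,
    (∀ w w' : Γ.OpenLeg, Quotient.mk P (Sum.inr w) = Quotient.mk P (Sum.inr w')) ∧
    (∀ m : Quotient P, ∃ x, Quotient.mk P x ≠ m) ∧
    (∀ m m' : Quotient P, m ≠ m' → (Γ.linksBetween P m m').ncard ≤ 1) ∧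
    (Γ.coarseGraph P).IsAcyclic

end Network

/-! ### Stranded diagrams and their amplitudes -/

/-- A fully contracted stranded diagram. `P` is the set of strand ends (field arguments) and `L`
the set of edges (propagators) that carry a gauge parameter. `strand` pairs the two arguments
joined by a delta function of a propagation or interaction kernel, `contract` the two arguments
joined by the contraction pattern of the network. The delta function of a strand from `p` to
`p'` imposes `gauge p * g = gauge p' * g'` on the arguments `g`, `g'`. -/
structure StrandedDiagram (P : Type v) (L : Type w) where
  contract : P → P
  strand : P → P
  contract_invol : Function.Involutive contract
  strand_invol : Function.Involutive strand
  gauge : P → FreeGroup L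

namespace StrandedDiagram

variable {P : Type v} {L : Type w} (𝒢 : StrandedDiagram P L)

/-- Two strand ends are on the same closed strand. -/
def faceSetoid : Setoid P :=
  Relation.EqvGen.setoid fun p p' => p' = 𝒢.strand p ∨ p' = 𝒢.contract p

/-- The faces: closed strands. -/
def Face : Type v := Quotient 𝒢.faceSetoid

instance [Finite P] : Finite 𝒢.Face := inferInstanceAs (Finite (Quotient 𝒢.faceSetoid))

instance [Finite P] : Fintype 𝒢.Face := Fintype.ofFinite _

/-- The parallel transport `g' = transport p * g` along the strand from `p` to `strand p`. -/
def transport (p : P) : FreeGroup L := (𝒢.gauge (𝒢.strand p))⁻¹ * 𝒢.gauge p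

/-- One step along a face: a strand followed by a contraction. -/
def step (p : P) : P := 𝒢.contract (𝒢.strand p)

/-- The holonomy word collected on the way around the face through `p`, starting at `p`. -/
def word (p : P) : FreeGroup L :=
  ((List.range (Function.minimalPeriod 𝒢.step p)).map
    fun i => 𝒢.transport (𝒢.step^[i] p)).reverse.prod

/-- The holonomy of a face, with an arbitrary base point and orientation: a change of these
conjugates or inverts it. -/
def holonomy {G : Type*} [Group G] (h : L → G) (f : 𝒢.Face) : G :=
  FreeGroup.lift h (𝒢.word (Quotient.out (s := 𝒢.faceSetoid) f))

/-- The amplitude `∫ ∏ dh_l ∏_f δ(∏_{l ∈ ∂f} h_l)`. -/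
def amplitude [Finite P] [Fintype L] {G : Type*} [Group G] [MeasurableSpace G]
    (μ : Measure G) (δ : G → ℝ) : ℝ :=
  ∫ h : L → G, ∏ f : 𝒢.Face, δ (𝒢.holonomy h f) ∂(Measure.pi fun _ => μ)

/-- The divergence degree `Ω`, the exponent in `amplitude = δ(e) ^ Ω`. -/
def degree [Finite P] [Fintype L] {G : Type*} [Group G] [MeasurableSpace G]
    (μ : Measure G) (δ : G → ℝ) : ℝ :=
  Real.logb (δ 1) (𝒢.amplitude μ δ)

end StrandedDiagram

/-! ### Local processes -/

/-- The `N` incoming (`inl`) and the `N` outgoing (`inr`) copies of the field at a node. -/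
abbrev Copies (N : ℕ) : Type := Fin N ⊕ Fin N

/-- Propagation of the incoming copy `k` to the outgoing copy `π k`. -/
def freeStrand {N : ℕ} (π : Equiv.Perm (Fin N)) : Copies N → Copies N
  | Sum.inl k => Sum.inr (π k)
  | Sum.inr k => Sum.inl (π.symm k)

/-- The strands of a local process in which the incoming copies `i`, `j` and the outgoing copies
`π i`, `π j` interact and every other incoming copy `k` propagates to `π k`. The first argument
is the index of the leg: on the first one the interaction joins `i` with `π i` and `j` with
`π j`, on the second one `i` with `π j` and `j` with `π i`, on the third one `i` with `j` and
`π i` with `π j`. -/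
def intStrand {N : ℕ} (π : Equiv.Perm (Fin N)) (i j : Fin N) : Fin 3 → Copies N → Copies N
  | 0, c => freeStrand π c
  | 1, c => freeStrand (π * Equiv.swap i j) c
  | 2, Sum.inl k => if k = i then Sum.inl j else if k = j then Sum.inl i else Sum.inr (π k)
  | 2, Sum.inr k =>
      if k = π i then Sum.inr (π j) else if k = π j then Sum.inr (π i)
      else Sum.inl (π.symm k)

lemma freeStrand_invol {N : ℕ} (π : Equiv.Perm (Fin N)) :
    Function.Involutive (freeStrand π) := by
  rintro (k | k) <;> simp [freeStrand]

lemma intStrand_invol {N : ℕ} (π : Equiv.Perm (Fin N)) (i j : Fin N) (a : Fin 3) :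
    Function.Involutive (intStrand π i j a) := by
  intro c
  fin_cases a
  · exact freeStrand_invol π c
  · exact freeStrand_invol _ c
  · rcases c with k | k
    · by_cases h1 : k = i
      · by_cases h3 : j = i <;> simp [intStrand, h1, h3]
      · by_cases h2 : k = j
        · by_cases h3 : j = i <;> simp [intStrand, h2, h3]
        · simp [intStrand, h1, h2]
    · by_cases h1 : k = π i
      · by_cases h3 : j = i <;> simp [intStrand, h1, h3]
      · by_cases h2 : k = π j
        · by_cases h3 : j = i <;> simp [intStrand, h2, h3]
        · have h1' : π.symm k ≠ i := fun h => h1 (by rw [← h]; simp)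
          have h2' : π.symm k ≠ j := fun h => h2 (by rw [← h]; simp)
          simp [intStrand, h1, h2, h1', h2']

namespace Network

variable {V : Type u} (Γ : Network V)

/-- The field arguments: a leg of a vertex and one of the copies of its field. -/
abbrev Point (V : Type u) (N : ℕ) : Type u := (V × Fin 3) × Copies N

/-- The fixed propagation at a boundary node: the cyclic permutation on the region `R` and the
identity elsewhere. The region is empty for `Z_0` and equal to `A` for `Z_A`. -/
def boundaryPerm (N : ℕ) (R : Set Γ.OpenLeg) (x : Γ.OpenLeg) : Equiv.Perm (Fin N) :=
  if x ∈ R then finRotate N else 1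

/-- The contraction pattern: a link of `E` joins equal copies of its two legs; an open leg is
contracted through the fixed propagation of its boundary node. -/
def contraction (N : ℕ) (R : Set Γ.OpenLeg) (p : Point V N) : Point V N :=
  if h : Γ.glue p.1 = p.1 then (p.1, freeStrand (Γ.boundaryPerm N R ⟨p.1, h⟩) p.2)
  else (Γ.glue p.1, p.2)

lemma contraction_invol (N : ℕ) (R : Set Γ.OpenLeg) :
    Function.Involutive (Γ.contraction N R) := by
  rintro ⟨l, c⟩
  by_cases h : Γ.glue l = l
  · simp [contraction, h, freeStrand_invol _ c]
  · have h' : ¬ Γ.glue (Γ.glue l) = Γ.glue l := by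
      rw [Γ.glue_glue]; exact fun e => h e.symm
    simp [contraction, h, Γ.glue_glue, Ne.symm (a := Γ.glue l) (b := l) h]

/-- The diagram of the free theory with the local propagation `π x` at each vertex `x`. The copy
`k` of `x` has the gauge parameter `(x, k)`. -/
def freeDiagram {N : ℕ} (R : Set Γ.OpenLeg) (π : V → Equiv.Perm (Fin N)) :
    StrandedDiagram (Point V N) (V × Fin N) where
  contract := Γ.contraction N R
  strand p := (p.1, freeStrand (π p.1.1) p.2)
  contract_invol := Γ.contraction_invol N R
  strand_invol := by
    rintro ⟨l, c⟩
    simp [freeStrand_invol _ c]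
  gauge
    | (l, Sum.inl k) => FreeGroup.of (l.1, k)
    | (_, Sum.inr _) => 1

end Network

/-- The data of a diagram with a single local interaction process: permutations at all vertices,
the vertex of the interaction and the (ordered) pair of its interacting incoming copies. -/
structure Interaction (V : Type u) (N : ℕ) where
  perm : V → Equiv.Perm (Fin N)
  node : V
  fst : Fin N
  snd : Fin N
  fst_ne_snd : fst ≠ snd

instance {V : Type u} [Finite V] {N : ℕ} : Finite (Interaction V N) :=
  Finite.of_injective
    (β := (V → Equiv.Perm (Fin N)) × V × Fin N × Fin N)
    (fun x => (x.perm, x.node, x.fst, x.snd)) (by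
      rintro ⟨a, b, c, d, _⟩ ⟨a', b', c', d', _⟩ h
      simp only [Prod.mk.injEq] at h
      obtain ⟨rfl, rfl, rfl, rfl⟩ := h
      rfl)

instance {V : Type u} [Finite V] {N : ℕ} : Fintype (Interaction V N) := Fintype.ofFinite _

namespace Network

variable {V : Type u} (Γ : Network V)

/-- The diagram with a single local interaction process. The four interacting fields have
independent gauge parameters: `(x, i)` and `(x, j)` for the incoming ones, and two additional
ones for the outgoing ones. -/
def interactionDiagram {N : ℕ} (R : Set Γ.OpenLeg) (I : Interaction V N) :
    StrandedDiagram (Point V N) ((V × Fin N) ⊕ Fin 2) where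
  contract := Γ.contraction N R
  strand p :=
    (p.1, if p.1.1 = I.node then intStrand (I.perm p.1.1) I.fst I.snd p.1.2 p.2
      else freeStrand (I.perm p.1.1) p.2)
  contract_invol := Γ.contraction_invol N R
  strand_invol := by
    rintro ⟨l, c⟩
    by_cases h : l.1 = I.node
    · simp [h, intStrand_invol _ _ _ _ c]
    · simp [h, freeStrand_invol _ c]
  gauge
    | (l, Sum.inl k) => FreeGroup.of (Sum.inl (l.1, k))
    | (l, Sum.inr k) =>
        if l.1 = I.node ∧ k = I.perm l.1 I.fst then FreeGroup.of (Sum.inr 0)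
        else if l.1 = I.node ∧ k = I.perm l.1 I.snd then FreeGroup.of (Sum.inr 1)
        else 1

/-- The pattern with the domain wall `τ`: the cyclic permutation at the vertices that are
connected to the region `R` after omission of `τ`, the identity at the others. -/
def wallPattern (N : ℕ) (R : Set Γ.OpenLeg) (τ : Set Γ.Link) (x : V) : Equiv.Perm (Fin N) :=
  if ∃ a ∈ R, (Γ.graphOff τ).Reachable (Sum.inl x) (Sum.inr a) then finRotate N else 1

variable [Fintype V]

/-- The locally averaged expectation of `Z_R^(N)` up to linear order in the coupling: the sum of
the amplitudes of all free local diagrams, minus the coupling times the sum of the amplitudes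
of all diagrams with a single local interaction process. -/
def partitionFunction (N : ℕ) (R : Set Γ.OpenLeg) (coupling : ℝ)
    {G : Type*} [Group G] [MeasurableSpace G] (μ : Measure G) (δ : G → ℝ) : ℝ :=
  ∑ π : V → Equiv.Perm (Fin N), (Γ.freeDiagram R π).amplitude μ δ
    - coupling * ∑ I : Interaction V N, (Γ.interactionDiagram R I).amplitude μ δ

/-- The averaged Rényi entropy `(1 - N)⁻¹ ln (E[Z_A] / E[Z_0])` up to linear order. -/
def renyiEntropy (N : ℕ) (A : Set Γ.OpenLeg) (coupling : ℝ)
    {G : Type*} [Group G] [MeasurableSpace G] (μ : Measure G) (δ : G → ℝ) : ℝ :=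
  (1 / (1 - (N : ℝ))) * Real.log
    (Γ.partitionFunction N A coupling μ δ / Γ.partitionFunction N ∅ coupling μ δ)

/-- The degree `N (|E ∪ ∂Γ| - |V|) - (N - 1) |τ|` of the pattern with the domain wall `τ`. -/
def wallDegree (N : ℕ) (τ : Set Γ.Link) : ℝ :=
  (N : ℝ) * ((Nat.card Γ.Link : ℝ) - (Nat.card V : ℝ)) - ((N : ℝ) - 1) * (τ.ncard : ℝ)

end Network

/-! ### Delta functions -/

/-- The normalised Haar measure of a finite group. -/
def uniformMeasure (G : Type*) [MeasurableSpace G] : Measure G :=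
  ProbabilityTheory.uniformOn (Set.univ : Set G)

/-- The delta function of a finite group; `δ(e)` is the order `D` of the group. -/
def finiteDelta (G : Type*) [Group G] (g : G) : ℝ := if g = 1 then (Nat.card G : ℝ) else 0

/-- A regularisation `δ₀, δ₁, …` of the delta function of a compact metric group with normalised
Haar measure `μ`, by non-negative, central, inversion-symmetric functions of integral one that
are largest at the identity, whose values there tend to infinity, and which are comparable to
that value on a ball of comparable volume. Examples on a compact Lie group are the normalised
indicator functions of balls and the heat kernels. -/
structure IsDeltaRegularisation {G : Type*} [Group G] [MetricSpace G] [MeasurableSpace G]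
    (μ : Measure G) (δ : ℕ → G → ℝ) : Prop where
  measurable : ∀ n, Measurable (δ n)
  nonneg : ∀ n g, 0 ≤ δ n g
  le_one : ∀ n g, δ n g ≤ δ n 1
  central : ∀ n g k, δ n (k * g * k⁻¹) = δ n g
  symm : ∀ n g, δ n g⁻¹ = δ n g
  integral_eq_one : ∀ n, ∫ g, δ n g ∂μ = 1
  tendsto : Tendsto (fun n => δ n 1) atTop atTop
  comparable : ∃ c : ℝ, 0 < c ∧ ∀ n, ∃ r : ℝ, 0 < r ∧
    (∀ g ∈ Metric.closedBall (1 : G) r, c * δ n 1 ≤ δ n g) ∧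
    c ≤ δ n 1 * μ.real (Metric.closedBall (1 : G) r)

end GFT

end

noncomputable section

open scoped Classical

namespace GFT

/-!
Every face of a diagram stays on a single link, and a link carries at most `N` faces, strictly
fewer when the strand pairings at its two ends do not match. If a gauge parameter occurs exactly
once along some face, integrating it removes the delta function of that face; all remaining delta
functions are bounded by `δ(e)`. The degree is therefore at most the number of faces minus the
number of faces that can be eliminated in this way, one after the other.

To eliminate many faces, use max-flow min-cut: there are as many link-disjoint paths from `A` to
the other open links as there are links in a minimal cut `σ`, and since vertices are three-valent
these paths are also vertex-disjoint. The faces on such a path are connected by shared gauge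
parameters, because the permutations `𝔽` and `𝕀` at its two ends together connect all copies, so
all but one of them can be eliminated. The remaining vertices hang off the paths and the boundary
in a forest, and the parameters of a vertex eliminate the faces on its link towards the root. If
every link carries `N` faces, `N (|E ∪ ∂Γ| - |V|) - (N - 1) |σ|` faces are left over.

If the diagram is not that of `π*`, some link off `σ` carries a mismatch. Because `σ` is the unique
minimal cut and `Γ` is not coarse-grainable to a tree, the paths and the forest can be chosen to
avoid such a link, which costs at least one further power of `δ(e)`.

For the diagram of `π*` the bound is attained: the gauge parameters close to the identity already
contribute this power of `δ(e)`, with a constant coming from the doubling property.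
-/

/-! ### Faces and holonomies -/

lemma exists_prod_map_eq_mul_mul {ι α M : Type*} [Monoid M] {l : List ι} (hl : l.Nodup) {i : ι}
    (hi : i ∈ l) (F : α → ι → M) (c : ι → M) (hF : ∀ g, ∀ j ∈ l, j ≠ i → F g j = c j) :
    ∃ a b : M, ∀ g, (l.map (F g)).prod = a * F g i * b := by
  obtain ⟨s, t, rfl⟩ := List.append_of_mem hi
  rw [List.nodup_middle, List.nodup_cons, List.mem_append, not_or] at hl
  obtain ⟨⟨his, hit⟩, -⟩ := hl
  refine ⟨(s.map c).prod, (t.map c).prod, fun g => ?_⟩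
  have hs : s.map (F g) = s.map c :=
    List.map_congr_left fun j hj => hF g j (by simp [hj]) (ne_of_mem_of_not_mem hj his)
  have ht : t.map (F g) = t.map c :=
    List.map_congr_left fun j hj => hF g j (by simp [hj]) (ne_of_mem_of_not_mem hj hit)
  rw [List.map_append, List.map_cons, List.prod_append, List.prod_cons, hs, ht, mul_assoc]

namespace StrandedDiagram

variable {P : Type*} {L : Type*} (𝒢 : StrandedDiagram P L)

lemma step_injective : Function.Injective 𝒢.step :=
  𝒢.contract_invol.injective.comp 𝒢.strand_invol.injective

lemma iterate_step_strand (j : ℕ) (p : P) :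
    𝒢.step^[j] (𝒢.strand (𝒢.step^[j] p)) = 𝒢.strand p := by
  induction j generalizing p with
  | zero => rfl
  | succ j ih =>
    rw [Function.iterate_succ_apply' 𝒢.step j (𝒢.strand _), Function.iterate_succ_apply, ih]
    simp only [step, 𝒢.strand_invol _, 𝒢.contract_invol _]

/-- The face through a strand end. -/
def face (p : P) : 𝒢.Face := Quotient.mk 𝒢.faceSetoid p

/-- The strand end at which `holonomy` starts to read off the word of a face. -/
def basePoint (f : 𝒢.Face) : P := Quotient.out (s := 𝒢.faceSetoid) f

lemma face_basePoint (f : 𝒢.Face) : 𝒢.face (𝒢.basePoint f) = f :=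
  Quotient.out_eq (s := 𝒢.faceSetoid) f

lemma face_strand (p : P) : 𝒢.face (𝒢.strand p) = 𝒢.face p :=
  Quotient.sound (s := 𝒢.faceSetoid)
    (Relation.EqvGen.symm _ _ (Relation.EqvGen.rel _ _ (Or.inl rfl)))

lemma face_contract (p : P) : 𝒢.face (𝒢.contract p) = 𝒢.face p :=
  Quotient.sound (s := 𝒢.faceSetoid)
    (Relation.EqvGen.symm _ _ (Relation.EqvGen.rel _ _ (Or.inr rfl)))

lemma face_iterate_step (i : ℕ) (p : P) : 𝒢.face (𝒢.step^[i] p) = 𝒢.face p := by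
  induction i with
  | zero => rfl
  | succ i ih => rw [Function.iterate_succ_apply', step, face_contract, face_strand, ih]

variable {𝒢} in
lemma eq_of_face_eq {α : Type*} (φ : P → α) (hs : ∀ p, φ (𝒢.strand p) = φ p)
    (hc : ∀ p, φ (𝒢.contract p) = φ p) {p q : P} (h : 𝒢.face p = 𝒢.face q) : φ p = φ q := by
  have hpq : Relation.EqvGen (fun p p' => p' = 𝒢.strand p ∨ p' = 𝒢.contract p) p q :=
    Quotient.exact (s := 𝒢.faceSetoid) h
  clear h
  induction hpq with
  | rel x y h => rcases h with rfl | rfl <;> simp only [hs, hc]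
  | refl => rfl
  | symm x y _ ih => exact ih.symm
  | trans x y z _ _ ih₁ ih₂ => exact ih₁.trans ih₂

lemma exists_contract_iterate_step_eq [Finite P] (p : P) (i : ℕ) :
    ∃ j, 𝒢.contract (𝒢.step^[i] p) = 𝒢.strand (𝒢.step^[j] p) := by
  set n := Function.minimalPeriod 𝒢.step p
  have hn : 0 < n :=
    Function.minimalPeriod_pos_iff_mem_periodicPts.2 (𝒢.step_injective.mem_periodicPts p)
  have hstep : 𝒢.step^[i] p = 𝒢.step (𝒢.step^[i + (n - 1)] p) := by
    rw [← Function.iterate_succ_apply' 𝒢.step, show (i + (n - 1)).succ = i + n by omega,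
      Function.iterate_add_minimalPeriod_eq]
  exact ⟨i + (n - 1), by rw [hstep, step, 𝒢.contract_invol]⟩

lemma exists_iterate_step_of_face_eq [Finite P] {p q : P} (h : 𝒢.face q = 𝒢.face p) :
    ∃ i < Function.minimalPeriod 𝒢.step p,
      q = 𝒢.step^[i] p ∨ q = 𝒢.strand (𝒢.step^[i] p) := by
  let OnWay : P → Prop := fun q => ∃ i, q = 𝒢.step^[i] p ∨ q = 𝒢.strand (𝒢.step^[i] p)
  have hs (q) (hq : OnWay q) : OnWay (𝒢.strand q) := by
    obtain ⟨i, rfl | rfl⟩ := hq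
    · exact ⟨i, Or.inr rfl⟩
    · exact ⟨i, Or.inl (𝒢.strand_invol _)⟩
  have hc (q) (hq : OnWay q) : OnWay (𝒢.contract q) := by
    obtain ⟨i, rfl | rfl⟩ := hq
    · obtain ⟨j, hj⟩ := 𝒢.exists_contract_iterate_step_eq p i
      exact ⟨j, Or.inr hj⟩
    · exact ⟨i + 1, Or.inl (Function.iterate_succ_apply' 𝒢.step i p).symm⟩
  have hqp : OnWay q = OnWay p := eq_of_face_eq OnWay
    (fun q => propext ⟨fun hq => 𝒢.strand_invol q ▸ hs _ hq, hs q⟩)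
    (fun q => propext ⟨fun hq => 𝒢.contract_invol q ▸ hc _ hq, hc q⟩) h
  obtain ⟨i, hi⟩ := hqp.mpr ⟨0, Or.inl rfl⟩
  refine ⟨i % Function.minimalPeriod 𝒢.step p, Nat.mod_lt _ ?_, ?_⟩
  · exact Function.minimalPeriod_pos_iff_mem_periodicPts.2 (𝒢.step_injective.mem_periodicPts p)
  · simpa only [Function.iterate_mod_minimalPeriod_eq] using hi

/-- No strand and no contraction returns to its own end, so that the two orientations of a face
are disjoint. -/
structure Nondegenerate : Prop where
  strand_ne : ∀ p, 𝒢.strand p ≠ p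
  contract_ne : ∀ p, 𝒢.contract p ≠ p

section

variable {𝒢}

lemma Nondegenerate.strand_ne_iterate_step (h𝒢 : 𝒢.Nondegenerate) (i : ℕ) (p : P) :
    𝒢.strand p ≠ 𝒢.step^[i] p := by
  intro h
  -- Halving the way from `p` to `strand p` leads to a fixed point of `strand` or of `contract`.
  obtain ⟨j, rfl | rfl⟩ : ∃ j, i = j + j ∨ i = j + (j + 1) := by
    rcases Nat.even_or_odd i with ⟨j, hj⟩ | ⟨j, hj⟩
    · exact ⟨j, Or.inl hj⟩
    · exact ⟨j, Or.inr (by omega)⟩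
  all_goals
    rw [← 𝒢.iterate_step_strand j p, Function.iterate_add_apply] at h
    have hmid := 𝒢.step_injective.iterate j h
  · exact h𝒢.strand_ne _ hmid
  · rw [Function.iterate_succ_apply'] at hmid
    exact h𝒢.contract_ne _ hmid.symm

lemma Nondegenerate.iterate_step_ne_strand_iterate_step (h𝒢 : 𝒢.Nondegenerate) (j k : ℕ) (p : P) :
    𝒢.step^[j] p ≠ 𝒢.strand (𝒢.step^[k] p) := by
  intro h
  have hk := 𝒢.iterate_step_strand k p
  rw [← h, ← Function.iterate_add_apply] at hk
  exact h𝒢.strand_ne_iterate_step _ _ hk.symm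

lemma Nondegenerate.ne_of_iterate_step_eq (h𝒢 : 𝒢.Nondegenerate) {p q : P} {i j : ℕ}
    (hi : i < Function.minimalPeriod 𝒢.step p) (hj : j < Function.minimalPeriod 𝒢.step p)
    (hij : j ≠ i) (hq : q = 𝒢.step^[i] p ∨ q = 𝒢.strand (𝒢.step^[i] p)) :
    𝒢.step^[j] p ≠ q ∧ 𝒢.strand (𝒢.step^[j] p) ≠ q := by
  have hne : 𝒢.step^[j] p ≠ 𝒢.step^[i] p := fun h =>
    hij (Function.iterate_injOn_Iio_minimalPeriod (f := 𝒢.step) (x := p) hj hi h)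
  rcases hq with rfl | rfl
  · exact ⟨hne, (h𝒢.iterate_step_ne_strand_iterate_step i j p).symm⟩
  · exact ⟨h𝒢.iterate_step_ne_strand_iterate_step j i p, 𝒢.strand_invol.injective.ne hne⟩

end

/-- Every strand end `p` carries the gauge parameter `label p`, or none if `label p = none`. -/
def LabelledBy (label : P → Option L) : Prop :=
  ∀ p, 𝒢.gauge p = (label p).elim 1 FreeGroup.of

variable {𝒢} {G : Type*} [Group G] {label : P → Option L}

lemma LabelledBy.lift_update_gauge_of_ne (hlab : 𝒢.LabelledBy label) (h : L → G) {l : L} (g : G)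
    {p : P} (hp : label p ≠ some l) :
    FreeGroup.lift (Function.update h l g) (𝒢.gauge p) = FreeGroup.lift h (𝒢.gauge p) := by
  rw [hlab]
  cases hl : label p with
  | none => simp
  | some l' =>
    have hne : l' ≠ l := fun e => hp (by rw [hl, e])
    simp [hne]

lemma LabelledBy.lift_update_transport_of_ne (hlab : 𝒢.LabelledBy label) (h : L → G) {l : L}
    (g : G) {p : P} (hp : label p ≠ some l) (hsp : label (𝒢.strand p) ≠ some l) :
    FreeGroup.lift (Function.update h l g) (𝒢.transport p) =
      FreeGroup.lift h (𝒢.transport p) := by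
  simp only [transport, map_mul, map_inv, hlab.lift_update_gauge_of_ne h g hp,
    hlab.lift_update_gauge_of_ne h g hsp]

variable (𝒢) in
lemma holonomy_eq_prod (h : L → G) (f : 𝒢.Face) :
    𝒢.holonomy h f =
      ((List.range (Function.minimalPeriod 𝒢.step (𝒢.basePoint f))).reverse.map fun i =>
        FreeGroup.lift h (𝒢.transport (𝒢.step^[i] (𝒢.basePoint f)))).prod := by
  rw [holonomy, word, map_list_prod, ← List.map_reverse, List.map_map]
  rfl

lemma LabelledBy.holonomy_update_of_forall_ne (hlab : 𝒢.LabelledBy label) {f : 𝒢.Face} {l : L}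
    (hl : ∀ p, 𝒢.face p = f → label p ≠ some l) (h : L → G) (g : G) :
    𝒢.holonomy (Function.update h l g) f = 𝒢.holonomy h f := by
  have hface (i : ℕ) : 𝒢.face (𝒢.step^[i] (𝒢.basePoint f)) = f := by
    rw [face_iterate_step, face_basePoint]
  rw [holonomy_eq_prod, holonomy_eq_prod]
  congr 1
  exact List.map_congr_left fun i _ => hlab.lift_update_transport_of_ne h g (hl _ (hface i))
    (hl _ ((𝒢.face_strand _).trans (hface i)))

lemma LabelledBy.lift_update_transport_of_unique (hlab : 𝒢.LabelledBy label)
    (h𝒢 : 𝒢.Nondegenerate) {q : P} {l : L} (hq : label q = some l)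
    (hl : ∀ p, 𝒢.face p = 𝒢.face q → label p = some l → p = q) (h : L → G) :
    ∃ c : G, ∀ g, FreeGroup.lift (Function.update h l g) (𝒢.transport q) = c * g := by
  refine ⟨(FreeGroup.lift h (𝒢.gauge (𝒢.strand q)))⁻¹, fun g => ?_⟩
  have hstrand : label (𝒢.strand q) ≠ some l := fun e =>
    h𝒢.strand_ne q (hl _ (𝒢.face_strand _) e)
  rw [transport, map_mul, map_inv, hlab.lift_update_gauge_of_ne h g hstrand, hlab q, hq]
  simp

/-- A gauge parameter that occurs exactly once on a face enters its holonomy as one factor; the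
two cases are the two orientations of the strand relative to the base point. -/
lemma LabelledBy.holonomy_update_of_unique [Finite P] (hlab : 𝒢.LabelledBy label)
    (h𝒢 : 𝒢.Nondegenerate) {q : P} {l : L} (hq : label q = some l)
    (hl : ∀ p, 𝒢.face p = 𝒢.face q → label p = some l → p = q) (h : L → G) :
    ∃ a b : G, (∀ g, 𝒢.holonomy (Function.update h l g) (𝒢.face q) = a * g * b) ∨
      (∀ g, 𝒢.holonomy (Function.update h l g) (𝒢.face q) = a * g⁻¹ * b) := by
  set p := 𝒢.basePoint (𝒢.face q) with hp
  have hpq : 𝒢.face p = 𝒢.face q := 𝒢.face_basePoint _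
  have hface (j : ℕ) : 𝒢.face (𝒢.step^[j] p) = 𝒢.face q := (𝒢.face_iterate_step j p).trans hpq
  obtain ⟨i, hin, hi⟩ := 𝒢.exists_iterate_step_of_face_eq hpq.symm
  obtain ⟨a, b, hprod⟩ := exists_prod_map_eq_mul_mul (List.nodup_reverse.2 List.nodup_range)
    (List.mem_reverse.2 (List.mem_range.2 hin))
    (fun g j => FreeGroup.lift (Function.update h l g) (𝒢.transport (𝒢.step^[j] p)))
    (fun j => FreeGroup.lift h (𝒢.transport (𝒢.step^[j] p))) fun g j hj hji => by
      have hne := h𝒢.ne_of_iterate_step_eq hin (List.mem_range.1 (List.mem_reverse.1 hj)) hji hi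
      exact hlab.lift_update_transport_of_ne h g (fun e => hne.1 (hl _ (hface j) e))
        (fun e => hne.2 (hl _ ((𝒢.face_strand _).trans (hface j)) e))
  obtain ⟨c, hc⟩ := hlab.lift_update_transport_of_unique h𝒢 hq hl h
  rcases hi with hi | hi
  · refine ⟨a * c, b, Or.inl fun g => ?_⟩
    simp only [holonomy_eq_prod, ← hp, hprod, ← hi, hc, mul_assoc]
  · refine ⟨a, c⁻¹ * b, Or.inr fun g => ?_⟩
    have hinv : 𝒢.transport (𝒢.step^[i] p) = (𝒢.transport q)⁻¹ := by
      rw [hi, transport, transport, 𝒢.strand_invol, mul_inv_rev, inv_inv]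
    simp only [holonomy_eq_prod, ← hp, hprod, hinv, map_inv, hc, mul_inv_rev, mul_assoc]

end StrandedDiagram

/-! ### Bounds for amplitudes -/

/-- A regularised delta function: central, symmetric under inversion, largest at the identity,
and of integral one. -/
structure IsDeltaFunction {G : Type*} [Group G] [MeasurableSpace G] (μ : Measure G)
    (δ : G → ℝ) : Prop where
  measurable : Measurable δ
  nonneg : ∀ g, 0 ≤ δ g
  le_one : ∀ g, δ g ≤ δ 1
  central : ∀ g k, δ (k * g * k⁻¹) = δ g
  symm : ∀ g, δ g⁻¹ = δ g
  integral_eq_one : ∫ g, δ g ∂μ = 1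

namespace IsDeltaFunction

variable {G : Type*} [Group G] [MeasurableSpace G] {μ : Measure G} {δ : G → ℝ}

lemma integrable (hδ : IsDeltaFunction μ δ) : Integrable δ μ :=
  .of_integral_ne_zero (hδ.integral_eq_one ▸ one_ne_zero)

lemma lintegral_eq_one (hδ : IsDeltaFunction μ δ) : ∫⁻ g, ENNReal.ofReal (δ g) ∂μ = 1 := by
  rw [← ofReal_integral_eq_lintegral_ofReal hδ.integrable (ae_of_all _ hδ.nonneg),
    hδ.integral_eq_one, ENNReal.ofReal_one]

variable [MeasurableMul₂ G] [μ.IsMulLeftInvariant]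

lemma lintegral_mul_mul_eq_one (hδ : IsDeltaFunction μ δ) (a b : G) :
    ∫⁻ g, ENNReal.ofReal (δ (a * g * b)) ∂μ = 1 := by
  have hcyc (g : G) : δ (a * g * b) = δ (b * a * g) := by
    rw [← hδ.central (a * g * b) b]
    congr 1
    group
  simp_rw [hcyc]
  rw [lintegral_mul_left_eq_self (fun g => ENNReal.ofReal (δ g)), hδ.lintegral_eq_one]

lemma lintegral_mul_inv_mul_eq_one (hδ : IsDeltaFunction μ δ) (a b : G) :
    ∫⁻ g, ENNReal.ofReal (δ (a * g⁻¹ * b)) ∂μ = 1 := by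
  have hinv (g : G) : δ (a * g⁻¹ * b) = δ (b⁻¹ * g * a⁻¹) := by
    rw [← hδ.symm]
    congr 1
    group
  simp_rw [hinv]
  exact hδ.lintegral_mul_mul_eq_one _ _

end IsDeltaFunction

lemma lintegral_pi_eq_lintegral_update {ι : Type*} [Fintype ι] {G : Type*} [MeasurableSpace G]
    (μ : Measure G) [IsProbabilityMeasure μ] (i : ι) {F : (ι → G) → ENNReal} (hF : Measurable F) :
    ∫⁻ h, F h ∂(Measure.pi fun _ => μ) =
      ∫⁻ h, ∫⁻ g, F (Function.update h i g) ∂μ ∂(Measure.pi fun _ => μ) := by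
  have hG : Nonempty G := μ.nonempty_of_neZero
  let x₀ : ι → G := fun _ => Classical.arbitrary G
  have hF' : Measurable fun h => ∫⁻ g, F (Function.update h i g) ∂μ := by
    simpa only [lmarginal_singleton] using hF.lmarginal (fun _ : ι => μ) (s := {i})
  have hi : i ∉ Finset.univ.erase i := Finset.notMem_erase i _
  rw [lintegral_eq_lmarginal_univ x₀, lintegral_eq_lmarginal_univ x₀,
    ← Finset.insert_erase (Finset.mem_univ i), lmarginal_insert' _ hF hi,
    lmarginal_insert' _ hF' hi]
  congr 1
  ext x
  simp

namespace StrandedDiagram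

variable {P : Type*} {L : Type*} {𝒢 : StrandedDiagram P L} {label : P → Option L}

/-- The delta functions of the faces in `I` can be integrated out one after the other: each face
`f ∈ I` has a strand end `mark f` whose gauge parameter occurs nowhere else on `f`, and otherwise
only on faces outside of `I` or of smaller height. -/
structure Eliminable (𝒢 : StrandedDiagram P L) (label : P → Option L) (I : Finset 𝒢.Face)
    (mark : 𝒢.Face → P) (height : 𝒢.Face → ℕ) : Prop where
  face_mark : ∀ f ∈ I, 𝒢.face (mark f) = f
  label_ne_none : ∀ f ∈ I, label (mark f) ≠ none
  eq_mark : ∀ f ∈ I, ∀ p, 𝒢.face p = f → label p = label (mark f) → p = mark f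
  height_lt : ∀ f ∈ I, ∀ p, 𝒢.face p ∈ I → label p = label (mark f) → 𝒢.face p ≠ f →
    height (𝒢.face p) < height f

lemma Eliminable.mono {I J : Finset 𝒢.Face} {mark : 𝒢.Face → P} {height : 𝒢.Face → ℕ}
    (hI : 𝒢.Eliminable label I mark height) (hJ : J ⊆ I) : 𝒢.Eliminable label J mark height where
  face_mark f hf := hI.face_mark f (hJ hf)
  label_ne_none f hf := hI.label_ne_none f (hJ hf)
  eq_mark f hf := hI.eq_mark f (hJ hf)
  height_lt f hf p hp := hI.height_lt f (hJ hf) p (hJ hp)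

variable {G : Type*} [Group G] {I : Finset 𝒢.Face} {mark : 𝒢.Face → P} {height : 𝒢.Face → ℕ}

lemma Eliminable.holonomy_update_of_height_le (hI : 𝒢.Eliminable label I mark height)
    (hlab : 𝒢.LabelledBy label) {f f' : 𝒢.Face} (hf : f ∈ I) (hf' : f' ∈ I) (hne : f' ≠ f)
    (hle : height f ≤ height f') {l : L} (hl : label (mark f) = some l) (h : L → G) (g : G) :
    𝒢.holonomy (Function.update h l g) f' = 𝒢.holonomy h f' := by
  refine hlab.holonomy_update_of_forall_ne (fun p hp hpl => ?_) h g
  subst hp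
  exact hle.not_gt (hI.height_lt f hf p hf' (hpl.trans hl.symm) hne)

variable [MeasurableSpace G] [MeasurableMul₂ G] {μ : Measure G} {δ : G → ℝ}

lemma Eliminable.lintegral_update_eq_one [Finite P] [μ.IsMulLeftInvariant]
    (hI : 𝒢.Eliminable label I mark height) (hδ : IsDeltaFunction μ δ) (h𝒢 : 𝒢.Nondegenerate)
    (hlab : 𝒢.LabelledBy label) {f : 𝒢.Face} (hf : f ∈ I) {l : L} (hl : label (mark f) = some l)
    (h : L → G) : ∫⁻ g, ENNReal.ofReal (δ (𝒢.holonomy (Function.update h l g) f)) ∂μ = 1 := by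
  have hmark := hI.face_mark f hf
  obtain ⟨a, b, hab⟩ := hlab.holonomy_update_of_unique h𝒢 hl
    (fun p hp hpl => hI.eq_mark f hf p (hp.trans hmark) (hpl.trans hl.symm)) h
  rw [hmark] at hab
  rcases hab with hab | hab
  · simp_rw [hab]
    exact hδ.lintegral_mul_mul_eq_one a b
  · simp_rw [hab]
    exact hδ.lintegral_mul_inv_mul_eq_one a b

variable [MeasurableInv G]

variable (𝒢) in
lemma measurable_holonomy (f : 𝒢.Face) : Measurable fun h : L → G => 𝒢.holonomy h f := by
  unfold holonomy
  induction 𝒢.word (Quotient.out (s := 𝒢.faceSetoid) f) using FreeGroup.induction_on with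
  | C1 => simp
  | of x => simpa using measurable_pi_apply x
  | inv_of x h => simp only [map_inv]; exact h.inv
  | mul x y hx hy => simp only [map_mul]; exact hx.mul hy

variable [Finite P] [Fintype L]

lemma Eliminable.lintegral_prod_eq_one [IsProbabilityMeasure μ] [μ.IsMulLeftInvariant]
    (hI : 𝒢.Eliminable label I mark height) (hδ : IsDeltaFunction μ δ) (h𝒢 : 𝒢.Nondegenerate)
    (hlab : 𝒢.LabelledBy label) :
    ∫⁻ h : L → G, ∏ f ∈ I, ENNReal.ofReal (δ (𝒢.holonomy h f)) ∂(Measure.pi fun _ => μ) = 1 := by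
  induction hn : I.card generalizing I with
  | zero =>
    rw [Finset.card_eq_zero] at hn
    subst hn
    simp
  | succ n ih =>
    obtain ⟨f, hf, hmin⟩ := Finset.exists_min_image I height (Finset.card_pos.1 (by omega))
    obtain ⟨l, hl⟩ := Option.ne_none_iff_exists'.1 (hI.label_ne_none f hf)
    have hmeas (f : 𝒢.Face) : Measurable fun h : L → G => ENNReal.ofReal (δ (𝒢.holonomy h f)) :=
      (hδ.measurable.comp (𝒢.measurable_holonomy f)).ennreal_ofReal
    have hrest (h : L → G) (g : G) :
        ∏ f' ∈ I.erase f, ENNReal.ofReal (δ (𝒢.holonomy (Function.update h l g) f')) =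
          ∏ f' ∈ I.erase f, ENNReal.ofReal (δ (𝒢.holonomy h f')) :=
      Finset.prod_congr rfl fun f' hf' => by
        obtain ⟨hne, hf'⟩ := Finset.mem_erase.1 hf'
        rw [hI.holonomy_update_of_height_le hlab hf hf' hne (hmin f' hf') hl]
    have hintegrate (h : L → G) :
        ∫⁻ g, ∏ f' ∈ I, ENNReal.ofReal (δ (𝒢.holonomy (Function.update h l g) f')) ∂μ =
          ∏ f' ∈ I.erase f, ENNReal.ofReal (δ (𝒢.holonomy h f')) := by
      simp_rw [← Finset.mul_prod_erase I _ hf, hrest]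
      rw [lintegral_mul_const, hI.lintegral_update_eq_one hδ h𝒢 hlab hf hl, one_mul]
      exact (hmeas f).comp (measurable_update h)
    rw [lintegral_pi_eq_lintegral_update μ l (Finset.measurable_prod _ fun f _ => hmeas f)]
    simp_rw [hintegrate]
    exact ih (hI.mono (Finset.erase_subset f I))
      (by rw [Finset.card_erase_of_mem hf, hn, Nat.add_sub_cancel])

variable (𝒢)

lemma amplitude_eq_toReal_lintegral (hδ : IsDeltaFunction μ δ) :
    𝒢.amplitude μ δ = (∫⁻ h : L → G, ∏ f : 𝒢.Face, ENNReal.ofReal (δ (𝒢.holonomy h f))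
      ∂(Measure.pi fun _ => μ)).toReal := by
  rw [amplitude, integral_eq_lintegral_of_nonneg_ae
    (ae_of_all _ fun h => Finset.prod_nonneg fun f _ => hδ.nonneg _)]
  · congr 2
    ext h
    rw [ENNReal.ofReal_prod_of_nonneg fun f _ => hδ.nonneg _]
  · exact (Finset.measurable_prod _ fun f _ =>
      hδ.measurable.comp (𝒢.measurable_holonomy f)).aestronglyMeasurable

lemma integrable_prod_holonomy [IsFiniteMeasure μ] (hδ : IsDeltaFunction μ δ) :
    Integrable (fun h : L → G => ∏ f : 𝒢.Face, δ (𝒢.holonomy h f)) (Measure.pi fun _ => μ) := by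
  refine Integrable.of_bound (C := δ 1 ^ (Finset.univ : Finset 𝒢.Face).card)
    (Finset.measurable_prod _ fun f _ =>
      hδ.measurable.comp (𝒢.measurable_holonomy f)).aestronglyMeasurable (ae_of_all _ fun h => ?_)
  rw [Real.norm_of_nonneg (Finset.prod_nonneg fun f _ => hδ.nonneg _), ← Finset.prod_const]
  exact Finset.prod_le_prod (fun f _ => hδ.nonneg _) fun f _ => hδ.le_one _

lemma pow_mul_pow_le_amplitude [IsProbabilityMeasure μ] (hδ : IsDeltaFunction μ δ) {B : Set G}
    (hB : MeasurableSet B) {b : ℝ} (hb : 0 ≤ b)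
    (hhol : ∀ h : L → G, (∀ l, h l ∈ B) → ∀ f, b ≤ δ (𝒢.holonomy h f)) :
    b ^ (Nat.card 𝒢.Face) * μ.real B ^ (Nat.card L) ≤ 𝒢.amplitude μ δ := by
  have hBm : MeasurableSet (Set.univ.pi fun _ : L => B) :=
    MeasurableSet.pi Set.countable_univ fun _ _ => hB
  calc b ^ (Nat.card 𝒢.Face) * μ.real B ^ (Nat.card L)
      = ∫ h : L → G, (Set.univ.pi fun _ : L => B).indicator
          (fun _ => b ^ (Nat.card 𝒢.Face)) h ∂(Measure.pi fun _ => μ) := by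
        rw [integral_indicator_const _ hBm, smul_eq_mul, mul_comm, measureReal_def,
          measureReal_def, Measure.pi_pi, Finset.prod_const, ENNReal.toReal_pow,
          Nat.card_eq_fintype_card, Finset.card_univ]
    _ ≤ 𝒢.amplitude μ δ := by
        refine integral_mono ((integrable_const _).indicator hBm)
          (𝒢.integrable_prod_holonomy hδ) fun h => Set.indicator_le' (fun h hh => ?_)
            (fun h _ => Finset.prod_nonneg fun f _ => hδ.nonneg _) h
        rw [Nat.card_eq_fintype_card, ← Finset.card_univ, ← Finset.prod_const]
        exact Finset.prod_le_prod (fun _ _ => hb) fun f _ => hhol h (fun l => hh l trivial) f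

variable {𝒢}

lemma Eliminable.amplitude_le_pow [IsProbabilityMeasure μ] [μ.IsMulLeftInvariant]
    (hI : 𝒢.Eliminable label I mark height) (hδ : IsDeltaFunction μ δ) (h𝒢 : 𝒢.Nondegenerate)
    (hlab : 𝒢.LabelledBy label) : 𝒢.amplitude μ δ ≤ δ 1 ^ Iᶜ.card := by
  rw [𝒢.amplitude_eq_toReal_lintegral hδ]
  refine ENNReal.toReal_le_of_le_ofReal (pow_nonneg (hδ.nonneg 1) _) ?_
  calc ∫⁻ h : L → G, ∏ f : 𝒢.Face, ENNReal.ofReal (δ (𝒢.holonomy h f)) ∂(Measure.pi fun _ => μ)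
      ≤ ∫⁻ h : L → G, ENNReal.ofReal (δ 1) ^ Iᶜ.card *
          ∏ f ∈ I, ENNReal.ofReal (δ (𝒢.holonomy h f)) ∂(Measure.pi fun _ => μ) := by
        refine lintegral_mono fun h => ?_
        rw [← Finset.prod_compl_mul_prod I]
        gcongr
        exact Finset.prod_le_pow_card _ _ _ fun f _ => ENNReal.ofReal_le_ofReal (hδ.le_one _)
    _ = ENNReal.ofReal (δ 1) ^ Iᶜ.card := by
        rw [lintegral_const_mul' _ _ (ENNReal.pow_ne_top ENNReal.ofReal_ne_top),
          hI.lintegral_prod_eq_one hδ h𝒢 hlab, mul_one]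
    _ = ENNReal.ofReal (δ 1 ^ Iᶜ.card) := (ENNReal.ofReal_pow (hδ.nonneg 1) _).symm

end StrandedDiagram

/-! ### Cuts of networks -/

lemma isAcyclic_of_card_le_two {V : Type*} [Finite V] (hV : Nat.card V ≤ 2) (H : SimpleGraph V) :
    H.IsAcyclic := by
  have := Fintype.ofFinite V
  intro v c hc
  have hle := hc.support_nodup.length_le_card
  rw [List.length_tail, SimpleGraph.Walk.length_support, Nat.add_sub_cancel,
    ← Nat.card_eq_fintype_card] at hle
  exact absurd (hc.three_le_length.trans (hle.trans hV)) (by norm_num)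

namespace Network

variable {V : Type*} (Γ : Network V)

instance [Finite V] : Finite Γ.Link :=
  inferInstanceAs (Finite {e : Sym2 (V × Fin 3) // ∃ l, e = s(l, Γ.glue l)})

instance [Finite V] : Fintype Γ.Link := Fintype.ofFinite _

lemma link_eq_iff {l l' : V × Fin 3} : Γ.link l = Γ.link l' ↔ l = l' ∨ l = Γ.glue l' := by
  have hval : Γ.link l = Γ.link l' ↔ s(l, Γ.glue l) = s(l', Γ.glue l') := Subtype.ext_iff
  rw [hval, Sym2.eq_iff]
  constructor
  · rintro (⟨h, -⟩ | ⟨h, -⟩)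
    · exact Or.inl h
    · exact Or.inr h
  · rintro (rfl | rfl)
    · exact Or.inl ⟨rfl, rfl⟩
    · exact Or.inr ⟨rfl, Γ.glue_glue _⟩

lemma link_glue (l : V × Fin 3) : Γ.link (Γ.glue l) = Γ.link l :=
  Γ.link_eq_iff.2 (Or.inr rfl)

lemma exists_eq_link (e : Γ.Link) : ∃ l, e = Γ.link l := by
  obtain ⟨_, l, rfl⟩ := e
  exact ⟨l, rfl⟩

/-- The open link of a leg that is not glued to another one. -/
def openLeg (l : V × Fin 3) (h : Γ.glue l = l) : Γ.OpenLeg := ⟨l, h⟩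

lemma farEnd_of_eq {l : V × Fin 3} (h : Γ.glue l = l) : Γ.farEnd l = Sum.inr (Γ.openLeg l h) :=
  dif_pos h

lemma farEnd_of_ne {l : V × Fin 3} (h : Γ.glue l ≠ l) : Γ.farEnd l = Sum.inl (Γ.glue l).1 :=
  dif_neg h

lemma glue_glue_ne {l : V × Fin 3} (h : Γ.glue l ≠ l) : Γ.glue (Γ.glue l) ≠ Γ.glue l := by
  rw [Γ.glue_glue]; exact h.symm

lemma farEnd_glue {l : V × Fin 3} (h : Γ.glue l ≠ l) : Γ.farEnd (Γ.glue l) = Sum.inl l.1 := by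
  rw [Γ.farEnd_of_ne (Γ.glue_glue_ne h), Γ.glue_glue]

/-- The set of nodes that consists of the vertices in `X` and the boundary nodes in `R`. -/
def region (X : Set V) (R : Set Γ.OpenLeg) : Set Γ.Node := Sum.elim X R

@[simp] lemma inl_mem_region {X : Set V} {R : Set Γ.OpenLeg} {x : V} :
    (Sum.inl x : Γ.Node) ∈ Γ.region X R ↔ x ∈ X := Iff.rfl

@[simp] lemma inr_mem_region {X : Set V} {R : Set Γ.OpenLeg} {w : Γ.OpenLeg} :
    (Sum.inr w : Γ.Node) ∈ Γ.region X R ↔ w ∈ R := Iff.rfl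

/-- The links between `Γ.region X R` and its complement. -/
def cut (X : Set V) (R : Set Γ.OpenLeg) : Set Γ.Link :=
  {e | ∃ l, e = Γ.link l ∧ ¬ (l.1 ∈ X ↔ Γ.farEnd l ∈ Γ.region X R)}

lemma link_mem_cut {X : Set V} {R : Set Γ.OpenLeg} {l : V × Fin 3} :
    Γ.link l ∈ Γ.cut X R ↔ ¬ (l.1 ∈ X ↔ Γ.farEnd l ∈ Γ.region X R) := by
  refine ⟨?_, fun h => ⟨l, rfl, h⟩⟩
  rintro ⟨l', h, hl'⟩
  rcases Γ.link_eq_iff.1 h with rfl | rfl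
  · exact hl'
  · by_cases ho : Γ.glue l' = l'
    · rwa [ho]
    · rw [Γ.farEnd_of_ne ho, inl_mem_region] at hl'
      rw [Γ.farEnd_glue ho, inl_mem_region]
      exact fun h => hl' h.symm

lemma exists_leg_of_mem_cut {S : Set V} {e : Γ.Link} (he : e ∈ Γ.cut S ∅) :
    ∃ l, e = Γ.link l ∧ l.1 ∈ S ∧ Γ.farEnd l ∉ Γ.region S ∅ := by
  obtain ⟨l, rfl⟩ := Γ.exists_eq_link e
  rw [link_mem_cut] at he
  by_cases hl : l.1 ∈ S
  · exact ⟨l, rfl, hl, fun h => he (iff_of_true hl h)⟩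
  · have hfar : Γ.farEnd l ∈ Γ.region S ∅ := by_contra fun h => he (iff_of_false hl h)
    by_cases ho : Γ.glue l = l
    · rw [Γ.farEnd_of_eq ho] at hfar
      exact hfar.elim
    · rw [Γ.farEnd_of_ne ho] at hfar
      exact ⟨Γ.glue l, (Γ.link_glue l).symm, hfar, by rwa [Γ.farEnd_glue ho]⟩

lemma cut_symmDiff (X S : Set V) (R : Set Γ.OpenLeg) :
    Γ.cut (symmDiff X S) R = symmDiff (Γ.cut X R) (Γ.cut S ∅) := by
  ext e
  obtain ⟨l, rfl⟩ := Γ.exists_eq_link e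
  rw [Set.mem_symmDiff, link_mem_cut, link_mem_cut, link_mem_cut, Set.mem_symmDiff]
  by_cases ho : Γ.glue l = l
  · rw [Γ.farEnd_of_eq ho]
    simp only [inr_mem_region, Set.mem_empty_iff_false]
    tauto
  · rw [Γ.farEnd_of_ne ho]
    simp only [inl_mem_region, Set.mem_symmDiff]
    tauto

lemma mem_iff_of_reachable {σ : Set Γ.Link} {T : Set Γ.Node}
    (hT : ∀ l, Γ.link l ∉ σ → (Sum.inl l.1 ∈ T ↔ Γ.farEnd l ∈ T)) {x y : Γ.Node}
    (h : (Γ.graphOff σ).Reachable x y) : x ∈ T ↔ y ∈ T := by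
  have hjoins {e : Γ.Link} {x y : Γ.Node} (he : e ∉ σ) : Γ.Joins e x y → (x ∈ T ↔ y ∈ T) := by
    rintro ⟨l, rfl, ⟨rfl, rfl⟩ | ⟨rfl, rfl⟩⟩
    exacts [hT l he, (hT l he).symm]
  obtain ⟨w⟩ := h
  induction w with
  | nil => rfl
  | cons hadj _ ih =>
    refine Iff.trans ?_ ih
    obtain ⟨-, ⟨e, he, h⟩ | ⟨e, he, h⟩⟩ := hadj
    exacts [hjoins he h, (hjoins he h).symm]

lemma reachable_farEnd {σ : Set Γ.Link} {l : V × Fin 3} (hl : Γ.link l ∉ σ) :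
    (Γ.graphOff σ).Reachable (Sum.inl l.1) (Γ.farEnd l) := by
  by_cases h : (Sum.inl l.1 : Γ.Node) = Γ.farEnd l
  · rw [← h]
  · exact SimpleGraph.Adj.reachable ⟨h, Or.inl ⟨_, hl, l, rfl, Or.inl ⟨rfl, rfl⟩⟩⟩

lemma separates_cut (X : Set V) (R : Set Γ.OpenLeg) : Γ.Separates R (Γ.cut X R) :=
  fun _ ha _ hb h => hb ((Γ.mem_iff_of_reachable (T := Γ.region X R)
    (fun _ hl => not_not.1 fun h' => hl (Γ.link_mem_cut.2 h')) h).1 ha)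

/-- The vertices that are connected to `R` after omission of `τ`. -/
def wallSide (R : Set Γ.OpenLeg) (τ : Set Γ.Link) : Set V :=
  {x | ∃ a ∈ R, (Γ.graphOff τ).Reachable (Sum.inl x) (Sum.inr a)}

variable {Γ} {R : Set Γ.OpenLeg} {τ : Set Γ.Link}

lemma Separates.mem_region_wallSide (h : Γ.Separates R τ) (n : Γ.Node) :
    n ∈ Γ.region (Γ.wallSide R τ) R ↔ ∃ a ∈ R, (Γ.graphOff τ).Reachable n (Sum.inr a) := by
  rcases n with x | w
  · rfl
  · refine ⟨fun hw => ⟨w, hw, SimpleGraph.Reachable.refl _⟩, fun ⟨a, ha, hr⟩ => ?_⟩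
    by_contra hw
    exact h a ha w hw hr.symm

lemma Separates.cut_subset (h : Γ.Separates R τ) : Γ.cut (Γ.wallSide R τ) R ⊆ τ := by
  rintro _ ⟨l, rfl, hl⟩
  by_contra hlτ
  have hr := Γ.reachable_farEnd hlτ
  rw [h.mem_region_wallSide] at hl
  exact hl ⟨fun ⟨a, ha, h'⟩ => ⟨a, ha, hr.symm.trans h'⟩, fun ⟨a, ha, h'⟩ => ⟨a, ha, hr.trans h'⟩⟩

lemma IsMinCut.cut_eq [Finite V] (h : Γ.IsMinCut R τ) : Γ.cut (Γ.wallSide R τ) R = τ :=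
  Set.eq_of_subset_of_ncard_le h.1.cut_subset (h.2 _ (Γ.separates_cut _ _)) (Set.toFinite _)

lemma coarseGrainable_of_cut_subsingleton (hbdry : Nonempty Γ.OpenLeg) {S : Set V}
    (hS : S.Nonempty) (hcut : (Γ.cut S ∅).Subsingleton) : Γ.CoarseGrainable := by
  let InS : Γ.Node → Prop := fun n => n ∈ Γ.region S ∅
  let P : Setoid Γ.Node := Setoid.ker InS
  have hmk (x y : Γ.Node) : Quotient.mk P x = Quotient.mk P y ↔ InS x = InS y :=
    Quotient.eq (r := P)
  have hinj : Function.Injective (Setoid.kerLift InS) := Setoid.kerLift_injective InS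
  have hfin : Finite (Quotient P) := Finite.of_injective _ hinj
  refine ⟨P, fun w w' => (hmk _ _).2 rfl, fun m => ?_, fun m m' hne => ?_,
    isAcyclic_of_card_le_two ?_ _⟩
  · obtain ⟨x, hx⟩ := hS
    obtain ⟨w⟩ := hbdry
    by_cases hm : Quotient.mk P (Sum.inr w) = m
    · refine ⟨Sum.inl x, fun h => ?_⟩
      exact (((hmk _ _).1 (h.trans hm.symm)).mp hx : (Sum.inr w : Γ.Node) ∈ Γ.region S ∅)
    · exact ⟨_, hm⟩
  · have hsub : Γ.linksBetween P m m' ⊆ Γ.cut S ∅ := by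
      rintro _ ⟨x, y, ⟨l, rfl, hj⟩, rfl, rfl⟩
      refine Γ.link_mem_cut.2 fun hiff => hne ((hmk _ _).2 (propext ?_))
      rcases hj with ⟨rfl, rfl⟩ | ⟨rfl, rfl⟩
      exacts [hiff, hiff.symm]
    have := (hcut.anti hsub).finite.to_subtype
    exact Set.ncard_le_one_iff_subsingleton.2 (hcut.anti hsub)
  · exact (Nat.card_le_card_of_injective _ hinj).trans (by simp)

lemma exists_mem_cut_ne (hbdry : Nonempty Γ.OpenLeg) (htree : ¬ Γ.CoarseGrainable)
    {S : Set V} (hS : S.Nonempty) (e : Γ.Link) : ∃ e' ∈ Γ.cut S ∅, e' ≠ e := by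
  by_contra! hcon
  exact htree (coarseGrainable_of_cut_subsingleton hbdry hS
    (Set.subsingleton_of_subset_singleton fun e' he' => hcon e' he'))

lemma IsMinCut.symmDiff_cut [Finite V] (hτ : Γ.IsMinCut R τ) {S : Set V}
    (hle : (Γ.cut S ∅ \ τ).ncard ≤ (τ ∩ Γ.cut S ∅).ncard) :
    Γ.IsMinCut R (symmDiff τ (Γ.cut S ∅)) := by
  have hsep := Γ.separates_cut (symmDiff (Γ.wallSide R τ) S) R
  rw [cut_symmDiff, hτ.cut_eq] at hsep
  refine ⟨hsep, fun τ' hτ' => le_trans ?_ (hτ.2 τ' hτ')⟩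
  calc (symmDiff τ (Γ.cut S ∅)).ncard
      ≤ (τ \ Γ.cut S ∅).ncard + (Γ.cut S ∅ \ τ).ncard := Set.ncard_union_le _ _
    _ ≤ (τ ∩ Γ.cut S ∅).ncard + (τ \ Γ.cut S ∅).ncard := by omega
    _ = τ.ncard := Set.ncard_inter_add_ncard_sdiff_eq_ncard τ _ (Set.toFinite _)

lemma exists_leaving_link_notMem [Finite V] (hbdry : Nonempty Γ.OpenLeg)
    (htree : ¬ Γ.CoarseGrainable) (hτ : Γ.IsMinCut R τ)
    (huniq : ∀ τ', Γ.IsMinCut R τ' → τ' = τ) {S : Set V} (hS : S.Nonempty) (e : Γ.Link) :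
    ∃ l, l.1 ∈ S ∧ Γ.farEnd l ∉ Γ.region S ∅ ∧ Γ.link l ∉ τ ∧ Γ.link l ≠ e := by
  suffices ∃ e' ∈ Γ.cut S ∅ \ τ, e' ≠ e by
    obtain ⟨_, ⟨he', hn⟩, hne⟩ := this
    obtain ⟨l, rfl, hl, hfar⟩ := Γ.exists_leg_of_mem_cut he'
    exact ⟨l, hl, hfar, hn, hne⟩
  obtain ⟨e', he', hne⟩ := exists_mem_cut_ne hbdry htree hS e
  by_contra! hsub
  have hinter : (τ ∩ Γ.cut S ∅).Nonempty := ⟨e', by_contra fun h => hne (hsub e' ⟨he', h⟩), he'⟩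
  have hle : (Γ.cut S ∅ \ τ).ncard ≤ (τ ∩ Γ.cut S ∅).ncard :=
    ((Set.ncard_le_ncard hsub).trans_eq (Set.ncard_singleton e)).trans
      ((Set.ncard_pos (Set.toFinite _)).2 hinter)
  have hempty := symmDiff_eq_left.1 (huniq _ (hτ.symmDiff_cut hle))
  exact hempty.le he'

lemma glue_fst_ne (hbdry : Nonempty Γ.OpenLeg) (htree : ¬ Γ.CoarseGrainable)
    {l : V × Fin 3} (hl : Γ.glue l ≠ l) : (Γ.glue l).1 ≠ l.1 := by
  obtain ⟨x, a⟩ := l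
  intro heq
  obtain ⟨b, hb⟩ : ∃ b, Γ.glue (x, a) = (x, b) := ⟨(Γ.glue (x, a)).2, Prod.ext heq rfl⟩
  have hb' : Γ.glue (x, b) = (x, a) := by rw [← hb, Γ.glue_glue]
  have hab : a ≠ b := fun h => hl (by rw [hb, h])
  have hthird : ∀ a b : Fin 3, a ≠ b → ∃ c : Fin 3, ∀ d, d = a ∨ d = b ∨ d = c := by decide
  obtain ⟨c, hc⟩ := hthird a b hab
  obtain ⟨_, he', hne⟩ := exists_mem_cut_ne hbdry htree (Set.singleton_nonempty x) (Γ.link (x, c))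
  obtain ⟨⟨y, d⟩, rfl, rfl, hfar⟩ := Γ.exists_leg_of_mem_cut he'
  rcases hc d with rfl | rfl | rfl
  · rw [Γ.farEnd_of_ne hl, hb] at hfar
    exact hfar rfl
  · rw [Γ.farEnd_of_ne (by rw [hb']; simpa using hab), hb'] at hfar
    exact hfar rfl
  · exact hne rfl

end Network

/-! ### Flows and disjoint paths -/

lemma exists_depth {α : Type*} (r : α → α → Prop) (B : Set α) :
    ∃ d : α → ℕ, ∀ x, x ∉ B → (∃ b ∈ B, Relation.ReflTransGen r x b) →
      ∃ y, r x y ∧ d y < d x ∧ ∃ b ∈ B, Relation.ReflTransGen r y b := by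
  let level : ℕ → Set α := fun n => Nat.rec B (fun _ T => {x | ∃ y ∈ T, r x y}) n
  have hlevel (x : α) : (∃ b ∈ B, Relation.ReflTransGen r x b) ↔ ∃ n, x ∈ level n := by
    constructor
    · rintro ⟨b, hb, h⟩
      induction h using Relation.ReflTransGen.head_induction_on with
      | refl => exact ⟨0, hb⟩
      | head h' _ ih =>
        obtain ⟨n, hn⟩ := ih
        exact ⟨n + 1, _, hn, h'⟩
    · rintro ⟨n, hn⟩
      induction n generalizing x with
      | zero => exact ⟨x, hn, Relation.ReflTransGen.refl⟩
      | succ n ih =>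
        obtain ⟨y, hy, hxy⟩ := hn
        obtain ⟨b, hb, h⟩ := ih y hy
        exact ⟨b, hb, h.head hxy⟩
  refine ⟨fun x => sInf {n | x ∈ level n}, fun x hx hreach => ?_⟩
  have hmem : x ∈ level (sInf {n | x ∈ level n}) := Nat.sInf_mem ((hlevel x).1 hreach)
  beta_reduce
  generalize sInf {n | x ∈ level n} = m at hmem ⊢
  cases m with
  | zero => exact absurd hmem hx
  | succ m =>
    obtain ⟨y, hy, hxy⟩ := hmem
    exact ⟨y, hxy, Nat.lt_succ_of_le (Nat.sInf_le hy), (hlevel y).2 ⟨m, hy⟩⟩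

namespace Network

variable {V : Type*} (Γ : Network V)

/-- The legs of the open links in `R`. -/
def openIn (R : Set Γ.OpenLeg) : Set (V × Fin 3) := {l | ∃ h : Γ.glue l = l, Γ.openLeg l h ∈ R}

variable {Γ} {R : Set Γ.OpenLeg}

lemma glue_eq_of_openIn {l : V × Fin 3} (h : l ∈ Γ.openIn R) : Γ.glue l = l := h.1

lemma openIn_compl {l : V × Fin 3} : l ∈ Γ.openIn Rᶜ ↔ Γ.glue l = l ∧ l ∉ Γ.openIn R :=
  ⟨fun ⟨h, h'⟩ => ⟨h, fun ⟨_, h''⟩ => h' h''⟩, fun ⟨h, h'⟩ => ⟨h, fun h'' => h' ⟨h, h''⟩⟩⟩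

lemma farEnd_mem_region {X : Set V} {l : V × Fin 3} :
    Γ.farEnd l ∈ Γ.region X R ↔ l ∈ Γ.openIn R ∨ Γ.glue l ≠ l ∧ (Γ.glue l).1 ∈ X := by
  by_cases ho : Γ.glue l = l
  · rw [Γ.farEnd_of_eq ho, inr_mem_region]
    exact ⟨fun h => Or.inl ⟨ho, h⟩, fun h => h.elim (fun h => h.2) fun h => absurd ho h.1⟩
  · rw [Γ.farEnd_of_ne ho, inl_mem_region]
    exact ⟨fun h => Or.inr ⟨ho, h⟩, fun h => h.elim (fun h => absurd h.1 ho) fun h => h.2⟩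

lemma sum_single_fst (l : V × Fin 3) (x : V) :
    ∑ a : Fin 3, (Pi.single l 1 : V × Fin 3 → ℤ) (x, a) = if x = l.1 then 1 else 0 := by
  obtain ⟨y, b⟩ := l
  by_cases h : x = y
  · subst h
    simp [Pi.single_apply]
  · simp [h]

variable (Γ R) in
/-- An integral flow of unit capacity that avoids the link `e₀`, enters the network through `R` and
leaves it through the other open links. `f l` is the flow out of the vertex `l.1` along `l`. -/
structure IsFlow (e₀ : Γ.Link) (f : V × Fin 3 → ℤ) : Prop where
  neg_one_le : ∀ l, -1 ≤ f l
  le_one : ∀ l, f l ≤ 1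
  glue_eq_neg : ∀ l, Γ.glue l ≠ l → f (Γ.glue l) = -f l
  source : ∀ l ∈ Γ.openIn R, f l ≤ 0
  sink : ∀ l ∈ Γ.openIn Rᶜ, 0 ≤ f l
  avoid : ∀ l, Γ.link l = e₀ → f l = 0
  sum_eq_zero : ∀ x, ∑ a, f (x, a) = 0

variable (Γ R) in
/-- A unit of flow from the vertex `x` to an open link outside of `R` that can be added to the flow
`f`. -/
structure IsAugmentation (e₀ : Γ.Link) (f : V × Fin 3 → ℤ) (x : V) (c : V × Fin 3 → ℤ) : Prop where
  le_one : ∀ l, c l ≤ 1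
  nonpos_of_pos : ∀ l, 0 < c l → f l ≤ 0
  glue_eq_neg : ∀ l, Γ.glue l ≠ l → c (Γ.glue l) = -c l
  source : ∀ l ∈ Γ.openIn R, c l = 0
  sink : ∀ l ∈ Γ.openIn Rᶜ, 0 ≤ c l
  avoid : ∀ l, Γ.link l = e₀ → c l = 0
  sum_eq : ∀ z, ∑ a, c (z, a) = if z = x then 1 else 0

variable {e₀ : Γ.Link} {f : V × Fin 3 → ℤ}

lemma isAugmentation_single {l : V × Fin 3} (hl : l ∈ Γ.openIn Rᶜ) (hle : Γ.link l ≠ e₀)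
    (hfl : f l ≤ 0) : Γ.IsAugmentation R e₀ f l.1 (Pi.single l 1) where
  le_one l' := by rw [Pi.single_apply]; split_ifs <;> norm_num
  nonpos_of_pos l' h := by
    by_cases hl' : l' = l
    · rwa [hl']
    · simp [hl'] at h
  glue_eq_neg l' h := by
    have h₁ : l' ≠ l := fun e => h (by rw [e, glue_eq_of_openIn hl])
    have h₂ : Γ.glue l' ≠ l := fun e => Γ.glue_glue_ne h (by rw [e, glue_eq_of_openIn hl])
    simp [h₁, h₂]
  source l' h := by
    have hne : l' ≠ l := by rintro rfl; exact (openIn_compl.1 hl).2 h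
    simp [hne]
  sink l' _ := by rw [Pi.single_apply]; split_ifs <;> norm_num
  avoid l' h := by
    have hne : l' ≠ l := by rintro rfl; exact hle h
    simp [hne]
  sum_eq := sum_single_fst l

lemma IsAugmentation.add_single {l : V × Fin 3} {c : V × Fin 3 → ℤ}
    (hc : Γ.IsAugmentation R e₀ f (Γ.glue l).1 c) (hl : Γ.glue l ≠ l) (hle : Γ.link l ≠ e₀)
    (hfl : f l ≤ 0) (hcl : c l = 0) :
    Γ.IsAugmentation R e₀ f l.1 (c + Pi.single l 1 - Pi.single (Γ.glue l) 1) := by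
  have hopen {l'} (h : Γ.glue l' = l') : l' ≠ l ∧ l' ≠ Γ.glue l :=
    ⟨fun e => hl (e ▸ h), fun e => Γ.glue_glue_ne hl (e ▸ h)⟩
  have hoff {l'} (h : l' ≠ l ∧ l' ≠ Γ.glue l) :
      (c + Pi.single l 1 - Pi.single (Γ.glue l) 1 : V × Fin 3 → ℤ) l' = c l' := by simp [h.1, h.2]
  have hon : (c + Pi.single l 1 - Pi.single (Γ.glue l) 1 : V × Fin 3 → ℤ) l = 1 := by
    simp [hcl, hl.symm]
  have hon' : (c + Pi.single l 1 - Pi.single (Γ.glue l) 1 : V × Fin 3 → ℤ) (Γ.glue l) = -1 := by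
    simp [hc.glue_eq_neg l hl, hcl, hl]
  have cases (l') : l' = l ∨ l' = Γ.glue l ∨ (l' ≠ l ∧ l' ≠ Γ.glue l) := by tauto
  refine ⟨fun l' => ?_, fun l' => ?_, fun l' h => ?_, fun l' h => ?_, fun l' h => ?_,
    fun l' h => ?_, fun z => ?_⟩
  · rcases cases l' with h | h | h
    · rw [h, hon]
    · rw [h, hon']; norm_num
    · rw [hoff h]; exact hc.le_one l'
  · rcases cases l' with h | h | h
    · rw [h]; exact fun _ => hfl
    · rw [h, hon']; norm_num
    · rw [hoff h]; exact hc.nonpos_of_pos l'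
  · rcases cases l' with h' | h' | h'
    · rw [h', hon, hon']
    · rw [h', Γ.glue_glue, hon, hon', neg_neg]
    · rw [hoff h', hoff ⟨fun e => h'.2 (by rw [← e, Γ.glue_glue]),
        fun e => h'.1 (by rw [← Γ.glue_glue l', e, Γ.glue_glue])⟩, hc.glue_eq_neg l' h]
  · rw [hoff (hopen (glue_eq_of_openIn h)), hc.source l' h]
  · rw [hoff (hopen (glue_eq_of_openIn h))]
    exact hc.sink l' h
  · rw [hoff ⟨fun e => hle (e ▸ h), fun e => hle (by rw [← Γ.link_glue, ← e, h])⟩, hc.avoid l' h]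
  · simp only [Pi.sub_apply, Pi.add_apply, Finset.sum_sub_distrib, Finset.sum_add_distrib,
      hc.sum_eq, sum_single_fst]
    ring

variable (Γ R) in
/-- The flow `f` leaves room for another unit from the vertex `x` to the vertex `y`. -/
def Residual (e₀ : Γ.Link) (f : V × Fin 3 → ℤ) (x y : V) : Prop :=
  ∃ a, Γ.link (x, a) ≠ e₀ ∧ Γ.glue (x, a) ≠ (x, a) ∧ f (x, a) ≤ 0 ∧ (Γ.glue (x, a)).1 = y

variable (Γ R) in
/-- The vertices with an open link outside of `R` that is not used by the flow `f`. -/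
def freeSinks (e₀ : Γ.Link) (f : V × Fin 3 → ℤ) : Set V :=
  {x | ∃ a, (x, a) ∈ Γ.openIn Rᶜ ∧ Γ.link (x, a) ≠ e₀ ∧ f (x, a) ≤ 0}

variable (Γ R) in
/-- The vertices from which the flow `f` can be augmented. -/
def augmentable (e₀ : Γ.Link) (f : V × Fin 3 → ℤ) : Set V :=
  {x | ∃ b ∈ Γ.freeSinks R e₀ f, Relation.ReflTransGen (Γ.Residual e₀ f) x b}

lemma exists_isAugmentation {x : V} (hx : x ∈ Γ.augmentable R e₀ f) :
    ∃ c, Γ.IsAugmentation R e₀ f x c := by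
  obtain ⟨d, hd⟩ := exists_depth (Γ.Residual e₀ f) (Γ.freeSinks R e₀ f)
  -- A shortest augmenting path does not return to a level that it has left.
  suffices ∃ c, Γ.IsAugmentation R e₀ f x c ∧ ∀ l, c l ≠ 0 → d l.1 ≤ d x from
    this.imp fun _ => And.left
  induction hn : d x using Nat.strong_induction_on generalizing x with
  | _ n ih =>
    subst hn
    by_cases hxB : x ∈ Γ.freeSinks R e₀ f
    · obtain ⟨a, ha, hae, hfa⟩ := hxB
      refine ⟨_, isAugmentation_single ha hae hfa, fun l hl => ?_⟩
      obtain rfl : l = (x, a) := by_contra fun h => hl (Pi.single_eq_of_ne h _)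
      exact le_rfl
    · obtain ⟨y, ⟨a, hae, hao, hfa, rfl⟩, hdy, hy⟩ := hd x hxB hx
      obtain ⟨c, hc, hsupp⟩ := ih _ hdy hy rfl
      have hca : c (x, a) = 0 := by_contra fun h => (hsupp _ h).not_gt hdy
      refine ⟨_, hc.add_single hao hae hfa hca, fun l hl => ?_⟩
      by_cases h₁ : l = (x, a)
      · rw [h₁]
      by_cases h₂ : l = Γ.glue (x, a)
      · rw [h₂]; exact hdy.le
      exact (hsupp l (by simpa [h₁, h₂] using hl)).trans hdy.le

lemma IsFlow.neg_one_le_add {x : V} {c : V × Fin 3 → ℤ} (hf : Γ.IsFlow R e₀ f)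
    (hc : Γ.IsAugmentation R e₀ f x c) (l : V × Fin 3) : -1 ≤ f l + c l := by
  rcases le_or_gt 0 (c l) with h | h
  · linarith [hf.neg_one_le l]
  · have ho : Γ.glue l ≠ l := fun ho => by
      by_cases hR : l ∈ Γ.openIn R
      · exact h.ne (hc.source l hR)
      · exact (hc.sink l (openIn_compl.2 ⟨ho, hR⟩)).not_gt h
    have h₁ := hc.glue_eq_neg l ho
    have h₂ := hc.nonpos_of_pos (Γ.glue l) (by omega)
    have h₃ := hc.le_one (Γ.glue l)
    rw [hf.glue_eq_neg l ho] at h₂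
    omega

lemma IsFlow.add_augmentation {c : V × Fin 3 → ℤ} {l : V × Fin 3} (hf : Γ.IsFlow R e₀ f)
    (hc : Γ.IsAugmentation R e₀ f l.1 c) (hl : l ∈ Γ.openIn R) (hle : Γ.link l ≠ e₀)
    (hfl : f l = 0) : Γ.IsFlow R e₀ (f + c - Pi.single l 1) := by
  have hoff {l'} (h : l' ≠ l) : (f + c - Pi.single l 1 : V × Fin 3 → ℤ) l' = f l' + c l' := by
    simp [h]
  have hon : (f + c - Pi.single l 1 : V × Fin 3 → ℤ) l = -1 := by simp [hfl, hc.source l hl]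
  refine ⟨fun l' => ?_, fun l' => ?_, fun l' h => ?_, fun l' h => ?_, fun l' h => ?_,
    fun l' h => ?_, fun z => ?_⟩
  · by_cases h : l' = l
    · rw [h, hon]
    · rw [hoff h]; exact hf.neg_one_le_add hc l'
  · by_cases h : l' = l
    · rw [h, hon]; norm_num
    · rw [hoff h]
      have := hc.le_one l'
      have := hf.le_one l'
      have := hc.nonpos_of_pos l'
      omega
  · have h₁ : l' ≠ l := fun e => h (by rw [e, glue_eq_of_openIn hl])
    have h₂ : Γ.glue l' ≠ l := fun e => Γ.glue_glue_ne h (by rw [e, glue_eq_of_openIn hl])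
    rw [hoff h₁, hoff h₂, hf.glue_eq_neg l' h, hc.glue_eq_neg l' h]
    ring
  · by_cases h' : l' = l
    · rw [h', hon]; norm_num
    · rw [hoff h', hc.source l' h, add_zero]; exact hf.source l' h
  · have hne : l' ≠ l := by rintro rfl; exact (openIn_compl.1 h).2 hl
    rw [hoff hne]
    exact add_nonneg (hf.sink l' h) (hc.sink l' h)
  · rw [hoff fun e => hle (e ▸ h), hf.avoid l' h, hc.avoid l' h, add_zero]
  · simp only [Pi.sub_apply, Pi.add_apply, Finset.sum_sub_distrib, Finset.sum_add_distrib,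
      hc.sum_eq, hf.sum_eq_zero, sum_single_fst]
    ring

lemma sum_glued_eq_zero [Fintype V] (hf : ∀ l, Γ.glue l ≠ l → f (Γ.glue l) = -f l) (Y : Set V) :
    ∑ l with Γ.glue l ≠ l ∧ l.1 ∈ Y ∧ (Γ.glue l).1 ∈ Y, f l = 0 := by
  refine Finset.sum_involution (fun l _ => Γ.glue l) ?_ ?_ ?_ fun l _ => Γ.glue_glue l
  · intro l hl
    rw [hf l (Finset.mem_filter.1 hl).2.1, add_neg_cancel]
  · exact fun l hl _ => (Finset.mem_filter.1 hl).2.1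
  · intro l hl
    obtain ⟨-, h, hY, hY'⟩ := Finset.mem_filter.1 hl
    exact Finset.mem_filter.2 ⟨Finset.mem_univ _, Γ.glue_glue_ne h, hY', by rwa [Γ.glue_glue]⟩

lemma IsFlow.sum_fst_mem_eq_zero [Fintype V] (hf : Γ.IsFlow R e₀ f) (Y : Set V) :
    ∑ l with l.1 ∈ Y, f l = 0 := by
  rw [Finset.sum_filter, Fintype.sum_prod_type]
  refine Finset.sum_eq_zero fun x _ => ?_
  by_cases hx : x ∈ Y <;> simp [hx, hf.sum_eq_zero]

lemma IsFlow.sum_leaving [Fintype V] (hf : Γ.IsFlow R e₀ f) (Y : Set V) :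
    ∑ l with l.1 ∈ Y ∧ Γ.farEnd l ∈ Γ.region Yᶜ R, f l +
      ∑ l with l.1 ∈ Y ∧ l ∈ Γ.openIn Rᶜ, f l = 0 := by
  have hsplit : ∑ l with l.1 ∈ Y ∧ Γ.farEnd l ∈ Γ.region Yᶜ R, f l +
      ∑ l with l.1 ∈ Y ∧ l ∈ Γ.openIn Rᶜ, f l +
        ∑ l with Γ.glue l ≠ l ∧ l.1 ∈ Y ∧ (Γ.glue l).1 ∈ Y, f l = ∑ l with l.1 ∈ Y, f l := by
    simp only [Finset.sum_filter, ← Finset.sum_add_distrib, farEnd_mem_region, openIn_compl,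
      Set.mem_compl_iff]
    refine Finset.sum_congr rfl fun l _ => ?_
    grind [@glue_eq_of_openIn]
  rwa [sum_glued_eq_zero hf.glue_eq_neg, hf.sum_fst_mem_eq_zero, add_zero] at hsplit

lemma IsFlow.sum_openIn_add [Fintype V] (hf : Γ.IsFlow R e₀ f) :
    ∑ l with l ∈ Γ.openIn R, f l + ∑ l with l ∈ Γ.openIn Rᶜ, f l = 0 := by
  simpa [farEnd_mem_region] using hf.sum_leaving Set.univ

variable (Γ R) in
/-- The legs across which a flow from `R` leaves or enters the set `Y` of vertices on its way to the
other open links: those from `Y` to the rest of the network or to `R`, which it enters, and the open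
ones at the other vertices, where it leaves without having passed `Y`. -/
def crossing (Y : Set V) : Set (V × Fin 3) :=
  {l | l.1 ∈ Y ∧ Γ.farEnd l ∈ Γ.region Yᶜ R} ∪ {l | l ∈ Γ.openIn Rᶜ ∧ l.1 ∉ Y}

lemma cut_compl_subset (Y : Set V) : Γ.cut Yᶜ R ⊆ Γ.link '' Γ.crossing R Y := by
  rintro _ ⟨l, rfl, hl⟩
  rw [farEnd_mem_region, Set.mem_compl_iff] at hl
  by_cases ho : Γ.glue l = l
  · refine ⟨l, ?_, rfl⟩
    simp only [crossing, Set.mem_union, Set.mem_ofPred_eq, farEnd_mem_region, openIn_compl]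
    tauto
  · by_cases hY : l.1 ∈ Y
    · refine ⟨l, Or.inl ⟨hY, farEnd_mem_region.2 ?_⟩, rfl⟩
      tauto
    · refine ⟨Γ.glue l, Or.inl ⟨?_, ?_⟩, Γ.link_glue l⟩
      · by_contra h
        exact hl (iff_of_true hY (Or.inr ⟨ho, h⟩))
      · rwa [Γ.farEnd_glue ho, inl_mem_region]

lemma IsFlow.eq_neg_one_of_leaving (hf : Γ.IsFlow R e₀ f) {l : V × Fin 3}
    (hl : l.1 ∈ Γ.augmentable R e₀ f) (hfar : Γ.farEnd l ∈ Γ.region (Γ.augmentable R e₀ f)ᶜ R)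
    (hle : Γ.link l ≠ e₀) (hR : l ∈ Γ.openIn R → f l ≠ 0) : f l = -1 := by
  have hlow := hf.neg_one_le l
  rcases farEnd_mem_region.1 hfar with h | ⟨ho, h⟩
  · have := hf.source l h
    have := hR h
    omega
  · have hpos : 0 < f (Γ.glue l) := by
      by_contra! hneg
      obtain ⟨b, hb, hreach⟩ := hl
      exact h ⟨b, hb, hreach.head ⟨(Γ.glue l).2, by rwa [Γ.link_glue], Γ.glue_glue_ne ho, hneg,
        by rw [Γ.glue_glue]⟩⟩
    rw [hf.glue_eq_neg l ho] at hpos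
    omega

lemma IsFlow.eq_one_of_sink (hf : Γ.IsFlow R e₀ f) {l : V × Fin 3} (hl : l ∈ Γ.openIn Rᶜ)
    (hl' : l.1 ∉ Γ.augmentable R e₀ f) (hle : Γ.link l ≠ e₀) : f l = 1 := by
  have hpos : 0 < f l := by
    by_contra! hneg
    exact hl' ⟨l.1, ⟨l.2, hl, hle, hneg⟩, Relation.ReflTransGen.refl⟩
  have := hf.le_one l
  omega

/-- The paths of a flow that cannot be augmented use every link of the cut that bounds the
vertices from which an open link outside of `R` can still be reached. -/
lemma IsFlow.ncard_cut_le [Fintype V] (hf : Γ.IsFlow R e₀ f)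
    (hR : ∀ l ∈ Γ.openIn R, l.1 ∈ Γ.augmentable R e₀ f → Γ.link l ≠ e₀ → f l ≠ 0) :
    ((Γ.cut (Γ.augmentable R e₀ f)ᶜ R \ {e₀}).ncard : ℤ) ≤ ∑ l with l ∈ Γ.openIn Rᶜ, f l := by
  set Y := Γ.augmentable R e₀ f
  let Q : Finset (V × Fin 3) := {l | l ∈ Γ.crossing R Y ∧ Γ.link l ≠ e₀}
  have hsub : Γ.cut Yᶜ R \ {e₀} ⊆ Γ.link '' (Q : Set (V × Fin 3)) := by
    rintro _ ⟨he, hne⟩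
    obtain ⟨l, hl, rfl⟩ := cut_compl_subset Y he
    exact ⟨l, by simpa [Q] using ⟨hl, hne⟩, rfl⟩
  have hcard : (Γ.cut Yᶜ R \ {e₀}).ncard ≤ Q.card := by
    rw [← Set.ncard_coe_finset]
    exact (Set.ncard_le_ncard hsub (Set.toFinite _)).trans
      (Set.ncard_image_le (Finset.finite_toSet Q))
  have hvalue : (Q.card : ℤ) + ∑ l with l.1 ∈ Y ∧ Γ.farEnd l ∈ Γ.region Yᶜ R, f l +
      ∑ l with l.1 ∈ Y ∧ l ∈ Γ.openIn Rᶜ, f l = ∑ l with l ∈ Γ.openIn Rᶜ, f l := by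
    simp only [Q, Finset.card_filter, Nat.cast_sum, Finset.sum_filter, ← Finset.sum_add_distrib]
    refine Finset.sum_congr rfl fun l _ => ?_
    have h₁ : l.1 ∈ Y → Γ.farEnd l ∈ Γ.region Yᶜ R → Γ.link l ≠ e₀ → f l = -1 :=
      fun h h' hle => hf.eq_neg_one_of_leaving h h' hle fun hl => hR l hl h hle
    have h₂ : l ∈ Γ.openIn Rᶜ → l.1 ∉ Y → Γ.link l ≠ e₀ → f l = 1 := hf.eq_one_of_sink
    have h₃ := hf.avoid l
    simp only [crossing, Set.mem_union, Set.mem_ofPred_eq]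
    split_ifs <;> first | omega | grind
  have := hf.sum_leaving Y
  omega

lemma exists_flow [Fintype V] (e₀ : Γ.Link) (n : ℕ)
    (hk : ∀ X : Set V, n ≤ (Γ.cut X R \ {e₀}).ncard) :
    ∃ f, Γ.IsFlow R e₀ f ∧ ∑ l with l ∈ Γ.openIn Rᶜ, f l = n := by
  induction n with
  | zero => exact ⟨fun _ => 0, by constructor <;> simp, by simp⟩
  | succ n ih =>
    obtain ⟨f, hf, hval⟩ := ih fun X => (Nat.le_succ n).trans (hk X)
    obtain ⟨l, hl, hlY, hle, hfl⟩ : ∃ l ∈ Γ.openIn R, l.1 ∈ Γ.augmentable R e₀ f ∧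
        Γ.link l ≠ e₀ ∧ f l = 0 := by
      by_contra! hcon
      have := hf.ncard_cut_le hcon
      have := hk (Γ.augmentable R e₀ f)ᶜ
      omega
    obtain ⟨c, hc⟩ := exists_isAugmentation hlY
    have hf' := hf.add_augmentation hc hl hle hfl
    refine ⟨_, hf', ?_⟩
    have hsource : ∑ l' with l' ∈ Γ.openIn R, c l' = 0 :=
      Finset.sum_eq_zero fun l' h => hc.source l' (Finset.mem_filter.1 h).2
    have hsingle : ∑ l' with l' ∈ Γ.openIn R, (Pi.single l 1 : V × Fin 3 → ℤ) l' = 1 := by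
      rw [Finset.sum_pi_single']
      simp [hl]
    have h₁ := hf.sum_openIn_add
    have h₂ := hf'.sum_openIn_add
    simp only [Pi.sub_apply, Pi.add_apply, Finset.sum_sub_distrib, Finset.sum_add_distrib, hsource,
      hsingle] at h₂ ⊢
    push_cast
    omega

variable (Γ) in
/-- Two legs of `H` that are glued or belong to the same vertex. -/
def Near (H : Set (V × Fin 3)) (l l' : V × Fin 3) : Prop :=
  l ∈ H ∧ l' ∈ H ∧ (l' = Γ.glue l ∨ l.1 = l'.1)

lemma reflTransGen_near_inter {H C : Set (V × Fin 3)} (hC : ∀ l l', Γ.Near H l l' → l ∈ C → l' ∈ C)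
    {l l' : V × Fin 3} (hl : l ∈ C) (h : Relation.ReflTransGen (Γ.Near H) l l') :
    l' ∈ C ∧ Relation.ReflTransGen (Γ.Near (C ∩ H)) l l' := by
  induction h with
  | refl => exact ⟨hl, Relation.ReflTransGen.refl⟩
  | tail _ hbc ih => exact ⟨hC _ _ hbc ih.1,
      ih.2.tail ⟨⟨ih.1, hbc.1⟩, ⟨hC _ _ hbc ih.1, hbc.2.1⟩, hbc.2.2⟩⟩

lemma IsFlow.glue_mem_support (hf : Γ.IsFlow R e₀ f) {l : V × Fin 3} (hl : l ∈ f.support) :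
    Γ.glue l ∈ f.support := by
  by_cases ho : Γ.glue l = l
  · rwa [ho]
  · simpa [hf.glue_eq_neg l ho] using hl

lemma IsFlow.ncard_support_at (hf : Γ.IsFlow R e₀ f) {x : V} {a : Fin 3}
    (ha : (x, a) ∈ f.support) : {b | (x, b) ∈ f.support}.ncard = 2 := by
  have hsum := hf.sum_eq_zero x
  have h (b) : f (x, b) = -1 ∨ f (x, b) = 0 ∨ f (x, b) = 1 := by
    have := hf.neg_one_le (x, b)
    have := hf.le_one (x, b)
    omega
  have hne : f (x, 0) ≠ 0 ∨ f (x, 1) ≠ 0 ∨ f (x, 2) ≠ 0 := by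
    rw [Function.mem_support] at ha
    fin_cases a
    exacts [Or.inl ha, Or.inr (Or.inl ha), Or.inr (Or.inr ha)]
  simp only [Function.mem_support]
  rw [Set.ncard_eq_toFinset_card', Set.toFinset_ofPred, Finset.card_filter, Fin.sum_univ_three]
  rw [Fin.sum_univ_three] at hsum
  have := h 0
  have := h 1
  have := h 2
  split_ifs <;> omega

lemma IsFlow.indicator (hf : Γ.IsFlow R e₀ f) {C : Set (V × Fin 3)}
    (hC : ∀ l l', Γ.Near f.support l l' → l ∈ C → l' ∈ C) : Γ.IsFlow R e₀ (C.indicator f) := by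
  have hcases (l) : C.indicator f l = f l ∨ C.indicator f l = 0 := by
    by_cases h : l ∈ C <;> simp [h]
  refine ⟨fun l => ?_, fun l => ?_, fun l ho => ?_, fun l hl => ?_, fun l hl => ?_,
    fun l hl => ?_, fun x => ?_⟩
  · rcases hcases l with h | h <;> simp [h, hf.neg_one_le]
  · rcases hcases l with h | h <;> simp [h, hf.le_one]
  · by_cases hl : l ∈ f.support
    · have hmem : Γ.glue l ∈ C ↔ l ∈ C := by
        have hl' := hf.glue_mem_support hl
        exact ⟨hC _ _ ⟨hl', hl, Or.inl (Γ.glue_glue l).symm⟩, hC _ _ ⟨hl, hl', Or.inl rfl⟩⟩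
      by_cases h : l ∈ C <;> simp [hmem, h, hf.glue_eq_neg l ho]
    · rw [Function.notMem_support] at hl
      have hl' : f (Γ.glue l) = 0 := by rw [hf.glue_eq_neg l ho, hl, neg_zero]
      simp [Set.indicator_apply, hl, hl']
  · rcases hcases l with h | h <;> simp [h, hf.source l hl]
  · rcases hcases l with h | h <;> simp [h, hf.sink l hl]
  · rcases hcases l with h | h <;> simp [h, hf.avoid l hl]
  · by_cases h : ∃ a, (x, a) ∈ C ∧ (x, a) ∈ f.support
    · obtain ⟨a, haC, ha⟩ := h
      rw [← hf.sum_eq_zero x]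
      refine Finset.sum_congr rfl fun b _ => Set.indicator_apply_eq_self.2 fun hb => ?_
      exact by_contra fun hfb => hb (hC _ _ ⟨ha, hfb, Or.inr rfl⟩ haC)
    · push Not at h
      exact Finset.sum_eq_zero fun a _ => Set.indicator_apply_eq_zero.2 fun ha =>
        Function.notMem_support.1 (h a ha)

lemma IsFlow.exists_near_sink [Finite V] (hf : Γ.IsFlow R e₀ f) {l : V × Fin 3}
    (hl : l ∈ Γ.openIn R) (hfl : f l ≠ 0) : ∃ l' ∈ f.support, l' ∈ Γ.openIn Rᶜ ∧
      Relation.ReflTransGen (Γ.Near f.support) l l' := by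
  have := Fintype.ofFinite V
  by_contra! hcon
  let C : Set (V × Fin 3) := {l' | Relation.ReflTransGen (Γ.Near f.support) l l'}
  have hg := hf.indicator (C := C) fun _ _ h hreach => Relation.ReflTransGen.tail hreach h
  have hsink : ∑ l' with l' ∈ Γ.openIn Rᶜ, C.indicator f l' = 0 :=
    Finset.sum_eq_zero fun l' h => Set.indicator_apply_eq_zero.2 fun hreach =>
      by_contra fun hne => hcon l' hne (Finset.mem_filter.1 h).2 hreach
  have hsource : ∑ l' with l' ∈ Γ.openIn R, C.indicator f l' < 0 := by
    refine Finset.sum_neg' (fun l' h => hg.source l' (Finset.mem_filter.1 h).2) ⟨l, by simpa, ?_⟩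
    rw [Set.indicator_of_mem (show l ∈ C from Relation.ReflTransGen.refl)]
    exact lt_of_le_of_ne (hf.source l hl) hfl
  linarith [hg.sum_openIn_add]

lemma IsFlow.ncard_source [Fintype V] (hf : Γ.IsFlow R e₀ f) :
    ({l | l ∈ f.support ∧ l ∈ Γ.openIn R}.ncard : ℤ) = -∑ l with l ∈ Γ.openIn R, f l := by
  rw [Set.ncard_eq_toFinset_card', Set.toFinset_ofPred, Finset.card_filter, Nat.cast_sum,
    Finset.sum_filter, ← Finset.sum_neg_distrib]
  refine Finset.sum_congr rfl fun l _ => ?_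
  by_cases h : l ∈ Γ.openIn R
  · have := hf.source l h
    have := hf.neg_one_le l
    simp only [h, Function.mem_support, and_true, if_true]
    split_ifs <;> push_cast <;> omega
  · simp [h]

lemma IsFlow.ncard_sink [Fintype V] (hf : Γ.IsFlow R e₀ f) :
    ({l | l ∈ f.support ∧ l ∈ Γ.openIn Rᶜ}.ncard : ℤ) = ∑ l with l ∈ Γ.openIn Rᶜ, f l := by
  rw [Set.ncard_eq_toFinset_card', Set.toFinset_ofPred, Finset.card_filter, Nat.cast_sum,
    Finset.sum_filter]
  refine Finset.sum_congr rfl fun l _ => ?_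
  by_cases h : l ∈ Γ.openIn Rᶜ
  · have := hf.sink l h
    have := hf.le_one l
    simp only [h, Function.mem_support, and_true, if_true]
    split_ifs <;> push_cast <;> omega
  · simp [h]

variable (Γ R) in
/-- The legs of `k` disjoint paths that join the open links in `R` with the others and avoid the
link `e₀`. -/
structure PathSystem (e₀ : Γ.Link) (k : ℕ) (H : Set (V × Fin 3)) : Prop where
  glue_mem : ∀ l ∈ H, Γ.glue l ∈ H
  avoid : ∀ l ∈ H, Γ.link l ≠ e₀
  two : ∀ x a, (x, a) ∈ H → {b | (x, b) ∈ H}.ncard = 2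
  card_in : {l | l ∈ H ∧ l ∈ Γ.openIn R}.ncard = k
  card_out : {l | l ∈ H ∧ l ∈ Γ.openIn Rᶜ}.ncard = k
  conn_in : ∀ l ∈ H, ∃ l₀ ∈ H, l₀ ∈ Γ.openIn R ∧ Relation.ReflTransGen (Γ.Near H) l₀ l
  conn_out : ∀ l₀ ∈ H, l₀ ∈ Γ.openIn R →
    ∃ l₁ ∈ H, l₁ ∈ Γ.openIn Rᶜ ∧ Relation.ReflTransGen (Γ.Near H) l₀ l₁

lemma exists_pathSystem [Finite V] (e₀ : Γ.Link) (k : ℕ)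
    (hk : ∀ X : Set V, k ≤ (Γ.cut X R \ {e₀}).ncard) : ∃ H, Γ.PathSystem R e₀ k H := by
  have := Fintype.ofFinite V
  obtain ⟨f, hf, hval⟩ := exists_flow e₀ k hk
  -- Without its closed loops, the support of an integral flow consists of disjoint paths.
  let C : Set (V × Fin 3) := {l | ∃ l₀ ∈ f.support, l₀ ∈ Γ.openIn R ∧
    Relation.ReflTransGen (Γ.Near f.support) l₀ l}
  have hC (l l') (h : Γ.Near f.support l l') : l ∈ C → l' ∈ C :=
    fun ⟨l₀, h₀, hR, hreach⟩ => ⟨l₀, h₀, hR, hreach.tail h⟩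
  have hg := hf.indicator hC
  have hsource : ∑ l with l ∈ Γ.openIn R, C.indicator f l = -k := by
    have hsame : ∑ l with l ∈ Γ.openIn R, C.indicator f l = ∑ l with l ∈ Γ.openIn R, f l := by
      refine Finset.sum_congr rfl fun l hl => Set.indicator_apply_eq_self.2 fun hlC => ?_
      exact by_contra fun h => hlC ⟨l, h, (Finset.mem_filter.1 hl).2, Relation.ReflTransGen.refl⟩
    linarith [hf.sum_openIn_add]
  refine ⟨(C.indicator f).support, fun l => hg.glue_mem_support, fun l hl h => hl (hg.avoid l h),
    fun x a => hg.ncard_support_at, ?_, ?_, fun l hl => ?_, fun l hl hR => ?_⟩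
  · have := hg.ncard_source
    omega
  · have := hg.ncard_sink
    have := hg.sum_openIn_add
    omega
  · rw [Set.support_indicator] at hl ⊢
    obtain ⟨l₀, h₀, hR, hreach⟩ := hl.1
    have hl₀ : l₀ ∈ C := ⟨l₀, h₀, hR, Relation.ReflTransGen.refl⟩
    exact ⟨l₀, ⟨hl₀, h₀⟩, hR, (reflTransGen_near_inter hC hl₀ hreach).2⟩
  · exact hg.exists_near_sink hR hl

/-- `leg x` leads towards the root of a forest, and `d x` bounds the distance from it. -/
lemma exists_forest (e₀ : Γ.Link) (H : Set (V × Fin 3))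
    (hS : ∀ S : Set V, S.Nonempty →
      ∃ l, l.1 ∈ S ∧ Γ.farEnd l ∉ Γ.region S ∅ ∧ Γ.link l ≠ e₀) :
    ∃ (d : V → ℕ) (leg : V → Fin 3), ∀ x, (∀ a, (x, a) ∉ H) → Γ.link (x, leg x) ≠ e₀ ∧
      (Γ.glue (x, leg x) = (x, leg x) ∨ d (Γ.glue (x, leg x)).1 < d x) := by
  let r : V → V → Prop := fun x y => ∃ a, Γ.link (x, a) ≠ e₀ ∧ (Γ.glue (x, a)).1 = y
  let B : Set V := {x | (∃ a, (x, a) ∈ H) ∨ ∃ a, Γ.link (x, a) ≠ e₀ ∧ Γ.glue (x, a) = (x, a)}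
  obtain ⟨d, hd⟩ := exists_depth r B
  have hreach (x) : ∃ b ∈ B, Relation.ReflTransGen r x b := by
    by_contra hcon
    obtain ⟨l, hl, hfar, hle⟩ := hS {x | ¬ ∃ b ∈ B, Relation.ReflTransGen r x b} ⟨x, hcon⟩
    by_cases ho : Γ.glue l = l
    · exact hl ⟨l.1, Or.inr ⟨l.2, hle, ho⟩, Relation.ReflTransGen.refl⟩
    · rw [Γ.farEnd_of_ne ho, inl_mem_region] at hfar
      obtain ⟨b, hb, h⟩ := not_not.1 hfar
      exact hl ⟨b, hb, h.head ⟨l.2, hle, rfl⟩⟩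
  have hleg (x) : ∃ a, (∀ a, (x, a) ∉ H) → Γ.link (x, a) ≠ e₀ ∧
      (Γ.glue (x, a) = (x, a) ∨ d (Γ.glue (x, a)).1 < d x) := by
    by_cases hx : x ∈ B
    · rcases hx with ⟨a, ha⟩ | ⟨a, hae, hao⟩
      · exact ⟨0, fun h => absurd ha (h a)⟩
      · exact ⟨a, fun _ => ⟨hae, Or.inl hao⟩⟩
    · obtain ⟨y, ⟨a, ha, rfl⟩, hdy, -⟩ := hd x hx (hreach x)
      exact ⟨a, fun _ => ⟨ha, Or.inr hdy⟩⟩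
  choose leg hleg using hleg
  exact ⟨d, leg, hleg⟩

end Network

/-! ### Diagrams of local processes -/

/-- Local processes at the vertices of a network: pairings of the copies on each leg, and gauge
parameters for some of the copies. A copy without gauge parameter is joined with the same copy on
all legs, and this copy has a gauge parameter. -/
structure Propagation (V : Type*) (N : ℕ) (L : Type*) where
  pairing : V × Fin 3 → Copies N → Copies N
  pairing_invol : ∀ l, Function.Involutive (pairing l)
  pairing_ne : ∀ l c, pairing l c ≠ c
  label : V → Copies N → Option L
  label_inj : ∀ {x c x' c' i}, label x c = some i → label x' c' = some i → x = x' ∧ c = c'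
  pairing_of_none : ∀ {x c}, label x c = none → ∀ a b, pairing (x, a) c = pairing (x, b) c
  label_pairing : ∀ {x c}, label x c = none → ∀ a, label x (pairing (x, a) c) ≠ none

lemma freeStrand_ne {N : ℕ} (ρ : Equiv.Perm (Fin N)) (c : Copies N) : freeStrand ρ c ≠ c := by
  rcases c with k | k <;> simp [freeStrand]

lemma freeStrand_injective {N : ℕ} :
    Function.Injective (freeStrand : Equiv.Perm (Fin N) → Copies N → Copies N) := by
  intro ρ ρ' h
  ext k
  have hk := congrFun h (Sum.inl k)
  simp only [freeStrand, Sum.inr.injEq] at hk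
  rw [hk]

namespace Network

variable {V : Type*} (Γ : Network V) {N : ℕ} {R : Set Γ.OpenLeg}

lemma contraction_of_eq {l : V × Fin 3} (h : Γ.glue l = l) (c : Copies N) :
    Γ.contraction N R (l, c) = (l, freeStrand (Γ.boundaryPerm N R (Γ.openLeg l h)) c) :=
  dif_pos h

lemma contraction_of_ne {l : V × Fin 3} (h : Γ.glue l ≠ l) (c : Copies N) :
    Γ.contraction N R (l, c) = (Γ.glue l, c) := dif_neg h

lemma contraction_ne (p : Point V N) : Γ.contraction N R p ≠ p := by
  obtain ⟨l, c⟩ := p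
  by_cases h : Γ.glue l = l
  · rw [Γ.contraction_of_eq h]
    exact fun e => freeStrand_ne _ c (Prod.mk.inj e).2
  · rw [Γ.contraction_of_ne h]
    exact fun e => h (Prod.mk.inj e).1

lemma link_contraction (p : Point V N) : Γ.link (Γ.contraction N R p).1 = Γ.link p.1 := by
  obtain ⟨l, c⟩ := p
  by_cases h : Γ.glue l = l
  · rw [Γ.contraction_of_eq h]
  · rw [Γ.contraction_of_ne h, Γ.link_glue]

end Network

namespace Propagation

variable {V : Type*} {N : ℕ} {L : Type*} (𝒬 : Propagation V N L) (Γ : Network V)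
  (R : Set Γ.OpenLeg)

/-- The gauge parameter at a field argument. -/
def pointLabel (p : Network.Point V N) : Option L := 𝒬.label p.1.1 p.2

/-- The diagram of the local processes `𝒬`. -/
def diagram : StrandedDiagram (Network.Point V N) L where
  contract := Γ.contraction N R
  strand p := (p.1, 𝒬.pairing p.1 p.2)
  contract_invol := Γ.contraction_invol N R
  strand_invol _ := Prod.ext rfl (𝒬.pairing_invol _ _)
  gauge p := (𝒬.pointLabel p).elim 1 FreeGroup.of

/-- The pairing of the copies at the far end of the link of a leg. The faces on this link pass
alternately through it and through the pairing on the leg itself. -/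
def farPairing (l : V × Fin 3) : Copies N → Copies N :=
  if h : Γ.glue l = l then freeStrand (Γ.boundaryPerm N R (Γ.openLeg l h))
  else 𝒬.pairing (Γ.glue l)

variable {Γ R}

lemma farPairing_of_eq {l : V × Fin 3} (h : Γ.glue l = l) :
    𝒬.farPairing Γ R l = freeStrand (Γ.boundaryPerm N R (Γ.openLeg l h)) := dif_pos h

lemma farPairing_of_ne {l : V × Fin 3} (h : Γ.glue l ≠ l) :
    𝒬.farPairing Γ R l = 𝒬.pairing (Γ.glue l) := dif_neg h

variable {𝒬}

lemma diagram_nondegenerate : (𝒬.diagram Γ R).Nondegenerate where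
  strand_ne p h := 𝒬.pairing_ne p.1 p.2 (congrArg Prod.snd h)
  contract_ne := Γ.contraction_ne

lemma face_pairing (l : V × Fin 3) (c : Copies N) :
    (𝒬.diagram Γ R).face (l, 𝒬.pairing l c) = (𝒬.diagram Γ R).face (l, c) :=
  (𝒬.diagram Γ R).face_strand (l, c)

lemma face_glue {l : V × Fin 3} (h : Γ.glue l ≠ l) (c : Copies N) :
    (𝒬.diagram Γ R).face (Γ.glue l, c) = (𝒬.diagram Γ R).face (l, c) := by
  rw [← (𝒬.diagram Γ R).face_contract (l, c)]
  exact congrArg _ (Γ.contraction_of_ne h c).symm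

lemma face_freeStrand_boundaryPerm {l : V × Fin 3} (h : Γ.glue l = l) (c : Copies N) :
    (𝒬.diagram Γ R).face (l, freeStrand (Γ.boundaryPerm N R (Γ.openLeg l h)) c) =
      (𝒬.diagram Γ R).face (l, c) := by
  rw [← (𝒬.diagram Γ R).face_contract (l, c)]
  exact congrArg _ (Γ.contraction_of_eq h c).symm

lemma face_farPairing (l : V × Fin 3) (c : Copies N) :
    (𝒬.diagram Γ R).face (l, 𝒬.farPairing Γ R l c) = (𝒬.diagram Γ R).face (l, c) := by
  by_cases h : Γ.glue l = l
  · rw [𝒬.farPairing_of_eq h, face_freeStrand_boundaryPerm]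
  · rw [𝒬.farPairing_of_ne h, ← face_glue h, face_pairing, face_glue h]

lemma farPairing_ne (l : V × Fin 3) (c : Copies N) : 𝒬.farPairing Γ R l c ≠ c := by
  by_cases h : Γ.glue l = l
  · rw [𝒬.farPairing_of_eq h]
    exact freeStrand_ne _ _
  · rw [𝒬.farPairing_of_ne h]
    exact 𝒬.pairing_ne _ _

variable (𝒬 Γ R) in
/-- The link on which a face runs. -/
def faceLink (f : (𝒬.diagram Γ R).Face) : Γ.Link := Γ.link ((𝒬.diagram Γ R).basePoint f).1

lemma link_eq_of_face_eq {p q : Network.Point V N}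
    (h : (𝒬.diagram Γ R).face p = (𝒬.diagram Γ R).face q) : Γ.link p.1 = Γ.link q.1 :=
  StrandedDiagram.eq_of_face_eq (fun p => Γ.link p.1) (fun _ => rfl)
    (fun p => Γ.link_contraction p) h

lemma faceLink_face (p : Network.Point V N) :
    𝒬.faceLink Γ R ((𝒬.diagram Γ R).face p) = Γ.link p.1 :=
  link_eq_of_face_eq ((𝒬.diagram Γ R).face_basePoint _)

lemma exists_face_eq_of_faceLink_eq {f : (𝒬.diagram Γ R).Face} {l : V × Fin 3}
    (h : 𝒬.faceLink Γ R f = Γ.link l) : ∃ c, (𝒬.diagram Γ R).face (l, c) = f := by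
  obtain ⟨⟨l', c⟩, rfl⟩ : ∃ q, (𝒬.diagram Γ R).face q = f := ⟨_, (𝒬.diagram Γ R).face_basePoint f⟩
  rw [faceLink_face, Γ.link_eq_iff] at h
  by_cases ho : Γ.glue l = l
  · rw [ho, or_self] at h
    exact ⟨c, by rw [← h]⟩
  · rcases h with rfl | rfl
    · exact ⟨c, rfl⟩
    · exact ⟨c, (face_glue ho c).symm⟩

lemma eq_of_face_eq_of_pairing_invariant {α : Type*} {l : V × Fin 3} (φ : Copies N → α)
    (hnear : ∀ c, φ (𝒬.pairing l c) = φ c) (hfar : ∀ c, φ (𝒬.farPairing Γ R l c) = φ c)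
    {c c' : Copies N} (h : (𝒬.diagram Γ R).face (l, c) = (𝒬.diagram Γ R).face (l, c')) :
    φ c = φ c' := by
  have hinv := StrandedDiagram.eq_of_face_eq (𝒢 := 𝒬.diagram Γ R)
    (fun p => if Γ.link p.1 = Γ.link l then some (φ p.2) else none) ?_ ?_ h
  · simpa using hinv
  · rintro ⟨l', c⟩
    change (if Γ.link l' = _ then some (φ (𝒬.pairing l' c)) else none) = _
    refine ite_congr rfl (fun hl => congrArg some ?_) fun _ => rfl
    rcases Γ.link_eq_iff.1 hl with rfl | rfl
    · exact hnear c
    · by_cases ho : Γ.glue l = l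
      · rw [ho, hnear]
      · rw [← 𝒬.farPairing_of_ne (R := R) ho, hfar]
  · rintro ⟨l', c⟩
    change (if Γ.link (Γ.contraction N R (l', c)).1 = _ then _ else _) = _
    rw [Γ.link_contraction]
    refine ite_congr rfl (fun hl => congrArg some ?_) fun _ => rfl
    change φ (Γ.contraction N R (l', c)).2 = φ c
    by_cases ho : Γ.glue l' = l'
    · obtain rfl : l = l' := by
        rwa [Eq.comm, Γ.link_eq_iff, ho, or_self] at hl
      rw [Γ.contraction_of_eq ho, ← 𝒬.farPairing_of_eq ho, hfar]
    · rw [Γ.contraction_of_ne ho]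

lemma two_le_card_copies_on_face (l : V × Fin 3) {f : (𝒬.diagram Γ R).Face}
    (h : 𝒬.faceLink Γ R f = Γ.link l) :
    2 ≤ (Finset.univ.filter fun c => (𝒬.diagram Γ R).face (l, c) = f).card := by
  obtain ⟨c, rfl⟩ := exists_face_eq_of_faceLink_eq h
  refine Nat.succ_le_iff.2 (Finset.one_lt_card.2 ?_)
  exact ⟨c, by simp, 𝒬.pairing l c, by simp [face_pairing], (𝒬.pairing_ne l c).symm⟩

section FaceCount

variable [Finite V]

lemma sum_card_copies_on_face (l : V × Fin 3) :
    ∑ f : (𝒬.diagram Γ R).Face with 𝒬.faceLink Γ R f = Γ.link l,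
      (Finset.univ.filter fun c => (𝒬.diagram Γ R).face (l, c) = f).card = 2 * N := by
  have hcard := Finset.card_eq_sum_card_fiberwise (s := (Finset.univ : Finset (Copies N)))
    (t := Finset.univ.filter fun f => 𝒬.faceLink Γ R f = Γ.link l)
    (f := fun c => (𝒬.diagram Γ R).face (l, c)) fun c _ => by simp [faceLink_face]
  rw [← hcard]
  simp [two_mul]

lemma card_faces_le (e : Γ.Link) :
    (Finset.univ.filter fun f => 𝒬.faceLink Γ R f = e).card ≤ N := by
  obtain ⟨l, rfl⟩ := Γ.exists_eq_link e
  have htwo := Finset.card_nsmul_le_sum (Finset.univ.filter fun f => 𝒬.faceLink Γ R f = Γ.link l)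
    _ 2 fun f hf => two_le_card_copies_on_face l (Finset.mem_filter.1 hf).2
  rw [sum_card_copies_on_face, smul_eq_mul] at htwo
  omega

/-- Where the pairings at the two ends differ, some face passes through at least three copies. -/
lemma card_faces_lt {l : V × Fin 3} (h : 𝒬.pairing l ≠ 𝒬.farPairing Γ R l) :
    (Finset.univ.filter fun f => 𝒬.faceLink Γ R f = Γ.link l).card < N := by
  obtain ⟨c, hc⟩ := Function.ne_iff.1 h
  have hthree : 2 < (Finset.univ.filter fun c' =>
      (𝒬.diagram Γ R).face (l, c') = (𝒬.diagram Γ R).face (l, c)).card :=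
    Finset.two_lt_card.2 ⟨c, by simp, 𝒬.pairing l c, by simp [face_pairing],
      𝒬.farPairing Γ R l c, by simp [face_farPairing], (𝒬.pairing_ne l c).symm,
      (farPairing_ne l c).symm, hc⟩
  have hsum := Finset.sum_lt_sum (s := Finset.univ.filter fun f => 𝒬.faceLink Γ R f = Γ.link l)
    (fun f hf => two_le_card_copies_on_face l (Finset.mem_filter.1 hf).2)
    ⟨(𝒬.diagram Γ R).face (l, c), by simp [faceLink_face], hthree⟩
  rw [sum_card_copies_on_face, Finset.sum_const, smul_eq_mul] at hsum
  omega

lemma one_le_card_faces (hN : 0 < N) (e : Γ.Link) :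
    1 ≤ (Finset.univ.filter fun f => 𝒬.faceLink Γ R f = e).card := by
  obtain ⟨l, rfl⟩ := Γ.exists_eq_link e
  refine Finset.card_pos.2 ⟨(𝒬.diagram Γ R).face (l, Sum.inl ⟨0, hN⟩), ?_⟩
  simp [faceLink_face]

lemma le_card_faces {l : V × Fin 3} {ρ : Equiv.Perm (Fin N)} (hnear : 𝒬.pairing l = freeStrand ρ)
    (hfar : 𝒬.farPairing Γ R l = freeStrand ρ) :
    N ≤ (Finset.univ.filter fun f => 𝒬.faceLink Γ R f = Γ.link l).card := by
  let incoming : Copies N → Fin N := Sum.elim id ρ.symm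
  have hincoming (c) : incoming (freeStrand ρ c) = incoming c := by
    rcases c with k | k <;> simp [incoming, freeStrand]
  have hinj : Function.Injective fun k : Fin N => (𝒬.diagram Γ R).face (l, Sum.inl k) :=
    fun k k' h => eq_of_face_eq_of_pairing_invariant incoming (fun c => by rw [hnear, hincoming])
      (fun c => by rw [hfar, hincoming]) h
  calc N = (Finset.univ.image fun k : Fin N => (𝒬.diagram Γ R).face (l, Sum.inl k)).card := by
        rw [Finset.card_image_of_injective _ hinj, Finset.card_univ, Fintype.card_fin]
    _ ≤ _ := Finset.card_le_card fun f hf => by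
        obtain ⟨k, _, rfl⟩ := Finset.mem_image.1 hf
        simp [faceLink_face]

lemma card_filter_faceLink_mem (S : Finset Γ.Link) :
    (Finset.univ.filter fun f => 𝒬.faceLink Γ R f ∈ S).card =
      ∑ e ∈ S, (Finset.univ.filter fun f => 𝒬.faceLink Γ R f = e).card := by
  rw [Finset.card_eq_sum_card_fiberwise (f := 𝒬.faceLink Γ R) (t := S)
    fun f hf => Finset.mem_coe.2 (Finset.mem_filter.1 (Finset.mem_coe.1 hf)).2]
  refine Finset.sum_congr rfl fun e he => ?_
  rw [Finset.filter_filter]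
  congr 1
  ext f
  simp only [Finset.mem_filter, Finset.mem_univ, true_and, and_iff_right_iff_imp]
  exact fun h => h ▸ he

lemma card_filter_faceLink_mem_le (S : Finset Γ.Link) {l : V × Fin 3} (hl : Γ.link l ∈ S) :
    ((Finset.univ.filter fun f => 𝒬.faceLink Γ R f ∈ S).card : ℤ) ≤
      N * S.card - if 𝒬.pairing l = 𝒬.farPairing Γ R l then 0 else 1 := by
  have hloss : (if 𝒬.pairing l = 𝒬.farPairing Γ R l then 0 else 1 : ℤ) ≤
      ∑ e ∈ S, ((N : ℤ) - (Finset.univ.filter fun f => 𝒬.faceLink Γ R f = e).card) := by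
    refine le_trans ?_ (Finset.single_le_sum
      (fun e _ => sub_nonneg.2 (by exact_mod_cast card_faces_le e)) hl)
    split_ifs with h
    · exact sub_nonneg.2 (by exact_mod_cast card_faces_le _)
    · have := card_faces_lt h
      omega
  rw [Finset.sum_sub_distrib, Finset.sum_const, nsmul_eq_mul] at hloss
  rw [card_filter_faceLink_mem, Nat.cast_sum]
  linarith

end FaceCount

end Propagation

/-! ### Faces on disjoint paths and on a forest -/

namespace Network

variable {V : Type*} {Γ : Network V} {R : Set Γ.OpenLeg} {e₀ : Γ.Link} {k : ℕ}
  {H : Set (V × Fin 3)}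

lemma eq_of_link_eq (hloop : ∀ l, Γ.glue l ≠ l → (Γ.glue l).1 ≠ l.1) {x : V} {a b : Fin 3}
    (h : Γ.link (x, a) = Γ.link (x, b)) : a = b := by
  rcases Γ.link_eq_iff.1 h with h | h
  · exact (Prod.mk.inj h).2
  · by_cases ho : Γ.glue (x, b) = (x, b)
    · rw [ho] at h
      exact (Prod.mk.inj h).2
    · exact absurd (by rw [← h]) (hloop _ ho)

lemma mem_of_link_mem_image (hglue : ∀ l ∈ H, Γ.glue l ∈ H) {l : V × Fin 3}
    (h : Γ.link l ∈ Γ.link '' H) : l ∈ H := by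
  obtain ⟨l', hl', hlink⟩ := h
  rcases Γ.link_eq_iff.1 hlink.symm with rfl | rfl
  · exact hl'
  · exact hglue _ hl'

lemma two_mul_ncard_image_link [Finite V] (hglue : ∀ l ∈ H, Γ.glue l ∈ H) :
    2 * (Γ.link '' H).ncard = H.ncard + {l | l ∈ H ∧ Γ.glue l = l}.ncard := by
  have := Fintype.ofFinite V
  have hfiber (e) (he : e ∈ (Γ.link '' H).toFinset) :
      ∑ l ∈ H.toFinset with Γ.link l = e, (1 + if Γ.glue l = l then 1 else 0) = 2 := by
    obtain ⟨l, hl, rfl⟩ := Set.mem_toFinset.1 he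
    have hends : H.toFinset.filter (fun l' => Γ.link l' = Γ.link l) = {l, Γ.glue l} := by
      ext l'
      rw [Finset.mem_filter, Set.mem_toFinset, Γ.link_eq_iff, Finset.mem_insert,
        Finset.mem_singleton, and_iff_right_iff_imp]
      rintro (rfl | rfl)
      exacts [hl, hglue _ hl]
    rw [hends]
    by_cases ho : Γ.glue l = l
    · simp [ho]
    · rw [Finset.sum_pair (Ne.symm ho), if_neg ho, if_neg (Γ.glue_glue_ne ho)]
  have hsum := Finset.sum_fiberwise_of_maps_to (s := H.toFinset) (t := (Γ.link '' H).toFinset)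
    (g := Γ.link) (fun l hl => Set.mem_toFinset.2 ⟨l, Set.mem_toFinset.1 hl, rfl⟩)
    (fun l => 1 + if Γ.glue l = l then 1 else 0)
  rw [Finset.sum_congr rfl hfiber, Finset.sum_const, smul_eq_mul, Finset.sum_add_distrib,
    ← Finset.card_eq_sum_ones, ← Finset.card_filter] at hsum
  rw [Set.ncard_eq_toFinset_card', mul_comm, hsum, Set.ncard_eq_toFinset_card',
    Set.ncard_eq_toFinset_card']
  congr 2
  ext l
  simp only [Finset.mem_filter, Set.mem_toFinset, Set.mem_ofPred_eq]

namespace PathSystem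

lemma eq_of_mem (hH : Γ.PathSystem R e₀ k H) {x : V} {a b c : Fin 3} (ha : (x, a) ∈ H)
    (hb : (x, b) ∈ H) (hc : (x, c) ∈ H) (hab : a ≠ b) (hac : a ≠ c) : b = c := by
  by_contra hbc
  have hthree : ({a, b, c} : Set (Fin 3)).ncard ≤ {d | (x, d) ∈ H}.ncard := by
    refine Set.ncard_le_ncard ?_ (Set.toFinite _)
    rintro d (rfl | rfl | rfl) <;> assumption
  rw [hH.two x a ha, Set.ncard_eq_three.2 ⟨a, b, c, hab, hac, hbc, rfl⟩] at hthree
  omega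

lemma ncard_legs [Finite V] (hH : Γ.PathSystem R e₀ k H) : H.ncard = 2 * (Prod.fst '' H).ncard := by
  have := Fintype.ofFinite V
  rw [Set.ncard_eq_toFinset_card' H, Finset.card_eq_sum_card_fiberwise (f := Prod.fst)
    (t := (Prod.fst '' H).toFinset) fun l hl => by simpa using ⟨l.2, by simpa using hl⟩,
    Set.ncard_eq_toFinset_card' (Prod.fst '' H), mul_comm, ← smul_eq_mul, ← Finset.sum_const]
  refine Finset.sum_congr rfl fun x hx => ?_
  obtain ⟨⟨x, a⟩, ha, rfl⟩ := Set.mem_toFinset.1 hx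
  rw [← hH.two x a ha, Set.ncard_eq_toFinset_card']
  refine (congrArg _ ?_).trans (Finset.card_image_of_injective _ (Prod.mk_right_injective x))
  ext ⟨y, b⟩
  simp only [Finset.mem_filter, Finset.mem_image, Set.mem_toFinset, Set.mem_ofPred_eq,
    Prod.mk.injEq]
  exact ⟨fun ⟨hb, hy⟩ => ⟨b, hy ▸ hb, hy.symm, rfl⟩, fun ⟨c, hc, hy, hcb⟩ => hy ▸ hcb ▸ ⟨hc, rfl⟩⟩

lemma ncard_openLegs [Finite V] (hH : Γ.PathSystem R e₀ k H) :
    {l | l ∈ H ∧ Γ.glue l = l}.ncard = 2 * k := by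
  have hsplit : {l | l ∈ H ∧ Γ.glue l = l} =
      {l | l ∈ H ∧ l ∈ Γ.openIn R} ∪ {l | l ∈ H ∧ l ∈ Γ.openIn Rᶜ} := by
    ext l
    simp only [Set.mem_ofPred_eq, Set.mem_union, openIn_compl]
    have := glue_eq_of_openIn (l := l) (R := R)
    tauto
  have hdisj : Disjoint {l | l ∈ H ∧ l ∈ Γ.openIn R} {l | l ∈ H ∧ l ∈ Γ.openIn Rᶜ} :=
    Set.disjoint_left.2 fun l hl hl' => (openIn_compl.1 hl'.2).2 hl.2
  rw [hsplit, Set.ncard_union_eq hdisj (Set.toFinite _) (Set.toFinite _), hH.card_in, hH.card_out,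
    two_mul]

lemma ncard_links [Finite V] (hH : Γ.PathSystem R e₀ k H) :
    (Γ.link '' H).ncard = (Prod.fst '' H).ncard + k := by
  have htwo := two_mul_ncard_image_link hH.glue_mem
  rw [hH.ncard_legs, hH.ncard_openLegs] at htwo
  omega

end PathSystem

variable {X : Set V} {leg : V → Fin 3} {d : V → ℕ}

lemma depth_lt_of_link_leg_eq
    (hleg : ∀ x ∈ X, Γ.glue (x, leg x) = (x, leg x) ∨ d (Γ.glue (x, leg x)).1 < d x) {x : V}
    (hx : x ∈ X) {l : V × Fin 3} (h : Γ.link (x, leg x) = Γ.link l) (hne : l ≠ (x, leg x)) :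
    d l.1 < d x := by
  rcases Γ.link_eq_iff.1 h with h | h
  · exact absurd h.symm hne
  · have hback : Γ.glue (x, leg x) = l := by rw [h, Γ.glue_glue]
    rcases hleg x hx with ho | hlt
    · exact absurd (hback.symm.trans ho) hne
    · rwa [hback] at hlt

lemma injOn_link_leg
    (hleg : ∀ x ∈ X, Γ.glue (x, leg x) = (x, leg x) ∨ d (Γ.glue (x, leg x)).1 < d x) :
    Set.InjOn (fun x => Γ.link (x, leg x)) X := by
  intro x hx y hy hxy
  by_contra hne
  have hyx := depth_lt_of_link_leg_eq hleg hx hxy fun h => hne (Prod.mk.inj h).1.symm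
  have hxy := depth_lt_of_link_leg_eq hleg hy hxy.symm fun h => hne (Prod.mk.inj h).1
  exact lt_asymm hyx hxy

lemma PathSystem.ncard_links_union_forest [Finite V] (hH : Γ.PathSystem R e₀ k H)
    (hleg : ∀ x ∈ (Prod.fst '' H)ᶜ,
      Γ.glue (x, leg x) = (x, leg x) ∨ d (Γ.glue (x, leg x)).1 < d x) :
    (Γ.link '' H ∪ (fun x => Γ.link (x, leg x)) '' (Prod.fst '' H)ᶜ).ncard = Nat.card V + k := by
  have hdisj : Disjoint (Γ.link '' H) ((fun x => Γ.link (x, leg x)) '' (Prod.fst '' H)ᶜ) := by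
    rw [Set.disjoint_right]
    rintro _ ⟨x, hx, rfl⟩ hmem
    exact hx ⟨_, mem_of_link_mem_image hH.glue_mem hmem, rfl⟩
  have hcompl := Set.ncard_add_ncard_compl (Prod.fst '' H) (Set.toFinite _) (Set.toFinite _)
  rw [Set.ncard_union_eq hdisj (Set.toFinite _) (Set.toFinite _), hH.ncard_links,
    (injOn_link_leg hleg).ncard_image]
  omega

lemma exists_pathSystem_of_isMinCut [Finite V] {τ : Set Γ.Link} (hτ : Γ.IsMinCut R τ)
    (huniq : ∀ τ', Γ.IsMinCut R τ' → τ' = τ) (he₀ : e₀ ∉ τ) :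
    ∃ H, Γ.PathSystem R e₀ τ.ncard H := by
  refine exists_pathSystem e₀ τ.ncard fun X => ?_
  have hle := hτ.2 _ (Γ.separates_cut X R)
  by_cases hmem : e₀ ∈ Γ.cut X R
  · have hcard := Set.ncard_sdiff_singleton_add_one hmem (Set.toFinite _)
    by_contra hlt
    have hmin : Γ.IsMinCut R (Γ.cut X R) :=
      ⟨Γ.separates_cut X R, fun τ' h' => le_trans (by omega) (hτ.2 τ' h')⟩
    exact he₀ (huniq _ hmin ▸ hmem)
  · rwa [Set.sdiff_singleton_eq_self hmem]

end Network

/-- Faces in `I₁` may share their parameters with faces in `I₂` but not conversely, so the former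
are eliminated first. -/
lemma StrandedDiagram.Eliminable.exists_union {P L : Type*} {𝒢 : StrandedDiagram P L}
    {label : P → Option L} {I₁ I₂ : Finset 𝒢.Face} {mark₁ mark₂ : 𝒢.Face → P}
    {height₁ height₂ : 𝒢.Face → ℕ} (h₁ : 𝒢.Eliminable label I₁ mark₁ height₁)
    (h₂ : 𝒢.Eliminable label I₂ mark₂ height₂)
    (h : ∀ f ∈ I₂, ∀ p, label p = label (mark₂ f) → 𝒢.face p ∉ I₁) :
    ∃ mark height, 𝒢.Eliminable label (I₁ ∪ I₂) mark height := by
  let mark : 𝒢.Face → P := fun f => if f ∈ I₁ then mark₁ f else mark₂ f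
  let height : 𝒢.Face → ℕ := fun f =>
    if f ∈ I₁ then height₁ f + I₂.sup height₂ + 1 else height₂ f
  have mark_cases {f} (hf : f ∈ I₁ ∪ I₂) :
      f ∈ I₁ ∧ mark f = mark₁ f ∨ f ∉ I₁ ∧ f ∈ I₂ ∧ mark f = mark₂ f := by
    by_cases hf₁ : f ∈ I₁
    · exact Or.inl ⟨hf₁, if_pos hf₁⟩
    · exact Or.inr ⟨hf₁, (Finset.mem_union.1 hf).resolve_left hf₁, if_neg hf₁⟩
  refine ⟨mark, height, fun f hf => ?_, fun f hf => ?_, fun f hf => ?_, fun f hf p hp => ?_⟩ <;>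
    rcases mark_cases hf with ⟨hf₁, hm⟩ | ⟨hf₁, hf₂, hm⟩ <;> rw [hm]
  · exact h₁.face_mark f hf₁
  · exact h₂.face_mark f hf₂
  · exact h₁.label_ne_none f hf₁
  · exact h₂.label_ne_none f hf₂
  · exact h₁.eq_mark f hf₁
  · exact h₂.eq_mark f hf₂
  · intro hlab hne
    by_cases hp₁ : 𝒢.face p ∈ I₁
    · have := h₁.height_lt f hf₁ p hp₁ hlab hne
      simp only [height, if_pos hf₁, if_pos hp₁]
      omega
    · have : height₂ (𝒢.face p) ≤ I₂.sup height₂ :=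
        Finset.le_sup ((Finset.mem_union.1 hp).resolve_left hp₁)
      simp only [height, if_pos hf₁, if_neg hp₁]
      omega
  · intro hlab hne
    have hp₁ := h f hf₂ p hlab
    simp only [height, if_neg hf₁, if_neg hp₁]
    exact h₂.height_lt f hf₂ p ((Finset.mem_union.1 hp).resolve_left hp₁) hlab hne

namespace Propagation

variable {V : Type*} {N : ℕ} {L : Type*} {𝒬 : Propagation V N L} {Γ : Network V}
  {R : Set Γ.OpenLeg} {H : Set (V × Fin 3)} {e₀ : Γ.Link} {k : ℕ}

lemma eq_of_pointLabel_eq {p q : Network.Point V N} (hq : 𝒬.pointLabel q ≠ none)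
    (h : 𝒬.pointLabel p = 𝒬.pointLabel q) : p.1.1 = q.1.1 ∧ p.2 = q.2 := by
  obtain ⟨i, hi⟩ := Option.ne_none_iff_exists'.1 hq
  exact 𝒬.label_inj (h.trans hi) hi

lemma eq_of_pointLabel_eq_of_face_eq (hloop : ∀ l, Γ.glue l ≠ l → (Γ.glue l).1 ≠ l.1)
    {p q : Network.Point V N} (hq : 𝒬.pointLabel q ≠ none)
    (hlab : 𝒬.pointLabel p = 𝒬.pointLabel q)
    (hface : (𝒬.diagram Γ R).face p = (𝒬.diagram Γ R).face q) : p = q := by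
  obtain ⟨hx, hc⟩ := eq_of_pointLabel_eq hq hlab
  have hlink := link_eq_of_face_eq hface
  obtain ⟨⟨x, a⟩, c⟩ := p
  obtain ⟨⟨y, b⟩, c'⟩ := q
  obtain rfl : x = y := hx
  obtain rfl : c = c' := hc
  rw [Network.eq_of_link_eq hloop hlink]

variable (𝒬 Γ R) in
/-- Two faces that share a gauge parameter of a vertex on one of the paths `H`. -/
def Touch (H : Set (V × Fin 3)) (f f' : (𝒬.diagram Γ R).Face) : Prop :=
  ∃ x a b c, (x, a) ∈ H ∧ (x, b) ∈ H ∧ 𝒬.label x c ≠ none ∧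
    (𝒬.diagram Γ R).face ((x, a), c) = f ∧ (𝒬.diagram Γ R).face ((x, b), c) = f'

lemma reflTransGen_touch_symm {f f' : (𝒬.diagram Γ R).Face}
    (h : Relation.ReflTransGen (𝒬.Touch Γ R H) f f') :
    Relation.ReflTransGen (𝒬.Touch Γ R H) f' f := by
  have hsymm : Std.Symm (𝒬.Touch Γ R H) :=
    ⟨fun _ _ ⟨x, a, b, c, ha, hb, hc, hf, hf'⟩ => ⟨x, b, a, c, hb, ha, hc, hf', hf⟩⟩
  exact symm_of (Relation.ReflTransGen (𝒬.Touch Γ R H)) h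

lemma reflTransGen_touch_of_near {l l' : V × Fin 3}
    (h : Relation.ReflTransGen (Γ.Near H) l l') (c : Copies N) :
    Relation.ReflTransGen (𝒬.Touch Γ R H) ((𝒬.diagram Γ R).face (l, c))
      ((𝒬.diagram Γ R).face (l', c)) := by
  induction h with
  | refl => exact Relation.ReflTransGen.refl
  | @tail l₁ l₂ _ hnear ih =>
    refine ih.trans ?_
    obtain ⟨h₁, h₂, rfl | hxy⟩ := hnear
    · by_cases ho : Γ.glue l₁ = l₁
      · rw [ho]
      · rw [face_glue ho]
    · obtain ⟨x, a⟩ := l₁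
      obtain ⟨y, b⟩ := l₂
      obtain rfl : x = y := hxy
      by_cases hc : 𝒬.label x c = none
      · rw [← face_pairing (x, a) c, ← face_pairing (x, b) c, 𝒬.pairing_of_none hc b a]
        exact Relation.ReflTransGen.single
          ⟨x, a, b, _, h₁, h₂, 𝒬.label_pairing hc a, rfl, rfl⟩
      · exact Relation.ReflTransGen.single ⟨x, a, b, c, h₁, h₂, hc, rfl, rfl⟩

/-- At an end of the path outside of `R` the boundary joins the incoming and outgoing copy `k`. -/
lemma reflTransGen_touch_inr_inl {l l₁ : V × Fin 3} (hl₁ : l₁ ∈ Γ.openIn Rᶜ)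
    (h : Relation.ReflTransGen (Γ.Near H) l l₁) (k : Fin N) :
    Relation.ReflTransGen (𝒬.Touch Γ R H) ((𝒬.diagram Γ R).face (l, Sum.inr k))
      ((𝒬.diagram Γ R).face (l, Sum.inl k)) := by
  obtain ⟨ho, hR⟩ := hl₁
  have hend : (𝒬.diagram Γ R).face (l₁, Sum.inr k) = (𝒬.diagram Γ R).face (l₁, Sum.inl k) := by
    rw [← face_freeStrand_boundaryPerm ho (Sum.inl k), Network.boundaryPerm, if_neg hR]
    rfl
  have hfar := reflTransGen_touch_of_near (𝒬 := 𝒬) (R := R) h (Sum.inr k)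
  rw [hend] at hfar
  exact hfar.trans (reflTransGen_touch_symm (reflTransGen_touch_of_near h (Sum.inl k)))

/-- At an end of the path in `R` the boundary joins the incoming copy `k` to the outgoing copy
`k + 1`, so that together with the other end all copies are connected. -/
lemma reflTransGen_touch_inl_zero (hN : 0 < N) {l₀ l₁ : V × Fin 3} (hl₀ : l₀ ∈ Γ.openIn R)
    (hl₁ : l₁ ∈ Γ.openIn Rᶜ) (h : Relation.ReflTransGen (Γ.Near H) l₀ l₁) (k : Fin N) :
    Relation.ReflTransGen (𝒬.Touch Γ R H) ((𝒬.diagram Γ R).face (l₀, Sum.inl k))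
      ((𝒬.diagram Γ R).face (l₀, Sum.inl ⟨0, hN⟩)) := by
  obtain ⟨ho, hR⟩ := hl₀
  have hrotate (k) : (𝒬.diagram Γ R).face (l₀, Sum.inr (finRotate N k)) =
      (𝒬.diagram Γ R).face (l₀, Sum.inl k) := by
    rw [← face_freeStrand_boundaryPerm ho (Sum.inl k), Network.boundaryPerm, if_pos hR]
    rfl
  obtain ⟨n, rfl⟩ : ∃ n, N = n + 1 := ⟨N - 1, by omega⟩
  induction k using Fin.induction with
  | zero => exact Relation.ReflTransGen.refl
  | succ i ih =>
    have hstep := hrotate i.castSucc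
    rw [finRotate_apply, Fin.coeSucc_eq_succ] at hstep
    rw [← hstep] at ih
    exact (reflTransGen_touch_symm (reflTransGen_touch_inr_inl hl₁ h i.succ)).trans ih

lemma exists_root_reflTransGen_touch (hN : 0 < N) (hH : Γ.PathSystem R e₀ k H) {l : V × Fin 3}
    (hl : l ∈ H) (c : Copies N) : ∃ l₀ ∈ H, l₀ ∈ Γ.openIn R ∧
      Relation.ReflTransGen (𝒬.Touch Γ R H) ((𝒬.diagram Γ R).face (l, c))
        ((𝒬.diagram Γ R).face (l₀, Sum.inl ⟨0, hN⟩)) := by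
  obtain ⟨l₀, h₀, hR, hnear⟩ := hH.conn_in l hl
  obtain ⟨l₁, -, hR', hnear'⟩ := hH.conn_out l₀ h₀ hR
  refine ⟨l₀, h₀, hR, (reflTransGen_touch_symm (reflTransGen_touch_of_near hnear c)).trans ?_⟩
  have hin := reflTransGen_touch_inl_zero (𝒬 := 𝒬) hN hR hR' hnear'
  rcases c with k | k
  · exact hin k
  · exact (reflTransGen_touch_inr_inl hR' hnear' k).trans (hin k)

lemma faceLink_face_mem_image_link (hglue : ∀ l ∈ H, Γ.glue l ∈ H) {l : V × Fin 3}
    {c : Copies N} : 𝒬.faceLink Γ R ((𝒬.diagram Γ R).face (l, c)) ∈ Γ.link '' H ↔ l ∈ H := by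
  rw [faceLink_face]
  exact ⟨Network.mem_of_link_mem_image hglue, fun h => ⟨l, h, rfl⟩⟩

lemma exists_roots_dist [Finite V] (hN : 0 < N) (hH : Γ.PathSystem R e₀ k H) :
    ∃ (J : Finset (𝒬.diagram Γ R).Face) (dist : (𝒬.diagram Γ R).Face → ℕ), J.card ≤ k ∧
      ∀ f, 𝒬.faceLink Γ R f ∈ Γ.link '' H ∧ f ∉ J → ∃ q, (𝒬.diagram Γ R).face q = f ∧
        𝒬.pointLabel q ≠ none ∧ q.1 ∈ H ∧
          ∃ b, (q.1.1, b) ∈ H ∧ dist ((𝒬.diagram Γ R).face ((q.1.1, b), q.2)) < dist f := by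
  have := Fintype.ofFinite V
  let 𝒢 := 𝒬.diagram Γ R
  let J : Finset 𝒢.Face := {l | l ∈ H ∧ l ∈ Γ.openIn R}.toFinset.image
    fun l => 𝒢.face (l, Sum.inl ⟨0, hN⟩)
  have hJ : J.card ≤ k := by
    refine Finset.card_image_le.trans ?_
    rw [← hH.card_in, Set.ncard_eq_toFinset_card']
  obtain ⟨dist, hdist⟩ := exists_depth (𝒬.Touch Γ R H) (J : Set 𝒢.Face)
  refine ⟨J, dist, hJ, ?_⟩
  rintro f ⟨⟨l, hl, hfl⟩, hfJ⟩
  obtain ⟨c, rfl⟩ := exists_face_eq_of_faceLink_eq hfl.symm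
  obtain ⟨l₀, h₀, hR, htouch⟩ := exists_root_reflTransGen_touch (𝒬 := 𝒬) hN hH hl c
  have hl₀ : 𝒢.face (l₀, Sum.inl ⟨0, hN⟩) ∈ J :=
    Finset.mem_image_of_mem _ (Set.mem_toFinset.2 ⟨h₀, hR⟩)
  obtain ⟨_, ⟨x, a, b, c', ha, hb, hc', hf, rfl⟩, hlt, -⟩ := hdist _ hfJ ⟨_, hl₀, htouch⟩
  exact ⟨((x, a), c'), hf, hc', ha, b, hb, hlt⟩

/-- All but one face on each path: the faces on a path are connected by shared gauge parameters,
and each face is eliminated through one that it shares with a face closer to the remaining one. -/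
lemma exists_eliminable_paths [Finite V] (hN : 0 < N)
    (hloop : ∀ l, Γ.glue l ≠ l → (Γ.glue l).1 ≠ l.1) (hH : Γ.PathSystem R e₀ k H) :
    ∃ (J : Finset (𝒬.diagram Γ R).Face) (mark : _) (height : _), J.card ≤ k ∧
      (𝒬.diagram Γ R).Eliminable 𝒬.pointLabel
        (Finset.univ.filter fun f => 𝒬.faceLink Γ R f ∈ Γ.link '' H ∧ f ∉ J) mark height := by
  obtain ⟨J, dist, hJ, hcloser⟩ := exists_roots_dist (𝒬 := 𝒬) hN hH
  have hmark (f) : ∃ q, 𝒬.faceLink Γ R f ∈ Γ.link '' H ∧ f ∉ J → (𝒬.diagram Γ R).face q = f ∧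
      𝒬.pointLabel q ≠ none ∧ q.1 ∈ H ∧
        ∃ b, (q.1.1, b) ∈ H ∧ dist ((𝒬.diagram Γ R).face ((q.1.1, b), q.2)) < dist f := by
    by_cases hf : 𝒬.faceLink Γ R f ∈ Γ.link '' H ∧ f ∉ J
    · exact (hcloser f hf).imp fun _ hq _ => hq
    · exact ⟨(𝒬.diagram Γ R).basePoint f, fun h => absurd h hf⟩
  choose mark hmark using hmark
  refine ⟨J, mark, dist, hJ, fun f hf => ?_, fun f hf => ?_, fun f hf p hp hlab => ?_,
    fun f hf p hpI hlab hne => ?_⟩ <;>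
    obtain ⟨hface, hnone, ha, b, hb, hlt⟩ := hmark f (Finset.mem_filter.1 hf).2
  · exact hface
  · exact hnone
  · exact eq_of_pointLabel_eq_of_face_eq hloop hnone hlab (hp.trans hface.symm)
  · obtain ⟨hx, hc⟩ := eq_of_pointLabel_eq hnone hlab
    obtain ⟨⟨x, a'⟩, c⟩ := p
    have ha' := (faceLink_face_mem_image_link hH.glue_mem).1 (Finset.mem_filter.1 hpI).2.1
    generalize mark f = q at hface ha hb hlt hx hc
    obtain ⟨⟨y, a⟩, c'⟩ := q
    obtain rfl : x = y := hx
    obtain rfl : c = c' := hc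
    have hab : a ≠ b := by
      rintro rfl
      exact hlt.ne (congrArg dist hface)
    have haa' : a ≠ a' := by
      rintro rfl
      exact hne hface
    rwa [← hH.eq_of_mem ha hb ha' hab haa']

lemma exists_eliminable_forest [Finite V] (hloop : ∀ l, Γ.glue l ≠ l → (Γ.glue l).1 ≠ l.1)
    {X : Set V} {leg : V → Fin 3} {d : V → ℕ}
    (hleg : ∀ x ∈ X, Γ.glue (x, leg x) = (x, leg x) ∨ d (Γ.glue (x, leg x)).1 < d x) :
    ∃ mark height, (𝒬.diagram Γ R).Eliminable 𝒬.pointLabel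
        (Finset.univ.filter fun f => 𝒬.faceLink Γ R f ∈ (fun x => Γ.link (x, leg x)) '' X)
        mark height ∧
      ∀ f, 𝒬.faceLink Γ R f ∈ (fun x => Γ.link (x, leg x)) '' X → (mark f).1.1 ∈ X := by
  let 𝒢 := 𝒬.diagram Γ R
  have hmark (f) : ∃ q : Network.Point V N, 𝒬.faceLink Γ R f ∈ (fun x => Γ.link (x, leg x)) '' X →
      𝒢.face q = f ∧ 𝒬.pointLabel q ≠ none ∧ q.1.1 ∈ X ∧ q.1.2 = leg q.1.1 := by
    by_cases hf : 𝒬.faceLink Γ R f ∉ (fun x => Γ.link (x, leg x)) '' X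
    · exact ⟨𝒢.basePoint f, fun h => absurd h hf⟩
    obtain ⟨x, hx, hfx⟩ := not_not.1 hf
    obtain ⟨c, rfl⟩ := exists_face_eq_of_faceLink_eq hfx.symm
    by_cases hc : 𝒬.label x c = none
    · exact ⟨((x, leg x), 𝒬.pairing (x, leg x) c),
        fun _ => ⟨face_pairing _ _, 𝒬.label_pairing hc _, hx, rfl⟩⟩
    · exact ⟨((x, leg x), c), fun _ => ⟨rfl, hc, hx, rfl⟩⟩
  choose mark hmark using hmark
  obtain ⟨M, hM⟩ : ∃ M, ∀ x, d x ≤ M := by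
    obtain ⟨M, hM⟩ := (Set.finite_range d).bddAbove
    exact ⟨M, fun x => hM ⟨x, rfl⟩⟩
  refine ⟨mark, fun f => M - d (mark f).1.1, ⟨fun f hf => ?_, fun f hf => ?_,
    fun f hf p hp hlab => ?_, fun f hf p hpI hlab hne => ?_⟩, fun f hf => (hmark f hf).2.2.1⟩ <;>
    obtain ⟨hface, hnone, -, hlegx⟩ := hmark f (Finset.mem_filter.1 hf).2
  · exact hface
  · exact hnone
  · exact eq_of_pointLabel_eq_of_face_eq hloop hnone hlab (hp.trans hface.symm)
  · obtain ⟨hface', -, hy, hlegy⟩ := hmark _ (Finset.mem_filter.1 hpI).2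
    have hpx := (eq_of_pointLabel_eq hnone hlab).1
    set y := (mark (𝒢.face p)).1.1
    have hylink : Γ.link (y, leg y) = Γ.link p.1 := by
      rw [← hlegy]
      exact link_eq_of_face_eq hface'
    have hyp : p.1 ≠ (y, leg y) := by
      intro hpy
      refine hne ((congrArg 𝒢.face ?_).trans hface)
      refine Prod.ext (Prod.ext hpx ?_) (eq_of_pointLabel_eq hnone hlab).2
      rw [hlegx, ← hpx, hpy]
    have hlt := Network.depth_lt_of_link_leg_eq hleg hy hylink hyp
    rw [hpx] at hlt
    have := hM y
    omega

lemma exists_eliminable_paths_union_forest [Finite V] (hN : 0 < N)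
    (hloop : ∀ l, Γ.glue l ≠ l → (Γ.glue l).1 ≠ l.1) (hH : Γ.PathSystem R e₀ k H)
    {leg : V → Fin 3} {d : V → ℕ} (hleg : ∀ x ∈ (Prod.fst '' H)ᶜ,
      Γ.glue (x, leg x) = (x, leg x) ∨ d (Γ.glue (x, leg x)).1 < d x) :
    ∃ (J : Finset (𝒬.diagram Γ R).Face) (mark : _) (height : _), J.card ≤ k ∧
      (𝒬.diagram Γ R).Eliminable 𝒬.pointLabel (Finset.univ.filter fun f => 𝒬.faceLink Γ R f ∈
        Γ.link '' H ∪ (fun x => Γ.link (x, leg x)) '' (Prod.fst '' H)ᶜ ∧ f ∉ J) mark height := by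
  obtain ⟨J, mark₁, height₁, hJ, hpaths⟩ := exists_eliminable_paths (𝒬 := 𝒬) hN hloop hH
  obtain ⟨mark₂, height₂, hforest, hmark₂⟩ :=
    exists_eliminable_forest (𝒬 := 𝒬) (R := R) hloop hleg
  obtain ⟨mark, height, hunion⟩ := hpaths.exists_union hforest fun f hf p hlab hp => by
    refine hmark₂ f (Finset.mem_filter.1 hf).2 ⟨p.1, ?_, ?_⟩
    · exact (faceLink_face_mem_image_link hH.glue_mem).1 (Finset.mem_filter.1 hp).2.1
    · exact (eq_of_pointLabel_eq (hforest.label_ne_none f hf) hlab).1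
  refine ⟨J, mark, height, hJ, hunion.mono fun f hf => ?_⟩
  simp only [Finset.mem_filter, Finset.mem_union, Finset.mem_univ, true_and, Set.mem_union] at hf ⊢
  tauto

lemma exists_eliminable_card_le [Finite V] (hN : 0 < N) (hbdry : Nonempty Γ.OpenLeg)
    (htree : ¬ Γ.CoarseGrainable) {τ : Set Γ.Link} (hτ : Γ.IsMinCut R τ)
    (huniq : ∀ τ', Γ.IsMinCut R τ' → τ' = τ) {l₀ : V × Fin 3} (hl₀ : Γ.link l₀ ∉ τ) :
    ∃ (I : Finset (𝒬.diagram Γ R).Face) (mark : _) (height : _),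
      (𝒬.diagram Γ R).Eliminable 𝒬.pointLabel I mark height ∧
      (Iᶜ.card : ℤ) ≤ N * ((Nat.card Γ.Link : ℤ) - Nat.card V) - (N - 1) * τ.ncard -
        if 𝒬.pairing l₀ = 𝒬.farPairing Γ R l₀ then 0 else 1 := by
  obtain ⟨H, hH⟩ := Network.exists_pathSystem_of_isMinCut hτ huniq hl₀
  obtain ⟨d, leg, hleg⟩ := Network.exists_forest (Γ.link l₀) H fun S hS => by
    obtain ⟨l, hl, hfar, -, hne⟩ :=
      Network.exists_leaving_link_notMem hbdry htree hτ huniq hS (Γ.link l₀)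
    exact ⟨l, hl, hfar, hne⟩
  have hleg (x) (hx : x ∈ (Prod.fst '' H)ᶜ) := hleg x fun a ha => hx ⟨_, ha, rfl⟩
  obtain ⟨J, mark, height, hJ, hI⟩ := exists_eliminable_paths_union_forest (𝒬 := 𝒬) hN
    (fun _ => Network.glue_fst_ne hbdry htree) hH fun x hx => (hleg x hx).2
  refine ⟨_, mark, height, hI, ?_⟩
  have hcard := hH.ncard_links_union_forest fun x hx => (hleg x hx).2
  set U : Set Γ.Link := Γ.link '' H ∪ (fun x => Γ.link (x, leg x)) '' (Prod.fst '' H)ᶜ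
  have hl₀U : Γ.link l₀ ∈ U.toFinsetᶜ := by
    rw [Finset.mem_compl, Set.mem_toFinset]
    rintro (⟨l, hl, h⟩ | ⟨x, hx, h⟩)
    exacts [hH.avoid l hl h, (hleg x hx).1 h]
  have hUc : (U.toFinsetᶜ.card : ℤ) = Nat.card Γ.Link - (Nat.card V + τ.ncard) := by
    have := Finset.card_add_card_compl U.toFinset
    rw [← Set.ncard_eq_toFinset_card', hcard, ← Nat.card_eq_fintype_card] at this
    omega
  have hsub : (Finset.univ.filter fun f => 𝒬.faceLink Γ R f ∈ U ∧ f ∉ J)ᶜ ⊆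
      J ∪ Finset.univ.filter fun f => 𝒬.faceLink Γ R f ∈ U.toFinsetᶜ := by
    intro f hf
    simp only [Finset.mem_compl, Finset.mem_filter, Finset.mem_univ, true_and, Finset.mem_union,
      Set.mem_toFinset] at hf ⊢
    tauto
  have hcompl := (Finset.card_le_card hsub).trans (Finset.card_union_le _ _)
  have hloss := card_filter_faceLink_mem_le (𝒬 := 𝒬) (R := R) _ hl₀U
  rw [hUc] at hloss
  zify at hcompl hJ
  linarith

end Propagation

/-! ### Free diagrams and diagrams with a single interaction -/

section Strands

variable {N : ℕ} (ρ : Equiv.Perm (Fin N)) {i j : Fin N}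

lemma intStrand_ne (hij : i ≠ j) (a : Fin 3) (c : Copies N) : intStrand ρ i j a c ≠ c := by
  fin_cases a
  · exact freeStrand_ne _ _
  · exact freeStrand_ne _ _
  · rcases c with k | k <;> simp only [intStrand] <;> split_ifs <;> simp [hij.symm, *]

lemma intStrand_inr_of_ne {k : Fin N} (hi : k ≠ ρ i) (hj : k ≠ ρ j) (a : Fin 3) :
    intStrand ρ i j a (Sum.inr k) = Sum.inl (ρ.symm k) := by
  have hi' : ρ.symm k ≠ i := fun h => hi (ρ.symm_apply_eq.1 h)
  have hj' : ρ.symm k ≠ j := fun h => hj (ρ.symm_apply_eq.1 h)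
  fin_cases a
  · rfl
  · refine congrArg Sum.inl ?_
    rw [Equiv.symm_apply_eq, Equiv.Perm.mul_apply, Equiv.swap_apply_of_ne_of_ne hi' hj',
      Equiv.apply_symm_apply]
  · simp [intStrand, hi, hj]

/-- On the first two legs an interaction acts as the free propagation of two distinct
permutations, so one of them differs from any given permutation. -/
lemma exists_intStrand_eq_freeStrand_ne (hij : i ≠ j) (ρ' : Equiv.Perm (Fin N)) :
    ∃ a ≠ 2, ∃ σ ≠ ρ', intStrand ρ i j a = freeStrand σ ∧
      ∀ b ≠ 2, b ≠ a → intStrand ρ i j b ≠ freeStrand σ := by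
  have hswap : ρ ≠ ρ * Equiv.swap i j := fun h =>
    hij (Equiv.swap_eq_one_iff.1 (mul_eq_left.1 h.symm))
  by_cases hρ : ρ = ρ'
  · refine ⟨1, by decide, ρ * Equiv.swap i j, fun h => hswap (hρ.trans h.symm), rfl, ?_⟩
    intro b hb hb'
    obtain rfl : b = 0 := by omega
    exact freeStrand_injective.ne hswap
  · refine ⟨0, by decide, ρ, hρ, rfl, fun b hb hb' => ?_⟩
    obtain rfl : b = 1 := by omega
    exact freeStrand_injective.ne hswap.symm

end Strands

variable {V : Type*} {N : ℕ}

/-- The local processes of a free diagram: the incoming copies carry the gauge parameters. -/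
def freePropagation (π : V → Equiv.Perm (Fin N)) : Propagation V N (V × Fin N) where
  pairing l := freeStrand (π l.1)
  pairing_invol _ := freeStrand_invol _
  pairing_ne _ := freeStrand_ne _
  label x := Sum.elim (fun k => some (x, k)) fun _ => none
  label_inj := by
    rintro x (k | k) x' (k' | k') i h h' <;> simp at h h'
    grind
  pairing_of_none _ _ _ := rfl
  label_pairing := by
    rintro x (k | k) h a <;> simp_all [freeStrand]

lemma freeDiagram_eq (Γ : Network V) (R : Set Γ.OpenLeg) (π : V → Equiv.Perm (Fin N)) :
    Γ.freeDiagram R π = (freePropagation π).diagram Γ R := by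
  unfold Network.freeDiagram Propagation.diagram freePropagation
  congr 1
  funext ⟨l, c⟩
  rcases c with k | k <;> rfl

/-- The local processes of a diagram with a single interaction: gauge parameters are carried by the
incoming copies and by the two outgoing copies that interact. -/
def interactionPropagation (I : Interaction V N) : Propagation V N ((V × Fin N) ⊕ Fin 2) where
  pairing l := if l.1 = I.node then intStrand (I.perm l.1) I.fst I.snd l.2
    else freeStrand (I.perm l.1)
  pairing_invol l := by
    split_ifs
    · exact intStrand_invol _ _ _ _
    · exact freeStrand_invol _
  pairing_ne l c := by
    split_ifs
    · exact intStrand_ne _ I.fst_ne_snd _ _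
    · exact freeStrand_ne _ _
  label x := Sum.elim (fun k => some (Sum.inl (x, k))) fun k =>
    if x = I.node ∧ k = I.perm x I.fst then some (Sum.inr 0)
    else if x = I.node ∧ k = I.perm x I.snd then some (Sum.inr 1) else none
  label_inj := by
    rintro x (k | k) x' (k' | k') i h h' <;>
      simp only [Sum.elim_inl, Sum.elim_inr] at h h' <;> grind
  pairing_of_none := by
    rintro x (k | k) h a b
    · simp at h
    · simp only [Sum.elim_inr] at h
      split_ifs at h with h₁ h₂
      split_ifs with hx
      · rw [intStrand_inr_of_ne, intStrand_inr_of_ne] <;> tauto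
      · rfl
  label_pairing := by
    rintro x (k | k) h a
    · simp at h
    · simp only [Sum.elim_inr] at h
      split_ifs at h with h₁ h₂
      split_ifs with hx
      · rw [intStrand_inr_of_ne _ (by tauto) (by tauto)]
        exact Option.some_ne_none _
      · exact Option.some_ne_none _

lemma interactionPropagation_pairing_node (I : Interaction V N) (a : Fin 3) :
    (interactionPropagation I).pairing (I.node, a) =
      intStrand (I.perm I.node) I.fst I.snd a := if_pos rfl

lemma interactionPropagation_pairing_of_ne {I : Interaction V N} {l : V × Fin 3}
    (h : l.1 ≠ I.node) :
    (interactionPropagation I).pairing l = freeStrand (I.perm l.1) := if_neg h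

lemma interactionDiagram_eq (Γ : Network V) (R : Set Γ.OpenLeg) (I : Interaction V N) :
    Γ.interactionDiagram R I = (interactionPropagation I).diagram Γ R := by
  unfold Network.interactionDiagram Propagation.diagram interactionPropagation
  congr 1
  · funext p
    by_cases h : p.1.1 = I.node <;> simp [h]
  · funext ⟨l, c⟩
    rcases c with k | k
    · rfl
    · simp only [Propagation.pointLabel, Sum.elim_inr]
      split_ifs <;> rfl

namespace Network

variable {Γ : Network V} {R : Set Γ.OpenLeg} {τ : Set Γ.Link}

lemma wallPattern_eq (x : V) :
    Γ.wallPattern N R τ x = if x ∈ Γ.wallSide R τ then finRotate N else 1 := rfl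

lemma interactionPropagation_pairing_two_ne_farPairing
    (hloop : ∀ l, Γ.glue l ≠ l → (Γ.glue l).1 ≠ l.1) (I : Interaction V N) :
    (interactionPropagation I).pairing (I.node, 2) ≠
      (interactionPropagation I).farPairing Γ R (I.node, 2) := by
  rw [interactionPropagation_pairing_node]
  refine Function.ne_iff.2 ⟨Sum.inl I.fst, ?_⟩
  by_cases h : Γ.glue (I.node, 2) = (I.node, 2)
  · rw [Propagation.farPairing_of_eq _ h]
    simp [intStrand, freeStrand]
  · rw [Propagation.farPairing_of_ne _ h, interactionPropagation_pairing_of_ne (hloop _ h)]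
    simp [intStrand, freeStrand]

variable [Finite V]

lemma IsMinCut.mem_wallSide_iff (hτ : Γ.IsMinCut R τ) {l : V × Fin 3} (hl : Γ.link l ∉ τ) :
    l.1 ∈ Γ.wallSide R τ ↔ Γ.farEnd l ∈ Γ.region (Γ.wallSide R τ) R := by
  rw [← hτ.cut_eq, link_mem_cut] at hl
  exact not_not.1 hl

lemma IsMinCut.wallPattern_glue (hτ : Γ.IsMinCut R τ) {l : V × Fin 3} (hl : Γ.link l ∉ τ)
    (h : Γ.glue l ≠ l) : Γ.wallPattern N R τ (Γ.glue l).1 = Γ.wallPattern N R τ l.1 := by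
  have hside := hτ.mem_wallSide_iff hl
  rw [Γ.farEnd_of_ne h, inl_mem_region] at hside
  simp only [wallPattern_eq, hside]

lemma IsMinCut.boundaryPerm_eq_wallPattern (hτ : Γ.IsMinCut R τ) {l : V × Fin 3}
    (hl : Γ.link l ∉ τ) (h : Γ.glue l = l) :
    Γ.boundaryPerm N R (Γ.openLeg l h) = Γ.wallPattern N R τ l.1 := by
  have hside := hτ.mem_wallSide_iff hl
  rw [Γ.farEnd_of_eq h, inr_mem_region] at hside
  simp only [boundaryPerm, wallPattern_eq, hside]

lemma IsMinCut.farPairing_wallPattern (hτ : Γ.IsMinCut R τ) {l : V × Fin 3}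
    (hl : Γ.link l ∉ τ) :
    (freePropagation (Γ.wallPattern N R τ)).farPairing Γ R l =
      (freePropagation (Γ.wallPattern N R τ)).pairing l := by
  by_cases h : Γ.glue l = l
  · rw [Propagation.farPairing_of_eq _ h, hτ.boundaryPerm_eq_wallPattern hl h]
    rfl
  · rw [Propagation.farPairing_of_ne _ h]
    exact congrArg freeStrand (hτ.wallPattern_glue hl h)

lemma link_notMem_of_link_mem (hbdry : Nonempty Γ.OpenLeg) (htree : ¬ Γ.CoarseGrainable)
    (hτ : Γ.IsMinCut R τ) (huniq : ∀ τ', Γ.IsMinCut R τ' → τ' = τ) {x : V} {a b : Fin 3}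
    (hab : b ≠ a) (ha : Γ.link (x, a) ∈ τ) : Γ.link (x, b) ∉ τ := by
  obtain ⟨c, hca, hcb⟩ : ∃ c, c ≠ a ∧ c ≠ b := by
    clear * - a b
    decide +revert
  obtain ⟨⟨y, d⟩, rfl, -, hdτ, hdc⟩ := exists_leaving_link_notMem hbdry htree hτ huniq
    (Set.singleton_nonempty x) (Γ.link (x, c))
  have hda : d ≠ a := by
    rintro rfl
    exact hdτ ha
  have hdc' : d ≠ c := by
    rintro rfl
    exact hdc rfl
  obtain rfl : d = b := by omega
  exact hdτ

/-- Some link other than `e` leaves `S` without crossing the minimal cut. Its two ends lie on the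
same side of the cut, so the copies can only match along it if the pairing continues outside `S`. -/
lemma exists_pairing_ne_farPairing_of_pairing_eq {L : Type*} {𝒬 : Propagation V N L}
    (hbdry : Nonempty Γ.OpenLeg) (htree : ¬ Γ.CoarseGrainable) (hτ : Γ.IsMinCut R τ)
    (huniq : ∀ τ', Γ.IsMinCut R τ' → τ' = τ) {S : Set V} (hS : S.Nonempty)
    (e : Γ.Link) {σ : Equiv.Perm (Fin N)}
    (hpair : ∀ l : V × Fin 3, l.1 ∈ S → 𝒬.pairing l = freeStrand σ)
    (hpattern : ∀ x ∈ S, σ ≠ Γ.wallPattern N R τ x)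
    (hout : ∀ l : V × Fin 3, l.1 ∈ S → Γ.glue l ≠ l → (Γ.glue l).1 ∉ S → Γ.link l ∉ τ →
      Γ.link l ≠ e → 𝒬.pairing (Γ.glue l) ≠ freeStrand σ) :
    ∃ l, Γ.link l ∉ τ ∧ 𝒬.pairing l ≠ 𝒬.farPairing Γ R l := by
  obtain ⟨l, hl, hfar, hlτ, hle⟩ := exists_leaving_link_notMem hbdry htree hτ huniq hS e
  refine ⟨l, hlτ, ?_⟩
  rw [hpair l hl]
  by_cases h : Γ.glue l = l
  · rw [𝒬.farPairing_of_eq h, hτ.boundaryPerm_eq_wallPattern hlτ h]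
    exact freeStrand_injective.ne (hpattern _ hl)
  · rw [𝒬.farPairing_of_ne h]
    rw [Γ.farEnd_of_ne h, inl_mem_region] at hfar
    exact (hout l hl h hfar hlτ hle).symm

lemma exists_freePropagation_pairing_ne_farPairing (hbdry : Nonempty Γ.OpenLeg)
    (htree : ¬ Γ.CoarseGrainable) (hτ : Γ.IsMinCut R τ)
    (huniq : ∀ τ', Γ.IsMinCut R τ' → τ' = τ) {π : V → Equiv.Perm (Fin N)}
    (hπ : π ≠ Γ.wallPattern N R τ) :
    ∃ l, Γ.link l ∉ τ ∧ (freePropagation π).pairing l ≠ (freePropagation π).farPairing Γ R l := by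
  obtain ⟨x, hx⟩ := Function.ne_iff.1 hπ
  refine exists_pairing_ne_farPairing_of_pairing_eq (σ := π x) hbdry htree hτ huniq
    (S := {y | Γ.wallPattern N R τ y = Γ.wallPattern N R τ x ∧ π y = π x}) ⟨x, rfl, rfl⟩
    (Γ.link (x, 0)) (fun l hl => congrArg freeStrand hl.2) (fun y hy => hy.1 ▸ hx) ?_
  intro l hl h hglue hlτ _ hpair
  exact hglue ⟨(hτ.wallPattern_glue hlτ h).trans hl.1, freeStrand_injective hpair⟩

lemma exists_interactionPropagation_pairing_ne_farPairing (hbdry : Nonempty Γ.OpenLeg)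
    (htree : ¬ Γ.CoarseGrainable) (hτ : Γ.IsMinCut R τ)
    (huniq : ∀ τ', Γ.IsMinCut R τ' → τ' = τ) (I : Interaction V N) :
    ∃ l, Γ.link l ∉ τ ∧
      (interactionPropagation I).pairing l ≠ (interactionPropagation I).farPairing Γ R l := by
  have hloop (l) : Γ.glue l ≠ l → (Γ.glue l).1 ≠ l.1 := glue_fst_ne hbdry htree
  by_cases htwo : Γ.link (I.node, 2) ∉ τ
  · exact ⟨_, htwo, interactionPropagation_pairing_two_ne_farPairing hloop I⟩
  obtain ⟨a, ha, σ, hσ, haσ, hbσ⟩ := exists_intStrand_eq_freeStrand_ne (I.perm I.node)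
    I.fst_ne_snd (Γ.wallPattern N R τ I.node)
  have haτ : Γ.link (I.node, a) ∉ τ :=
    link_notMem_of_link_mem hbdry htree hτ huniq ha (not_not.1 htwo)
  rw [← interactionPropagation_pairing_node] at haσ
  by_cases hmatch : (interactionPropagation I).pairing (I.node, a) ≠
      (interactionPropagation I).farPairing Γ R (I.node, a)
  · exact ⟨_, haτ, hmatch⟩
  rw [not_not, haσ] at hmatch
  have hclosed : Γ.glue (I.node, a) ≠ (I.node, a) := fun h => by
    rw [Propagation.farPairing_of_eq _ h, hτ.boundaryPerm_eq_wallPattern haτ h] at hmatch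
    exact hσ (freeStrand_injective hmatch)
  rw [Propagation.farPairing_of_ne _ hclosed,
    interactionPropagation_pairing_of_ne (hloop _ hclosed)] at hmatch
  -- The permutation `σ` would have to continue from the leg `a` of the interacting vertex through
  -- a region that it cannot leave: the second leg carries another permutation and the third one
  -- lies in the cut.
  refine exists_pairing_ne_farPairing_of_pairing_eq (σ := σ) hbdry htree hτ huniq
    (S := {y | y ≠ I.node ∧ Γ.wallPattern N R τ y = Γ.wallPattern N R τ I.node ∧ I.perm y = σ})
    ⟨_, hloop _ hclosed, hτ.wallPattern_glue haτ hclosed, (freeStrand_injective hmatch).symm⟩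
    (Γ.link (I.node, a)) (fun l hl => ?_) (fun y hy => hy.2.1 ▸ hσ) ?_
  · rw [interactionPropagation_pairing_of_ne hl.1, hl.2.2]
  · intro l hl h hglue hlτ hla hpair
    have hlink := Γ.link_glue l
    have hpattern := (hτ.wallPattern_glue (N := N) hlτ h).trans hl.2.1
    generalize Γ.glue l = l' at *
    obtain ⟨y, b⟩ := l'
    by_cases hy : y = I.node
    · subst hy
      rw [interactionPropagation_pairing_node] at hpair
      refine hbσ b ?_ ?_ hpair
      · rintro rfl
        exact htwo (hlink ▸ hlτ)
      · rintro rfl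
        exact hla hlink.symm
    · rw [interactionPropagation_pairing_of_ne hy] at hpair
      exact hglue ⟨hy, hpattern, freeStrand_injective hpair⟩

end Network

/-! ### Divergence degrees -/

namespace Propagation

variable {V L : Type*} [Finite V] [Fintype L] {Γ : Network V} {N : ℕ} {R : Set Γ.OpenLeg}
  {τ : Set Γ.Link} {𝒬 : Propagation V N L} {G : Type*} [Group G] [MeasurableSpace G]
  [MeasurableMul₂ G] [MeasurableInv G] {μ : Measure G} [IsProbabilityMeasure μ]
  [μ.IsMulLeftInvariant] {δ : G → ℝ}

lemma amplitude_le_rpow (hδ : IsDeltaFunction μ δ) (hδ1 : 1 ≤ δ 1) (hN : 0 < N)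
    (hbdry : Nonempty Γ.OpenLeg) (htree : ¬ Γ.CoarseGrainable) (hτ : Γ.IsMinCut R τ)
    (huniq : ∀ τ', Γ.IsMinCut R τ' → τ' = τ) {l : V × Fin 3} (hl : Γ.link l ∉ τ) :
    (𝒬.diagram Γ R).amplitude μ δ ≤
      δ 1 ^ (Γ.wallDegree N τ - if 𝒬.pairing l = 𝒬.farPairing Γ R l then 0 else 1) := by
  obtain ⟨I, mark, height, hI, hcard⟩ :=
    exists_eliminable_card_le (𝒬 := 𝒬) hN hbdry htree hτ huniq hl
  refine (hI.amplitude_le_pow hδ diagram_nondegenerate fun _ => rfl).trans ?_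
  rw [← Real.rpow_natCast]
  refine Real.rpow_le_rpow_of_exponent_le hδ1 ?_
  rw [Network.wallDegree]
  exact_mod_cast hcard

lemma amplitude_le_rpow_sub_one (hδ : IsDeltaFunction μ δ) (hδ1 : 1 ≤ δ 1) (hN : 0 < N)
    (hbdry : Nonempty Γ.OpenLeg) (htree : ¬ Γ.CoarseGrainable) (hτ : Γ.IsMinCut R τ)
    (huniq : ∀ τ', Γ.IsMinCut R τ' → τ' = τ)
    (hmismatch : ∃ l, Γ.link l ∉ τ ∧ 𝒬.pairing l ≠ 𝒬.farPairing Γ R l) :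
    (𝒬.diagram Γ R).amplitude μ δ ≤ δ 1 ^ (Γ.wallDegree N τ - 1) := by
  obtain ⟨l, hl, hne⟩ := hmismatch
  simpa only [if_neg hne] using
    amplitude_le_rpow (𝒬 := 𝒬) hδ hδ1 hN hbdry htree hτ huniq hl

end Propagation

namespace Network

section WallPattern

variable {V : Type*} {Γ : Network V} {N : ℕ} {R : Set Γ.OpenLeg} {τ : Set Γ.Link}

lemma isMinCut_empty [Finite V] (Γ : Network V) : Γ.IsMinCut ∅ ∅ :=
  ⟨fun a ha => absurd ha (Set.notMem_empty a), fun τ _ => by simp⟩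

lemma IsMinCut.eq_empty [Finite V] (hτ : Γ.IsMinCut ∅ τ) : τ = ∅ := by
  have hcard := hτ.2 ∅ Γ.isMinCut_empty.1
  rw [Set.ncard_empty, Nat.le_zero] at hcard
  exact (Set.ncard_eq_zero (Set.toFinite _)).1 hcard

lemma le_card_face_wallPattern [Finite V] (hN : 0 < N) (hτ : Γ.IsMinCut R τ) :
    (N : ℝ) * Nat.card Γ.Link - (N - 1) * τ.ncard ≤
      Nat.card (Γ.freeDiagram R (Γ.wallPattern N R τ)).Face := by
  rw [freeDiagram_eq]
  set 𝒬 := freePropagation (Γ.wallPattern N R τ)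
  have hfaces : Nat.card (𝒬.diagram Γ R).Face =
      ∑ e : Γ.Link, (Finset.univ.filter fun f => 𝒬.faceLink Γ R f = e).card := by
    rw [Nat.card_eq_fintype_card, ← Finset.card_univ]
    exact Finset.card_eq_sum_card_fiberwise fun f _ => Finset.mem_coe.2 (Finset.mem_univ _)
  have hlink (e : Γ.Link) : (N : ℝ) - (N - 1) * (if e ∈ τ then 1 else 0) ≤
      (Finset.univ.filter fun f => 𝒬.faceLink Γ R f = e).card := by
    split_ifs with he
    · have : (1 : ℝ) ≤ (Finset.univ.filter fun f => 𝒬.faceLink Γ R f = e).card :=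
        mod_cast Propagation.one_le_card_faces hN e
      linarith
    · obtain ⟨l, rfl⟩ := Γ.exists_eq_link e
      simpa using Propagation.le_card_faces (ρ := Γ.wallPattern N R τ l.1) rfl
        (hτ.farPairing_wallPattern he)
  calc (N : ℝ) * Nat.card Γ.Link - (N - 1) * τ.ncard
      = ∑ e : Γ.Link, ((N : ℝ) - (N - 1) * (if e ∈ τ then 1 else 0)) := by
        rw [Finset.sum_sub_distrib, ← Finset.mul_sum, Finset.sum_const, Finset.card_univ,
          nsmul_eq_mul, Finset.sum_boole, Nat.card_eq_fintype_card, Set.ncard_eq_toFinset_card',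
          Set.filter_mem_univ_eq_toFinset]
        ring
    _ ≤ Nat.card (𝒬.diagram Γ R).Face := by
        rw [hfaces, Nat.cast_sum]
        exact Finset.sum_le_sum fun e _ => hlink e

variable [Fintype V] {G : Type*} [Group G] [MeasurableSpace G] [MeasurableMul₂ G]
  [MeasurableInv G] {μ : Measure G} [IsProbabilityMeasure μ] {δ : G → ℝ}

lemma mul_rpow_le_amplitude_wallPattern (hδ : IsDeltaFunction μ δ) (hδ1 : 1 ≤ δ 1) (hN : 0 < N)
    (hτ : Γ.IsMinCut R τ) {B : Set G} (hB : MeasurableSet B) {c c' : ℝ} (hc : 0 ≤ c)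
    (hc' : 0 ≤ c') (hBμ : c' / δ 1 ≤ μ.real B)
    (hhol : ∀ h : V × Fin N → G, (∀ l, h l ∈ B) →
      ∀ f, c * δ 1 ≤ δ ((Γ.freeDiagram R (Γ.wallPattern N R τ)).holonomy h f)) :
    c ^ Nat.card (Γ.freeDiagram R (Γ.wallPattern N R τ)).Face * c' ^ Nat.card (V × Fin N) *
        δ 1 ^ Γ.wallDegree N τ ≤
      (Γ.freeDiagram R (Γ.wallPattern N R τ)).amplitude μ δ := by
  have hδ0 : 0 < δ 1 := one_pos.trans_le hδ1
  have hexp : Γ.wallDegree N τ ≤ Nat.card (Γ.freeDiagram R (Γ.wallPattern N R τ)).Face -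
      (Nat.card (V × Fin N) : ℝ) := by
    have hcard := le_card_face_wallPattern (R := R) hN hτ
    rw [wallDegree, Nat.card_prod, Nat.card_fin, Nat.cast_mul]
    linarith
  refine le_trans ?_ ((Γ.freeDiagram R _).pow_mul_pow_le_amplitude hδ hB (by positivity) hhol)
  generalize Nat.card (Γ.freeDiagram R (Γ.wallPattern N R τ)).Face = F at *
  generalize Nat.card (V × Fin N) = n at *
  calc c ^ F * c' ^ n * δ 1 ^ Γ.wallDegree N τ
      ≤ c ^ F * c' ^ n * δ 1 ^ ((F : ℝ) - n) := by gcongr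
    _ = (c * δ 1) ^ F * (c' / δ 1) ^ n := by
        rw [Real.rpow_sub hδ0, Real.rpow_natCast, Real.rpow_natCast, mul_pow, div_pow]
        ring
    _ ≤ (c * δ 1) ^ F * μ.real B ^ n := by gcongr

lemma amplitude_wallPattern_le [μ.IsMulLeftInvariant] (hδ : IsDeltaFunction μ δ)
    (hδ1 : 1 ≤ δ 1) (hN : 0 < N) (hbdry : Nonempty Γ.OpenLeg) (htree : ¬ Γ.CoarseGrainable)
    (hτ : Γ.IsMinCut R τ) (huniq : ∀ τ', Γ.IsMinCut R τ' → τ' = τ) :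
    (Γ.freeDiagram R (Γ.wallPattern N R τ)).amplitude μ δ ≤ δ 1 ^ Γ.wallDegree N τ := by
  obtain ⟨w⟩ := id hbdry
  obtain ⟨l, -, -, hl, -⟩ := exists_leaving_link_notMem hbdry htree hτ huniq
    (S := Set.univ) ⟨w.1.1, trivial⟩ (Γ.link w.1)
  rw [freeDiagram_eq]
  simpa only [if_pos (hτ.farPairing_wallPattern hl).symm, sub_zero] using
    Propagation.amplitude_le_rpow (𝒬 := freePropagation (Γ.wallPattern N R τ))
      hδ hδ1 hN hbdry htree hτ huniq hl

end WallPattern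

variable {V : Type*} [Fintype V] (Γ : Network V) (N : ℕ)

/-- Dominance of the pattern with the domain wall `τ`: its amplitude is the power of `δ(e)` with
exponent `Γ.wallDegree N τ` up to a factor in `[κ, 1]`, and every other amplitude is positive and
smaller by a factor `δ(e)`. -/
structure AmplitudeBounds (R : Set Γ.OpenLeg) (τ : Set Γ.Link) {G : Type*} [Group G]
    [MeasurableSpace G] (μ : Measure G) (δ : G → ℝ) (κ : ℝ) : Prop where
  le_wall : κ * δ 1 ^ Γ.wallDegree N τ ≤
    (Γ.freeDiagram R (Γ.wallPattern N R τ)).amplitude μ δ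
  wall_le : (Γ.freeDiagram R (Γ.wallPattern N R τ)).amplitude μ δ ≤ δ 1 ^ Γ.wallDegree N τ
  free_pos : ∀ π : V → Equiv.Perm (Fin N), 0 < (Γ.freeDiagram R π).amplitude μ δ
  free_le : ∀ π : V → Equiv.Perm (Fin N), π ≠ Γ.wallPattern N R τ →
    (Γ.freeDiagram R π).amplitude μ δ ≤ δ 1 ^ (Γ.wallDegree N τ - 1)
  interaction_pos : ∀ I : Interaction V N, 0 < (Γ.interactionDiagram R I).amplitude μ δ
  interaction_le : ∀ I : Interaction V N,
    (Γ.interactionDiagram R I).amplitude μ δ ≤ δ 1 ^ (Γ.wallDegree N τ - 1)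

/-- The partition function in units of the leading power of `δ(e)` for the domain wall `τ`. -/
def normalizedPartitionFunction (R : Set Γ.OpenLeg) (τ : Set Γ.Link) (coupling : ℝ) {G : Type*}
    [Group G] [MeasurableSpace G] (μ : Measure G) (δ : G → ℝ) : ℝ :=
  Γ.partitionFunction N R coupling μ δ / δ 1 ^ Γ.wallDegree N τ

variable (V) in
/-- The number of diagrams, those with an interaction being weighted with the coupling. -/
def diagramCount (coupling : ℝ) : ℝ :=
  Fintype.card (V → Equiv.Perm (Fin N)) + |coupling| * Fintype.card (Interaction V N)

variable {Γ N} {R : Set Γ.OpenLeg} {τ : Set Γ.Link} {G : Type*} [Group G] [MeasurableSpace G]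
  {μ : Measure G} {δ : G → ℝ} {κ : ℝ}

lemma amplitudeBounds_of_forall_le_holonomy [MeasurableMul₂ G] [MeasurableInv G]
    [IsProbabilityMeasure μ] [μ.IsMulLeftInvariant] (hδ : IsDeltaFunction μ δ) (hδ1 : 1 ≤ δ 1)
    (hN : 0 < N) (hbdry : Nonempty Γ.OpenLeg) (htree : ¬ Γ.CoarseGrainable)
    (hτ : Γ.IsMinCut R τ) (huniq : ∀ τ', Γ.IsMinCut R τ' → τ' = τ) {B : Set G}
    (hB : MeasurableSet B) {c c' : ℝ} (hc : 0 < c) (hc' : 0 < c') (hBμ : c' / δ 1 ≤ μ.real B)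
    (hfree : ∀ π : V → Equiv.Perm (Fin N), ∀ h : V × Fin N → G, (∀ l, h l ∈ B) →
      ∀ f, c * δ 1 ≤ δ ((Γ.freeDiagram R π).holonomy h f))
    (hinteraction : ∀ I : Interaction V N, ∀ h : (V × Fin N) ⊕ Fin 2 → G, (∀ l, h l ∈ B) →
      ∀ f, c * δ 1 ≤ δ ((Γ.interactionDiagram R I).holonomy h f)) :
    Γ.AmplitudeBounds N R τ μ δ
      (c ^ Nat.card (Γ.freeDiagram R (Γ.wallPattern N R τ)).Face * c' ^ Nat.card (V × Fin N)) := by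
  have hδ0 : 0 < δ 1 := one_pos.trans_le hδ1
  have hBpos : 0 < μ.real B := (div_pos hc' hδ0).trans_le hBμ
  have hpos (m n : ℕ) : 0 < (c * δ 1) ^ m * μ.real B ^ n := by positivity
  exact {
    le_wall := mul_rpow_le_amplitude_wallPattern hδ hδ1 hN hτ hB hc.le hc'.le hBμ (hfree _)
    wall_le := amplitude_wallPattern_le hδ hδ1 hN hbdry htree hτ huniq
    free_pos := fun π => (hpos _ _).trans_le <|
      (Γ.freeDiagram R π).pow_mul_pow_le_amplitude hδ hB (by positivity) (hfree π)
    free_le := fun π hπ => freeDiagram_eq Γ R π ▸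
      Propagation.amplitude_le_rpow_sub_one hδ hδ1 hN hbdry htree hτ huniq
        (exists_freePropagation_pairing_ne_farPairing hbdry htree hτ huniq hπ)
    interaction_pos := fun I => (hpos _ _).trans_le <|
      (Γ.interactionDiagram R I).pow_mul_pow_le_amplitude hδ hB (by positivity) (hinteraction I)
    interaction_le := fun I => interactionDiagram_eq Γ R I ▸
      Propagation.amplitude_le_rpow_sub_one hδ hδ1 hN hbdry htree hτ huniq
        (exists_interactionPropagation_pairing_ne_farPairing hbdry htree hτ huniq I) }

namespace AmplitudeBounds

section Degree

variable (h : Γ.AmplitudeBounds N R τ μ δ κ)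
include h

lemma degree_wall_le (hδ : 1 < δ 1) :
    (Γ.freeDiagram R (Γ.wallPattern N R τ)).degree μ δ ≤ Γ.wallDegree N τ :=
  (Real.logb_le_iff_le_rpow hδ (h.free_pos _)).2 h.wall_le

lemma le_degree_wall (hδ : 1 < δ 1) (hκ : 0 < κ) :
    Real.logb (δ 1) κ + Γ.wallDegree N τ ≤
      (Γ.freeDiagram R (Γ.wallPattern N R τ)).degree μ δ := by
  have hδ0 : 0 < δ 1 := one_pos.trans hδ
  have hpow : 0 < δ 1 ^ Γ.wallDegree N τ := Real.rpow_pos_of_pos hδ0 _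
  rw [← Real.logb_rpow hδ0 hδ.ne' (x := Γ.wallDegree N τ), ← Real.logb_mul hκ.ne' hpow.ne']
  exact Real.logb_le_logb_of_le hδ (mul_pos hκ hpow) h.le_wall

lemma degree_free_le (hδ : 1 < δ 1) {π : V → Equiv.Perm (Fin N)}
    (hπ : π ≠ Γ.wallPattern N R τ) :
    (Γ.freeDiagram R π).degree μ δ ≤ Γ.wallDegree N τ - 1 :=
  (Real.logb_le_iff_le_rpow hδ (h.free_pos π)).2 (h.free_le π hπ)

lemma degree_interaction_le (hδ : 1 < δ 1) (I : Interaction V N) :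
    (Γ.interactionDiagram R I).degree μ δ ≤ Γ.wallDegree N τ - 1 :=
  (Real.logb_le_iff_le_rpow hδ (h.interaction_pos I)).2 (h.interaction_le I)

end Degree

lemma abs_partitionFunction_sub_le (h : Γ.AmplitudeBounds N R τ μ δ κ) (hδ : 0 ≤ δ 1)
    (coupling : ℝ) :
    |Γ.partitionFunction N R coupling μ δ -
      (Γ.freeDiagram R (Γ.wallPattern N R τ)).amplitude μ δ| ≤
      diagramCount V N coupling * δ 1 ^ (Γ.wallDegree N τ - 1) := by
  have hfree : |∑ π ∈ Finset.univ.erase (Γ.wallPattern N R τ),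
      (Γ.freeDiagram R π).amplitude μ δ| ≤
      Fintype.card (V → Equiv.Perm (Fin N)) * δ 1 ^ (Γ.wallDegree N τ - 1) := by
    rw [abs_of_nonneg (Finset.sum_nonneg fun π _ => (h.free_pos π).le)]
    refine (Finset.sum_le_card_nsmul _ _ _ fun π hπ =>
      h.free_le π (Finset.ne_of_mem_erase hπ)).trans ?_
    rw [nsmul_eq_mul]
    gcongr
    exact Finset.card_le_univ _
  have hinteraction : |coupling * ∑ I : Interaction V N,
      (Γ.interactionDiagram R I).amplitude μ δ| ≤
      |coupling| * (Fintype.card (Interaction V N) * δ 1 ^ (Γ.wallDegree N τ - 1)) := by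
    rw [abs_mul, abs_of_nonneg (Finset.sum_nonneg fun I _ => (h.interaction_pos I).le)]
    gcongr
    refine (Finset.sum_le_card_nsmul _ _ _ fun I _ => h.interaction_le I).trans_eq ?_
    rw [nsmul_eq_mul, Finset.card_univ]
  rw [partitionFunction, ← Finset.add_sum_erase _ _ (Finset.mem_univ (Γ.wallPattern N R τ)),
    add_sub_assoc, add_sub_cancel_left]
  refine (abs_sub _ _).trans ((add_le_add hfree hinteraction).trans_eq ?_)
  rw [diagramCount]
  ring

lemma normalizedPartitionFunction_mem_Icc (h : Γ.AmplitudeBounds N R τ μ δ κ) (hδ : 0 < δ 1)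
    (coupling : ℝ) :
    Γ.normalizedPartitionFunction N R τ coupling μ δ ∈
      Set.Icc (κ - diagramCount V N coupling / δ 1) (1 + diagramCount V N coupling / δ 1) := by
  have hpow : 0 < δ 1 ^ Γ.wallDegree N τ := Real.rpow_pos_of_pos hδ _
  have habs := h.abs_partitionFunction_sub_le hδ.le coupling
  rw [Real.rpow_sub_one hδ.ne', mul_div_left_comm, mul_comm, abs_le] at habs
  rw [normalizedPartitionFunction, Set.mem_Icc, le_div_iff₀ hpow, div_le_iff₀ hpow]
  constructor
  · linarith [habs.1, h.le_wall]
  · linarith [habs.2, h.wall_le]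

lemma normalizedPartitionFunction_pos (h : Γ.AmplitudeBounds N R τ μ δ κ) (hδ : 0 < δ 1)
    {coupling : ℝ} (hκ : diagramCount V N coupling / δ 1 < κ) :
    0 < Γ.normalizedPartitionFunction N R τ coupling μ δ :=
  (sub_pos.2 hκ).trans_le (h.normalizedPartitionFunction_mem_Icc hδ coupling).1

end AmplitudeBounds

lemma partitionFunction_pos_of_normalized (hδ : 0 < δ 1) {coupling : ℝ}
    (h : 0 < Γ.normalizedPartitionFunction N R τ coupling μ δ) :
    0 < Γ.partitionFunction N R coupling μ δ :=
  (div_pos_iff_of_pos_right (Real.rpow_pos_of_pos hδ _)).1 h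

lemma log_partitionFunction (hδ : 0 < δ 1) {coupling : ℝ}
    (h : 0 < Γ.normalizedPartitionFunction N R τ coupling μ δ) :
    Real.log (Γ.partitionFunction N R coupling μ δ) =
      Real.log (Γ.normalizedPartitionFunction N R τ coupling μ δ) +
        Γ.wallDegree N τ * Real.log (δ 1) := by
  rw [normalizedPartitionFunction, Real.log_div (partitionFunction_pos_of_normalized hδ h).ne'
    (Real.rpow_pos_of_pos hδ _).ne', Real.log_rpow hδ, sub_add_cancel]

lemma renyiEntropy_sub_eq (hN : 2 ≤ N) (hδ : 0 < δ 1) {coupling : ℝ} {A : Set Γ.OpenLeg}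
    {σ : Set Γ.Link} (h0 : 0 < Γ.normalizedPartitionFunction N ∅ ∅ coupling μ δ)
    (hA : 0 < Γ.normalizedPartitionFunction N A σ coupling μ δ) :
    Γ.renyiEntropy N A coupling μ δ - (σ.ncard : ℝ) * Real.log (δ 1) =
      1 / (1 - (N : ℝ)) * (Real.log (Γ.normalizedPartitionFunction N A σ coupling μ δ) -
        Real.log (Γ.normalizedPartitionFunction N ∅ ∅ coupling μ δ)) := by
  have hN1 : (1 : ℝ) - N ≠ 0 := sub_ne_zero.2 (mod_cast (by omega : 1 ≠ N))
  rw [renyiEntropy, Real.log_div (partitionFunction_pos_of_normalized hδ hA).ne'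
    (partitionFunction_pos_of_normalized hδ h0).ne', log_partitionFunction hδ hA,
    log_partitionFunction hδ h0, wallDegree, wallDegree, Set.ncard_empty, Nat.cast_zero]
  field_simp
  ring

lemma abs_renyiEntropy_sub_le (hN : 2 ≤ N) (hδ : 0 < δ 1) {coupling : ℝ} {A : Set Γ.OpenLeg}
    {σ : Set Γ.Link} (h0 : 0 < Γ.normalizedPartitionFunction N ∅ ∅ coupling μ δ)
    (hA : 0 < Γ.normalizedPartitionFunction N A σ coupling μ δ) :
    |Γ.renyiEntropy N A coupling μ δ - (σ.ncard : ℝ) * Real.log (δ 1)| ≤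
      |Real.log (Γ.normalizedPartitionFunction N A σ coupling μ δ)| +
      |Real.log (Γ.normalizedPartitionFunction N ∅ ∅ coupling μ δ)| := by
  have hN' : (2 : ℝ) ≤ N := mod_cast hN
  rw [renyiEntropy_sub_eq hN hδ h0 hA, abs_mul]
  refine (mul_le_of_le_one_left (abs_nonneg _) ?_).trans (abs_sub _ _)
  rw [abs_div, abs_one, div_le_one (abs_pos.2 (by linarith)), le_abs]
  right
  linarith

end Network

/-! ### Finite groups -/

section FiniteGroup

lemma finiteDelta_one (G : Type*) [Group G] : finiteDelta G 1 = Nat.card G := if_pos rfl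

variable (G : Type*) [Group G] [Finite G] [MeasurableSpace G] [MeasurableSingletonClass G]

instance : IsProbabilityMeasure (uniformMeasure G) :=
  inferInstanceAs (IsProbabilityMeasure (ProbabilityTheory.uniformOn Set.univ))

instance : (uniformMeasure G).IsMulLeftInvariant := by
  rw [uniformMeasure, ProbabilityTheory.uniformOn, ProbabilityTheory.cond, Measure.restrict_univ]
  infer_instance

lemma uniformMeasure_real_singleton_one : (uniformMeasure G).real {1} = 1 / Nat.card G := by
  cases nonempty_fintype G
  rw [measureReal_def, uniformMeasure, ProbabilityTheory.uniformOn_univ]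
  simp

lemma isDeltaFunction_finiteDelta : IsDeltaFunction (uniformMeasure G) (finiteDelta G) where
  measurable := Measurable.of_discrete
  nonneg g := by unfold finiteDelta; positivity
  le_one g := by
    rw [finiteDelta_one, finiteDelta]
    split_ifs <;> simp
  central g k := by simp [finiteDelta, mul_inv_eq_one]
  symm g := by simp [finiteDelta]
  integral_eq_one := by
    have hindicator : finiteDelta G = Set.indicator {1} fun _ => (Nat.card G : ℝ) := by
      ext g
      simp [finiteDelta, Set.indicator_apply]
    have hcard : (Nat.card G : ℝ) ≠ 0 := Nat.cast_ne_zero.2 Nat.card_pos.ne'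
    rw [hindicator, integral_indicator_const _ (measurableSet_singleton _),
      uniformMeasure_real_singleton_one, smul_eq_mul, one_div_mul_cancel hcard]

end FiniteGroup

lemma StrandedDiagram.holonomy_of_forall_eq_one {P L : Type*} (𝒢 : StrandedDiagram P L)
    {G : Type*} [Group G] {h : L → G} (hh : ∀ l, h l = 1) (f : 𝒢.Face) :
    𝒢.holonomy h f = 1 := by
  have hlift : FreeGroup.lift h = 1 := by
    ext l
    simp [hh]
  rw [holonomy, hlift, MonoidHom.one_apply]

lemma abs_log_le_two_mul {x y : ℝ} (hx : x ≤ 1 / 2) (hy : y ∈ Set.Icc (1 - x) (1 + x)) :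
    |Real.log y| ≤ 2 * x := by
  obtain ⟨hl, hu⟩ := hy
  have hy0 : 0 < y := by linarith
  have hinv : y⁻¹ ≤ 1 + 2 * x := by
    rw [inv_le_iff_one_le_mul₀ hy0]
    nlinarith
  rw [abs_le]
  constructor
  · linarith [Real.one_sub_inv_le_log_of_pos hy0]
  · linarith [Real.log_le_sub_one_of_pos hy0]

namespace Network

variable {V : Type*} [Fintype V] {Γ : Network V} {N : ℕ} {R : Set Γ.OpenLeg} {τ : Set Γ.Link}

lemma amplitudeBounds_finiteDelta (hN : 0 < N) (hbdry : Nonempty Γ.OpenLeg)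
    (htree : ¬ Γ.CoarseGrainable) (hτ : Γ.IsMinCut R τ)
    (huniq : ∀ τ', Γ.IsMinCut R τ' → τ' = τ) (G : Type*) [Group G] [Finite G]
    [MeasurableSpace G] [MeasurableSingletonClass G] :
    Γ.AmplitudeBounds N R τ (uniformMeasure G) (finiteDelta G) 1 := by
  have hcard : (1 : ℝ) ≤ finiteDelta G 1 := by
    rw [finiteDelta_one]
    exact_mod_cast Nat.card_pos
  simpa only [one_pow, mul_one] using
    amplitudeBounds_of_forall_le_holonomy (Γ := Γ) (N := N) (B := {(1 : G)}) (c := 1) (c' := 1)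
      (isDeltaFunction_finiteDelta G) hcard hN hbdry htree hτ huniq
      (measurableSet_singleton _) one_pos one_pos
      (by rw [uniformMeasure_real_singleton_one, finiteDelta_one])
      (fun π h hh f => by rw [StrandedDiagram.holonomy_of_forall_eq_one _ hh, one_mul])
      (fun I h hh f => by rw [StrandedDiagram.holonomy_of_forall_eq_one _ hh, one_mul])

variable {G : Type*} [Group G] [MeasurableSpace G] {μ : Measure G} {δ : G → ℝ}

namespace AmplitudeBounds

lemma degree_wall_eq (h : Γ.AmplitudeBounds N R τ μ δ 1) (hδ : 1 < δ 1) :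
    (Γ.freeDiagram R (Γ.wallPattern N R τ)).degree μ δ = Γ.wallDegree N τ := by
  refine (h.degree_wall_le hδ).antisymm ?_
  simpa only [Real.logb_one, zero_add] using h.le_degree_wall hδ one_pos

lemma degree_free_lt (h : Γ.AmplitudeBounds N R τ μ δ 1) (hδ : 1 < δ 1)
    {π : V → Equiv.Perm (Fin N)} (hπ : π ≠ Γ.wallPattern N R τ) :
    (Γ.freeDiagram R π).degree μ δ <
      (Γ.freeDiagram R (Γ.wallPattern N R τ)).degree μ δ := by
  rw [h.degree_wall_eq hδ]
  exact (h.degree_free_le hδ hπ).trans_lt (sub_one_lt _)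

lemma degree_interaction_lt (h : Γ.AmplitudeBounds N R τ μ δ 1) (hδ : 1 < δ 1)
    (I : Interaction V N) :
    (Γ.interactionDiagram R I).degree μ δ <
      (Γ.freeDiagram R (Γ.wallPattern N R τ)).degree μ δ := by
  rw [h.degree_wall_eq hδ]
  exact (h.degree_interaction_le hδ I).trans_lt (sub_one_lt _)

lemma partitionFunction_pos (h : Γ.AmplitudeBounds N R τ μ δ 1) (hδ : 0 < δ 1) {coupling : ℝ}
    (hlarge : 2 * diagramCount V N coupling ≤ δ 1) :
    0 < Γ.partitionFunction N R coupling μ δ :=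
  partitionFunction_pos_of_normalized hδ <|
    h.normalizedPartitionFunction_pos hδ ((div_lt_one hδ).2 (by linarith))

lemma abs_renyiEntropy_sub_le {A : Set Γ.OpenLeg} {σ : Set Γ.Link}
    (h₀ : Γ.AmplitudeBounds N ∅ ∅ μ δ 1) (hA : Γ.AmplitudeBounds N A σ μ δ 1) (hN : 2 ≤ N)
    (hδ : 0 < δ 1) {coupling : ℝ} (hlarge : 2 * diagramCount V N coupling ≤ δ 1) :
    |Γ.renyiEntropy N A coupling μ δ - (σ.ncard : ℝ) * Real.log (δ 1)| ≤
      4 * diagramCount V N coupling / δ 1 := by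
  have hsmall : diagramCount V N coupling / δ 1 ≤ 1 / 2 := by
    rw [div_le_iff₀ hδ]
    linarith
  have hone : diagramCount V N coupling / δ 1 < 1 := hsmall.trans_lt one_half_lt_one
  refine (Network.abs_renyiEntropy_sub_le hN hδ (h₀.normalizedPartitionFunction_pos hδ hone)
    (hA.normalizedPartitionFunction_pos hδ hone)).trans ?_
  refine (add_le_add
    (abs_log_le_two_mul hsmall (hA.normalizedPartitionFunction_mem_Icc hδ coupling))
    (abs_log_le_two_mul hsmall (h₀.normalizedPartitionFunction_mem_Icc hδ coupling))).trans_eq ?_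
  ring

end AmplitudeBounds

lemma exists_forall_abs_renyiEntropy_finiteDelta_sub_le {A : Set Γ.OpenLeg} {σ : Set Γ.Link}
    (hN : 2 ≤ N) (hbdry : Nonempty Γ.OpenLeg) (htree : ¬ Γ.CoarseGrainable)
    (hσ : Γ.IsMinCut A σ) (huniq : ∀ τ, Γ.IsMinCut A τ → τ = σ) (coupling : ℝ) :
    ∃ (C : ℝ) (D₀ : ℕ), ∀ (G : Type*) [Group G] [Finite G] [MeasurableSpace G]
      [MeasurableSingletonClass G], D₀ ≤ Nat.card G →
        0 < Γ.partitionFunction N ∅ coupling (uniformMeasure G) (finiteDelta G) ∧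
        0 < Γ.partitionFunction N A coupling (uniformMeasure G) (finiteDelta G) ∧
        |Γ.renyiEntropy N A coupling (uniformMeasure G) (finiteDelta G)
            - (σ.ncard : ℝ) * Real.log (Nat.card G)| ≤ C / Nat.card G := by
  refine ⟨4 * diagramCount V N coupling, ⌈2 * diagramCount V N coupling⌉₊,
    fun G _ _ _ _ hG => ?_⟩
  have hN0 : 0 < N := by omega
  have hlarge : 2 * diagramCount V N coupling ≤ finiteDelta G 1 := by
    rw [finiteDelta_one]
    exact Nat.ceil_le.1 hG
  have hδ : 0 < finiteDelta G 1 := by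
    rw [finiteDelta_one]
    exact_mod_cast Nat.card_pos
  have hb₀ := amplitudeBounds_finiteDelta hN0 hbdry htree Γ.isMinCut_empty
    (fun _ => IsMinCut.eq_empty) G
  have hb := amplitudeBounds_finiteDelta hN0 hbdry htree hσ huniq G
  rw [← finiteDelta_one]
  exact ⟨hb₀.partitionFunction_pos hδ hlarge, hb.partitionFunction_pos hδ hlarge,
    hb₀.abs_renyiEntropy_sub_le hb hN hδ hlarge⟩

end Network

/-! ### Compact groups -/

section CompactGroup

lemma measureReal_closedBall_mul_le {X : Type*} [PseudoMetricSpace X] [MeasurableSpace X]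
    (μ : Measure X) [IsFiniteMeasure μ] [IsUnifLocDoublingMeasure μ] {K r : ℝ} (hK : 0 < K)
    (hr : r ≤ IsUnifLocDoublingMeasure.scalingScaleOf μ K) (x : X) :
    μ.real (Metric.closedBall x (K * r)) ≤
      IsUnifLocDoublingMeasure.scalingConstantOf μ K * μ.real (Metric.closedBall x r) := by
  simpa only [measureReal_def, ENNReal.toReal_mul, ENNReal.coe_toReal] using
    ENNReal.toReal_mono (ENNReal.mul_ne_top ENNReal.coe_ne_top (measure_ne_top μ _))
      (IsUnifLocDoublingMeasure.measure_mul_le_scalingConstantOf_mul μ ⟨hK, le_rfl⟩ hr)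

lemma IsDeltaFunction.mul_measureReal_le_one {G : Type*} [Group G] [MeasurableSpace G]
    {μ : Measure G} [IsFiniteMeasure μ] {δ : G → ℝ}
    (hδ : IsDeltaFunction μ δ) {B : Set G} {b : ℝ} (hb : 0 ≤ b) (hB : ∀ g ∈ B, b ≤ δ g) :
    b * μ.real B ≤ 1 := by
  rw [← hδ.integral_eq_one]
  exact (mul_le_mul_of_nonneg_left (measureReal_mono hB) hb).trans
    (mul_meas_ge_le_integral_of_nonneg (ae_of_all _ hδ.nonneg) hδ.integrable b)

variable {G : Type*} [Group G]

section Holonomy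

variable [PseudoMetricSpace G] [IsIsometricSMul G G]

lemma exists_dist_lift_one_le {L : Type*} (w : FreeGroup L) :
    ∃ M : ℝ, ∀ (h : L → G) (ε : ℝ), (∀ l, dist (h l) 1 ≤ ε) →
      dist (FreeGroup.lift h w) 1 ≤ M * ε := by
  induction w using FreeGroup.induction_on with
  | C1 => exact ⟨0, fun h ε _ => by simp⟩
  | of l => exact ⟨1, fun h ε hε => by simpa using hε l⟩
  | inv_of l _ =>
    refine ⟨1, fun h ε hε => ?_⟩
    have hinv : dist (h l)⁻¹ 1 = dist (h l) 1 := by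
      rw [← dist_mul_left (h l), mul_inv_cancel, mul_one, dist_comm]
    simpa [hinv] using hε l
  | mul x y hx hy =>
    obtain ⟨M, hM⟩ := hx
    obtain ⟨M', hM'⟩ := hy
    refine ⟨M + M', fun h ε hε => ?_⟩
    calc dist (FreeGroup.lift h (x * y)) 1
        ≤ dist (FreeGroup.lift h x * FreeGroup.lift h y) (FreeGroup.lift h x * 1) +
            dist (FreeGroup.lift h x) 1 := by
          rw [map_mul, mul_one]
          exact dist_triangle _ _ _
      _ ≤ (M + M') * ε := by
          rw [dist_mul_left]
          linarith [hM h ε hε, hM' h ε hε]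

lemma exists_dist_holonomy_one_le {ι P L : Type*} [Finite ι] [Finite P]
    (𝒢 : ι → StrandedDiagram P L) :
    ∃ M : ℝ, ∀ i (h : L → G) (ε : ℝ), 0 ≤ ε → (∀ l, h l ∈ Metric.closedBall 1 ε) →
      ∀ f, dist ((𝒢 i).holonomy h f) 1 ≤ M * ε := by
  choose M hM using fun q : Σ i, (𝒢 i).Face =>
    exists_dist_lift_one_le (G := G)
      ((𝒢 q.1).word (Quotient.out (s := (𝒢 q.1).faceSetoid) q.2))
  obtain ⟨K, hK⟩ := (Set.finite_range M).bddAbove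
  exact ⟨K, fun i h ε hε hh f => (hM ⟨i, f⟩ h ε hh).trans
    (mul_le_mul_of_nonneg_right (hK ⟨_, rfl⟩) hε)⟩

end Holonomy

section Regularisation

variable [MetricSpace G] [MeasurableSpace G] {μ : Measure G} {δ : ℕ → G → ℝ}

namespace IsDeltaRegularisation

lemma isDeltaFunction (h : IsDeltaRegularisation μ δ) (n : ℕ) : IsDeltaFunction μ (δ n) :=
  ⟨h.measurable n, h.nonneg n, h.le_one n, h.central n, h.symm n, h.integral_eq_one n⟩

variable [IsProbabilityMeasure μ] [μ.IsOpenPosMeasure]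

lemma eventually_radius_le (h : IsDeltaRegularisation μ δ) {c s : ℝ} (hc : 0 < c)
    (hs : 0 < s) :
    ∀ᶠ n in atTop, ∀ r, (∀ g ∈ Metric.closedBall 1 r, c * δ n 1 ≤ δ n g) → r ≤ s := by
  have hvol : 0 < μ.real (Metric.closedBall (1 : G) s) :=
    ENNReal.toReal_pos (Metric.measure_closedBall_pos μ 1 hs).ne' (measure_ne_top μ _)
  filter_upwards [h.tendsto.eventually_gt_atTop 0,
    h.tendsto.eventually_gt_atTop (1 / (c * μ.real (Metric.closedBall (1 : G) s)))]
    with n hpos hlarge r hr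
  by_contra! hsr
  rw [div_lt_iff₀ (mul_pos hc hvol)] at hlarge
  have := (h.isDeltaFunction n).mul_measureReal_le_one (mul_nonneg hc.le hpos.le)
    fun g hg => hr g (Metric.closedBall_subset_closedBall hsr.le hg)
  linarith

lemma exists_eventually_exists_radius [IsUnifLocDoublingMeasure μ]
    (h : IsDeltaRegularisation μ δ) {K : ℝ} (hK : 0 < K) :
    ∃ c c' : ℝ, 0 < c ∧ 0 < c' ∧ ∀ᶠ n in atTop, ∃ ε : ℝ, 0 ≤ ε ∧
      (∀ g : G, dist g 1 ≤ K * ε → c * δ n 1 ≤ δ n g) ∧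
      c' / δ n 1 ≤ μ.real (Metric.closedBall 1 ε) := by
  obtain ⟨c, hc, hcomparable⟩ := h.comparable
  have hscale := IsUnifLocDoublingMeasure.scalingScaleOf_pos μ K
  have hC : (0 : ℝ) < IsUnifLocDoublingMeasure.scalingConstantOf μ K := by
    exact_mod_cast one_pos.trans_le (IsUnifLocDoublingMeasure.one_le_scalingConstantOf μ K)
  refine ⟨c, c / IsUnifLocDoublingMeasure.scalingConstantOf μ K, hc, div_pos hc hC, ?_⟩
  filter_upwards [h.tendsto.eventually_gt_atTop 0,
    h.eventually_radius_le hc (mul_pos hK hscale)] with n hpos hradius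
  obtain ⟨r, hr, hball, hvol⟩ := hcomparable n
  have hdoubling := measureReal_closedBall_mul_le μ hK ((div_le_iff₀' hK).2 (hradius r hball)) 1
  rw [mul_div_cancel₀ _ hK.ne'] at hdoubling
  refine ⟨r / K, (div_pos hr hK).le, fun g hg => hball g ?_, ?_⟩
  · rwa [mul_div_cancel₀ _ hK.ne'] at hg
  · rw [div_div, div_le_iff₀ (mul_pos hC hpos)]
    linarith [mul_le_mul_of_nonneg_left hdoubling hpos.le]

end IsDeltaRegularisation

lemma Network.exists_eventually_amplitudeBounds {V : Type*} [Fintype V] {Γ : Network V} {N : ℕ}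
    {R : Set Γ.OpenLeg} {τ : Set Γ.Link} (hN : 0 < N) (hbdry : Nonempty Γ.OpenLeg)
    (htree : ¬ Γ.CoarseGrainable) (hτ : Γ.IsMinCut R τ)
    (huniq : ∀ τ', Γ.IsMinCut R τ' → τ' = τ) [IsTopologicalGroup G] [CompactSpace G]
    [IsIsometricSMul G G] [BorelSpace G] [μ.IsHaarMeasure] [IsProbabilityMeasure μ]
    [IsUnifLocDoublingMeasure μ] (h : IsDeltaRegularisation μ δ) :
    ∃ κ : ℝ, 0 < κ ∧ ∀ᶠ n in atTop, Γ.AmplitudeBounds N R τ μ (δ n) κ := by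
  obtain ⟨M, hM⟩ := exists_dist_holonomy_one_le (G := G)
    fun π : V → Equiv.Perm (Fin N) => Γ.freeDiagram R π
  obtain ⟨M', hM'⟩ := exists_dist_holonomy_one_le (G := G)
    fun I : Interaction V N => Γ.interactionDiagram R I
  obtain ⟨c, c', hc, hc', hradius⟩ :=
    h.exists_eventually_exists_radius (K := max 1 (max M M')) (by positivity)
  refine ⟨c ^ Nat.card (Γ.freeDiagram R (Γ.wallPattern N R τ)).Face * c' ^ Nat.card (V × Fin N),
    by positivity, ?_⟩
  filter_upwards [hradius, h.tendsto.eventually_ge_atTop 1] with n ⟨ε, hε, hball, hvol⟩ hn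
  refine amplitudeBounds_of_forall_le_holonomy (h.isDeltaFunction n) hn hN hbdry htree hτ huniq
    (B := Metric.closedBall 1 ε) Metric.isClosed_closedBall.measurableSet hc hc' hvol
    (fun π g hg f => hball _ ((hM π g ε hε hg f).trans ?_))
    (fun I g hg f => hball _ ((hM' I g ε hε hg f).trans ?_))
  · gcongr
    exact (le_max_left _ _).trans (le_max_right _ _)
  · gcongr
    exact (le_max_right _ _).trans (le_max_right _ _)

end Regularisation

end CompactGroup

namespace Network

variable {V : Type*} [Fintype V] {Γ : Network V} {N : ℕ} {R : Set Γ.OpenLeg} {τ : Set Γ.Link}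
  {G : Type*} [Group G] [MeasurableSpace G] {μ : Measure G} {ι : Type*} {l : Filter ι}
  {δ : ι → G → ℝ} {κ : ℝ}

lemma tendsto_degree_wall (hκ : 0 < κ) (h : ∀ᶠ n in l, Γ.AmplitudeBounds N R τ μ (δ n) κ)
    (hδ : Tendsto (fun n => δ n 1) l atTop) :
    Tendsto (fun n => (Γ.freeDiagram R (Γ.wallPattern N R τ)).degree μ (δ n)) l
      (𝓝 (Γ.wallDegree N τ)) := by
  have hlower : Tendsto (fun n => Real.logb (δ n 1) κ + Γ.wallDegree N τ) l
      (𝓝 (Γ.wallDegree N τ)) := by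
    simpa [Real.logb] using ((tendsto_const_nhds (x := Real.log κ)).div_atTop
      (Real.tendsto_log_atTop.comp hδ)).add_const (Γ.wallDegree N τ)
  refine tendsto_of_tendsto_of_tendsto_of_le_of_le' hlower tendsto_const_nhds ?_ ?_
  · filter_upwards [h, hδ.eventually_gt_atTop 1] with n hn hn1 using hn.le_degree_wall hn1 hκ
  · filter_upwards [h, hδ.eventually_gt_atTop 1] with n hn hn1 using hn.degree_wall_le hn1

lemma exists_eventually_degree_free_le
    (h : ∀ᶠ n in l, Γ.AmplitudeBounds N R τ μ (δ n) κ) (hδ : Tendsto (fun n => δ n 1) l atTop)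
    {π : V → Equiv.Perm (Fin N)} (hπ : π ≠ Γ.wallPattern N R τ) :
    ∃ ω < Γ.wallDegree N τ, ∀ᶠ n in l, (Γ.freeDiagram R π).degree μ (δ n) ≤ ω := by
  refine ⟨_, sub_one_lt _, ?_⟩
  filter_upwards [h, hδ.eventually_gt_atTop 1] with n hn hn1 using hn.degree_free_le hn1 hπ

lemma exists_eventually_degree_interaction_le
    (h : ∀ᶠ n in l, Γ.AmplitudeBounds N R τ μ (δ n) κ) (hδ : Tendsto (fun n => δ n 1) l atTop)
    (I : Interaction V N) :
    ∃ ω < Γ.wallDegree N τ, ∀ᶠ n in l, (Γ.interactionDiagram R I).degree μ (δ n) ≤ ω := by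
  refine ⟨_, sub_one_lt _, ?_⟩
  filter_upwards [h, hδ.eventually_gt_atTop 1] with n hn hn1 using hn.degree_interaction_le hn1 I

lemma eventually_normalizedPartitionFunction_mem_Icc (hκ : 0 < κ)
    (h : ∀ᶠ n in l, Γ.AmplitudeBounds N R τ μ (δ n) κ) (hδ : Tendsto (fun n => δ n 1) l atTop)
    (coupling : ℝ) :
    ∀ᶠ n in l, Γ.normalizedPartitionFunction N R τ coupling μ (δ n) ∈ Set.Icc (κ / 2) 2 := by
  have hcorrection : Tendsto (fun n => diagramCount V N coupling / δ n 1) l (𝓝 0) :=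
    tendsto_const_nhds.div_atTop hδ
  filter_upwards [h, hδ.eventually_gt_atTop 0, hcorrection.eventually_le_const (half_pos hκ),
    hcorrection.eventually_le_const one_pos] with n hn hpos hhalf hone
  exact Set.Icc_subset_Icc (by linarith) (by linarith)
    (hn.normalizedPartitionFunction_mem_Icc hpos coupling)

lemma eventually_partitionFunction_pos (hκ : 0 < κ)
    (h : ∀ᶠ n in l, Γ.AmplitudeBounds N R τ μ (δ n) κ) (hδ : Tendsto (fun n => δ n 1) l atTop)
    (coupling : ℝ) : ∀ᶠ n in l, 0 < Γ.partitionFunction N R coupling μ (δ n) := by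
  filter_upwards [eventually_normalizedPartitionFunction_mem_Icc hκ h hδ coupling,
    hδ.eventually_gt_atTop 0] with n hn hpos
  exact partitionFunction_pos_of_normalized hpos ((half_pos hκ).trans_le hn.1)

lemma isBigO_renyiEntropy_sub {A : Set Γ.OpenLeg} {σ : Set Γ.Link} {κ₀ : ℝ} (hN : 2 ≤ N)
    (hκ₀ : 0 < κ₀) (h₀ : ∀ᶠ n in l, Γ.AmplitudeBounds N ∅ ∅ μ (δ n) κ₀) (hκ : 0 < κ)
    (hA : ∀ᶠ n in l, Γ.AmplitudeBounds N A σ μ (δ n) κ)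
    (hδ : Tendsto (fun n => δ n 1) l atTop) (coupling : ℝ) :
    (fun n => Γ.renyiEntropy N A coupling μ (δ n) - (σ.ncard : ℝ) * Real.log (δ n 1))
      =O[l] (fun _ => (1 : ℝ)) := by
  have habs {a y : ℝ} (ha : 0 < a) (hy : y ∈ Set.Icc a 2) :
      |Real.log y| ≤ max |Real.log a| |Real.log 2| :=
    abs_le_max_abs_abs (Real.log_le_log ha hy.1) (Real.log_le_log (ha.trans_le hy.1) hy.2)
  refine IsBigO.of_bound (max |Real.log (κ / 2)| |Real.log 2| +
    max |Real.log (κ₀ / 2)| |Real.log 2|) ?_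
  filter_upwards [eventually_normalizedPartitionFunction_mem_Icc hκ₀ h₀ hδ coupling,
    eventually_normalizedPartitionFunction_mem_Icc hκ hA hδ coupling,
    hδ.eventually_gt_atTop 0] with n hn₀ hnA hpos
  rw [norm_one, mul_one, Real.norm_eq_abs]
  exact (abs_renyiEntropy_sub_le hN hpos ((half_pos hκ₀).trans_le hn₀.1)
    ((half_pos hκ).trans_le hnA.1)).trans
    (add_le_add (habs (half_pos hκ) hnA) (habs (half_pos hκ₀) hn₀))

end Network

end GFT

end

open GFT.Network in
theorem mainTheorem1_general {V : Type*} [Fintype V] (Γ : GFT.Network V)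
    (A : Set Γ.OpenLeg) (σ : Set Γ.Link)
    (hbdry : Nonempty Γ.OpenLeg) (htree : ¬ Γ.CoarseGrainable)
    (hσ : Γ.IsMinCut A σ) (hσ_unique : ∀ τ, Γ.IsMinCut A τ → τ = σ)
    (N : ℕ) (hN : 2 ≤ N) :
    (∀ (G : Type*) [Group G] [Finite G] [MeasurableSpace G] [MeasurableSingletonClass G],
      2 ≤ Nat.card G →
      ∀ (R : Set Γ.OpenLeg) (τ : Set Γ.Link), (R = ∅ ∧ τ = ∅) ∨ (R = A ∧ τ = σ) →
        (Γ.freeDiagram R (Γ.wallPattern N R τ)).degree (GFT.uniformMeasure G)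
            (GFT.finiteDelta G) = Γ.wallDegree N τ ∧
        (∀ π : V → Equiv.Perm (Fin N), π ≠ Γ.wallPattern N R τ →
          (Γ.freeDiagram R π).degree (GFT.uniformMeasure G) (GFT.finiteDelta G) <
            (Γ.freeDiagram R (Γ.wallPattern N R τ)).degree (GFT.uniformMeasure G)
              (GFT.finiteDelta G)) ∧
        (∀ I : GFT.Interaction V N,
          (Γ.interactionDiagram R I).degree (GFT.uniformMeasure G) (GFT.finiteDelta G) <
            (Γ.freeDiagram R (Γ.wallPattern N R τ)).degree (GFT.uniformMeasure G)
              (GFT.finiteDelta G))) ∧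
    (∀ coupling : ℝ, ∃ (C : ℝ) (D₀ : ℕ),
      ∀ (G : Type*) [Group G] [Finite G] [MeasurableSpace G] [MeasurableSingletonClass G],
        D₀ ≤ Nat.card G →
        0 < Γ.partitionFunction N ∅ coupling (GFT.uniformMeasure G) (GFT.finiteDelta G) ∧
        0 < Γ.partitionFunction N A coupling (GFT.uniformMeasure G) (GFT.finiteDelta G) ∧
        |Γ.renyiEntropy N A coupling (GFT.uniformMeasure G) (GFT.finiteDelta G)
            - (σ.ncard : ℝ) * Real.log (Nat.card G)| ≤ C / Nat.card G) ∧
    (∀ (G : Type*) [Group G] [MetricSpace G] [IsTopologicalGroup G] [CompactSpace G]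
      [IsIsometricSMul G G] [MeasurableSpace G] [BorelSpace G]
      (μ : Measure G) [μ.IsHaarMeasure] [IsProbabilityMeasure μ] [IsUnifLocDoublingMeasure μ]
      (δ : ℕ → G → ℝ), GFT.IsDeltaRegularisation μ δ →
      (∀ (R : Set Γ.OpenLeg) (τ : Set Γ.Link), (R = ∅ ∧ τ = ∅) ∨ (R = A ∧ τ = σ) →
        Tendsto (fun n => (Γ.freeDiagram R (Γ.wallPattern N R τ)).degree μ (δ n)) atTop
          (𝓝 (Γ.wallDegree N τ)) ∧
        (∀ π : V → Equiv.Perm (Fin N), π ≠ Γ.wallPattern N R τ →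
          ∃ ω < Γ.wallDegree N τ, ∀ᶠ n in atTop, (Γ.freeDiagram R π).degree μ (δ n) ≤ ω) ∧
        (∀ I : GFT.Interaction V N,
          ∃ ω < Γ.wallDegree N τ, ∀ᶠ n in atTop,
            (Γ.interactionDiagram R I).degree μ (δ n) ≤ ω)) ∧
      (∀ coupling : ℝ,
        (∀ᶠ n in atTop, 0 < Γ.partitionFunction N ∅ coupling μ (δ n) ∧
          0 < Γ.partitionFunction N A coupling μ (δ n)) ∧
        (fun n => Γ.renyiEntropy N A coupling μ (δ n) - (σ.ncard : ℝ) * Real.log (δ n 1))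
          =O[atTop] (fun _ => (1 : ℝ)))) := by
  have hN0 : 0 < N := by omega
  have hcut (R : Set Γ.OpenLeg) (τ : Set Γ.Link) (h : (R = ∅ ∧ τ = ∅) ∨ (R = A ∧ τ = σ)) :
      Γ.IsMinCut R τ ∧ ∀ τ', Γ.IsMinCut R τ' → τ' = τ := by
    rcases h with ⟨rfl, rfl⟩ | ⟨rfl, rfl⟩
    exacts [⟨Γ.isMinCut_empty, fun _ => IsMinCut.eq_empty⟩, ⟨hσ, hσ_unique⟩]
  refine ⟨fun G _ _ _ _ hG R τ hRτ => ?_, fun coupling => ?_,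
    fun G _ _ _ _ _ _ _ μ _ _ _ δ hδ => ⟨fun R τ hRτ => ?_, fun coupling => ?_⟩⟩
  · obtain ⟨hτ, huniq⟩ := hcut R τ hRτ
    have hb := amplitudeBounds_finiteDelta hN0 hbdry htree hτ huniq G
    have hδ : 1 < GFT.finiteDelta G 1 := by rw [GFT.finiteDelta_one]; exact_mod_cast hG
    exact ⟨hb.degree_wall_eq hδ, fun π hπ => hb.degree_free_lt hδ hπ,
      fun I => hb.degree_interaction_lt hδ I⟩
  · exact exists_forall_abs_renyiEntropy_finiteDelta_sub_le hN hbdry htree hσ hσ_unique coupling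
  · obtain ⟨hτ, huniq⟩ := hcut R τ hRτ
    obtain ⟨κ, hκ, hb⟩ := exists_eventually_amplitudeBounds hN0 hbdry htree hτ huniq hδ
    exact ⟨tendsto_degree_wall hκ hb hδ.tendsto,
      fun π hπ => exists_eventually_degree_free_le hb hδ.tendsto hπ,
      fun I => exists_eventually_degree_interaction_le hb hδ.tendsto I⟩
  · obtain ⟨h₀, huniq₀⟩ := hcut ∅ ∅ (.inl ⟨rfl, rfl⟩)
    obtain ⟨κ₀, hκ₀, hb₀⟩ := exists_eventually_amplitudeBounds hN0 hbdry htree h₀ huniq₀ hδ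
    obtain ⟨κ, hκ, hb⟩ := exists_eventually_amplitudeBounds hN0 hbdry htree hσ hσ_unique hδ
    exact ⟨(eventually_partitionFunction_pos hκ₀ hb₀ hδ.tendsto coupling).and
        (eventually_partitionFunction_pos hκ hb hδ.tendsto coupling),
      isBigO_renyiEntropy_sub hN hκ₀ hb₀ hκ hb hδ.tendsto coupling⟩

theorem mainTheorem1 {V : Type*} [Fintype V] (Γ : GFT.Network V)
    (A : Set Γ.OpenLeg) (σ : Set Γ.Link)
    (hΓ : Γ.Connected) (hbdry : Nonempty Γ.OpenLeg) (htree : ¬ Γ.CoarseGrainable)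
    (hσ : Γ.IsMinCut A σ) (hσ_unique : ∀ τ, Γ.IsMinCut A τ → τ = σ)
    (N : ℕ) (hN : 2 ≤ N) :
    -- finite groups: the two boundary situations `Z_0` (no wall) and `Z_A` (wall `σ`)
    (∀ (G : Type*) [Group G] [Finite G] [MeasurableSpace G] [MeasurableSingletonClass G],
      2 ≤ Nat.card G →
      ∀ (R : Set Γ.OpenLeg) (τ : Set Γ.Link), (R = ∅ ∧ τ = ∅) ∨ (R = A ∧ τ = σ) →
        (Γ.freeDiagram R (Γ.wallPattern N R τ)).degree (GFT.uniformMeasure G)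
            (GFT.finiteDelta G) = Γ.wallDegree N τ ∧
        (∀ π : V → Equiv.Perm (Fin N), π ≠ Γ.wallPattern N R τ →
          (Γ.freeDiagram R π).degree (GFT.uniformMeasure G) (GFT.finiteDelta G) <
            (Γ.freeDiagram R (Γ.wallPattern N R τ)).degree (GFT.uniformMeasure G)
              (GFT.finiteDelta G)) ∧
        (∀ I : GFT.Interaction V N,
          (Γ.interactionDiagram R I).degree (GFT.uniformMeasure G) (GFT.finiteDelta G) <
            (Γ.freeDiagram R (Γ.wallPattern N R τ)).degree (GFT.uniformMeasure G)
              (GFT.finiteDelta G))) ∧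
    -- finite groups: the entropy formula, with error `O(1 / δ(e))`
    (∀ coupling : ℝ, ∃ (C : ℝ) (D₀ : ℕ),
      ∀ (G : Type*) [Group G] [Finite G] [MeasurableSpace G] [MeasurableSingletonClass G],
        D₀ ≤ Nat.card G →
        0 < Γ.partitionFunction N ∅ coupling (GFT.uniformMeasure G) (GFT.finiteDelta G) ∧
        0 < Γ.partitionFunction N A coupling (GFT.uniformMeasure G) (GFT.finiteDelta G) ∧
        |Γ.renyiEntropy N A coupling (GFT.uniformMeasure G) (GFT.finiteDelta G)
            - (σ.ncard : ℝ) * Real.log (Nat.card G)| ≤ C / Nat.card G) ∧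
    -- compact groups with a regularised delta function
    (∀ (G : Type*) [Group G] [MetricSpace G] [IsTopologicalGroup G] [CompactSpace G]
      [IsIsometricSMul G G] [MeasurableSpace G] [BorelSpace G]
      (μ : Measure G) [μ.IsHaarMeasure] [IsProbabilityMeasure μ] [IsUnifLocDoublingMeasure μ]
      (δ : ℕ → G → ℝ), GFT.IsDeltaRegularisation μ δ →
      (∀ (R : Set Γ.OpenLeg) (τ : Set Γ.Link), (R = ∅ ∧ τ = ∅) ∨ (R = A ∧ τ = σ) →
        Tendsto (fun n => (Γ.freeDiagram R (Γ.wallPattern N R τ)).degree μ (δ n)) atTop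
          (𝓝 (Γ.wallDegree N τ)) ∧
        (∀ π : V → Equiv.Perm (Fin N), π ≠ Γ.wallPattern N R τ →
          ∃ ω < Γ.wallDegree N τ, ∀ᶠ n in atTop, (Γ.freeDiagram R π).degree μ (δ n) ≤ ω) ∧
        (∀ I : GFT.Interaction V N,
          ∃ ω < Γ.wallDegree N τ, ∀ᶠ n in atTop,
            (Γ.interactionDiagram R I).degree μ (δ n) ≤ ω)) ∧
      (∀ coupling : ℝ,
        (∀ᶠ n in atTop, 0 < Γ.partitionFunction N ∅ coupling μ (δ n) ∧
          0 < Γ.partitionFunction N A coupling μ (δ n)) ∧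
        (fun n => Γ.renyiEntropy N A coupling μ (δ n) - (σ.ncard : ℝ) * Real.log (δ n 1))
          =O[atTop] (fun _ => (1 : ℝ)))) :=
  mainTheorem1_general Γ A σ hbdry htree hσ hσ_unique N hN
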